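/- Let $\mathbb T=\mathbb R/2\pi\mathbb Z$ with normalized Lebesgue measure, let $\Pi\big(\sum_{k\in\mathbb Z}u_ke^{ikx}\big)=\sum_{k\ge 0}u_ke^{ikx}$ be the Szegő projector on $L^2(\mathbb T)$, and let $H^{1/2}_+$ be the space of $u\in L^2(\mathbb T)$ with $\hat u(k)=0$ for $k<0$ and $\|u\|_{H^{1/2}}^2:=\sum_{k}(1+|k|)|\hat u(k)|^2<\infty$, a function being identified with its holomorphic extension $u(z)=\sum_{k\ge 0}\hat u(k)z^k$, $|z|<1$. Consider the quadratic Szegő equation $$i\partial_t u=2J(u)\,\Pi(|u|^2)+\overline{J(u)}\,u^2,\qquad J(u):=\int_{\mathbb T}|u|^2u,$$ whose solutions are understood to be global in time, with $u\in C(\mathbb R,H^{1/2}_+)\cap C^1(\mathbb R,L^2)$. For all $\lambda,p\in\mathbb C$ with $|p|<1$, the traveling wave profile $v_0(z)=\dfrac{\lambda}{1-pz}$ is $H^{1/2}_+$-orbitally stable, i.e. $v_0\in H^{1/2}_+$ and for every $\varepsilon>0$ there is $\eta>0$ such that, for every $u_0\in H^{1/2}_+$ with $\|u_0-v_0\|_{H^{1/2}}\le\eta$,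 the equation has a solution $u$ with $u(0)=u_0$, and every such solution satisfies $$\inf_{(\theta,\alpha)\in\mathbb T^2}\big\|u(t)-e^{-i\theta}v_0(\,\cdot\,e^{-i\alpha})\big\|_{H^{1/2}}\le\varepsilon\qquad\text{for all }t\in\mathbb R.$$ -/

import Mathlib

open MeasureTheory Filter Topology AddCircle

noncomputable section

namespace QuadSzego

instance fact_two_pi_pos : Fact (0 < 2 * Real.pi) := ⟨Real.two_pi_pos⟩

/-- The circle `𝕋 = ℝ / 2πℤ`; the point `x` stands for `z = e^{ix}`. -/
abbrev Torus : Type := AddCircle (2 * Real.pi)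

/-- The normalized Lebesgue measure `dx / 2π` on the circle. -/
abbrev torusMeasure : Measure Torus := haarAddCircle

/-- The space `L²(𝕋)` of complex-valued functions. -/
abbrev L2 : Type := Lp ℂ 2 torusMeasure

/-- The `k`-th Fourier coefficient `∫ u(x) e^{-ikx} dx / 2π`. -/
def coeff (u : L2) (k : ℤ) : ℂ := fourierCoeff (u : Torus → ℂ) k

theorem memlp_truncate (a : lp (fun _ : ℤ => ℂ) 2) :
    Memℓp (fun k : ℤ => if 0 ≤ k then a k else 0) 2 := by
  refine Memℓp.mono (g := fun k => ‖a k‖) ?_ ?_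
  · exact (lp.memℓp a).norm
  · intro k
    split_ifs <;> simp

/-- The Szegő projector `Π` on `L²(𝕋)`: `Σ_{k ∈ ℤ} u_k e^{ikx} ↦ Σ_{k ≥ 0} u_k e^{ikx}`. -/
def szego (u : L2) : L2 :=
  fourierBasis.repr.symm ⟨fun k : ℤ => if 0 ≤ k then fourierBasis.repr u k else 0,
    memlp_truncate (fourierBasis.repr u)⟩

/-- The energy space `H^{1/2}_+(𝕋)`: the `u ∈ L²(𝕋)` with `û(k) = 0` for `k < 0` and
`Σ_k (1 + |k|) |û(k)|² < ∞`. -/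
def HHalfPlus : Set L2 :=
  {u | (∀ k : ℤ, k < 0 → coeff u k = 0) ∧
    Summable fun k : ℤ => (1 + |(k : ℝ)|) * ‖coeff u k‖ ^ 2}

/-- The `H^{1/2}` norm `(Σ_k (1 + |k|) |û(k)|²)^{1/2}` (used on `H^{1/2}_+` only, where the
series converges). -/
def hHalfNorm (u : L2) : ℝ :=
  √(∑' k : ℤ, (1 + |(k : ℝ)|) * ‖coeff u k‖ ^ 2)

/-- `J(u) = ∫_𝕋 |u|² u`. -/
def J (u : L2) : ℂ := ∫ x : Torus, ((‖u x‖ ^ 2 : ℝ) : ℂ) * u x ∂torusMeasure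

/-- `u : ℝ → H^{1/2}_+` is a global solution, in `C(ℝ, H^{1/2}_+) ∩ C¹(ℝ, L²_+)`, of
`i ∂ₜu = 2 J(u) Π(|u|²) + conj (J(u)) u²` with `u(0) = u₀`. At each time `F` and `G` are `|u|²`
and `u²` as elements of `L²(𝕋)`, and `u'` is the time derivative in `L²(𝕋)`. -/
structure IsSolution (u₀ : L2) (u : ℝ → L2) : Prop where
  init : u 0 = u₀
  mem : ∀ t, u t ∈ HHalfPlus
  cont : ∀ t, Tendsto (fun s => hHalfNorm (u s - u t)) (𝓝 t) (𝓝 0)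
  eqn : ∀ t, ∃ F G u' : L2,
    (F =ᵐ[torusMeasure] fun x => ((‖u t x‖ ^ 2 : ℝ) : ℂ)) ∧
    (G =ᵐ[torusMeasure] fun x => u t x ^ 2) ∧
    HasDerivAt u u' t ∧
    Complex.I • u' = (2 * J (u t)) • szego F + (starRingEnd ℂ (J (u t))) • G

/-- The function `e^{-iθ} v(z e^{-iα})`, i.e. `x ↦ e^{-iθ} v(x - α)`. -/
def phaseShift (θ α : ℝ) (v : L2) : L2 :=
  Complex.exp (-(Complex.I * θ)) •
    Lp.compMeasurePreserving (fun x : Torus => x - (α : Torus))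
      (measurePreserving_sub_right torusMeasure (α : Torus)) v

/-- `H^{1/2}_+`-orbital stability of `v₀`. -/
def OrbitallyStable (v₀ : L2) : Prop :=
  v₀ ∈ HHalfPlus ∧
  ∀ ε : ℝ, 0 < ε → ∃ η : ℝ, 0 < η ∧ ∀ u₀ ∈ HHalfPlus, hHalfNorm (u₀ - v₀) ≤ η →
    (∃ u, IsSolution u₀ u) ∧
    ∀ u, IsSolution u₀ u → ∀ t : ℝ,
      ⨅ q : ℝ × ℝ, hHalfNorm (u t - phaseShift q.1 q.2 v₀) ≤ ε

theorem one_sub_mul_fourier_ne_zero {p : ℂ} (hp : ‖p‖ < 1) (x : Torus) :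
    1 - p * fourier 1 x ≠ 0 := by
  intro h
  have h1 : ‖p * fourier 1 x‖ = ‖p‖ := by
    rw [norm_mul, fourier_apply, Circle.norm_coe, mul_one]
  rw [← sub_eq_zero.mp h, norm_one] at h1
  linarith

/-- The function `z ↦ l / (1 - p z)`, `|p| < 1`, on the circle `z = e^{ix}`. -/
def groundState (l p : ℂ) (hp : ‖p‖ < 1) : L2 :=
  ContinuousMap.toLp 2 torusMeasure ℂ
    ⟨fun x : Torus => l / (1 - p * fourier 1 x),
      continuous_const.div (by fun_prop) (one_sub_mul_fourier_ne_zero hp)⟩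

end QuadSzego

end

noncomputable section

namespace QuadSzego

open Finset.HasAntidiagonal (antidiagonal)
open scoped ComplexConjugate

/-! ### Sequences of Fourier coefficients -/

/-! On coefficients a_n = û(n), the squared H^{1/2} norm is N = Σ (n+1)|a_n|² = Σ_{k,m} |a_{k+m}|²,
the squared Hilbert–Schmidt norm of the Hankel matrix (a_{k+m}), while J = Σ_{k,m} a_k a_m
conj(a_{k+m}) pairs that matrix with the tensor a ⊗ a. With Q = Σ |a_n|², Cauchy–Schwarz gives |J|²
≤ Q² N. For a ≠ 0, equality means a_{k+m} = c a_k a_m, that is, a is geometric: the profiles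
l/(1-pz) are the extremals, and Q and N at such an extremal determine |l| and |p|.

Stability follows because Q, N and |J| are conserved. If the data converge to a profile, the three
quantities at any later times converge to those of the profile, so the Cauchy–Schwarz defect N -
|J|²/Q² (`hasSum_defect`) tends to 0. Its columns m = 0 and m = 1 say that c a_0 ≈ 1 and a_{k+1} ≈ c
a_1 a_k, which gives ℓ² closeness to a geometric sequence with parameters of the right moduli; the
whole defect upgrades this to H^{1/2} (`exists_tendsto_geom`). Sequences with these moduli form
exactly the orbit under phases and translations. The argument is direct: no compactness of the
family of solutions at the later times is needed.

The conservation laws must hold for every solution, although the time derivative exists only in L².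
The weighted mass Σ w_n |a_n|² has flux Im(conj J · Σ (w_{k+m} - w_k - w_m) a_k a_m conj(a_{k+m})).
For w = 1 and w = n+1 the bracket is -1 and the flux is Im(-|J|²) = 0; compactly supported Lipschitz
weights make this rigorous (`CoeffSolution.weighted_conservation`). Conservation of |J| is the
Hamiltonian structure (`cubic_flux_re`).

Global existence comes from Galerkin truncations, which keep the Q and N laws exactly, and a
diagonal extraction (`exists_coeffSolution`); conservation of N then yields strong continuity in
H^{1/2}. Uniqueness is never used. -/

/-- The squared `ℓ²` norm. -/
def massSq (a : ℕ → ℂ) : ℝ := ∑' n, ‖a n‖ ^ 2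

/-- Finiteness of the `H^{1/2}` norm of a sequence of coefficients. -/
def FinEnergy (a : ℕ → ℂ) : Prop := Summable fun n : ℕ => ((n : ℝ) + 1) * ‖a n‖ ^ 2

/-- The squared `H^{1/2}` norm of a sequence of coefficients. -/
def energySq (a : ℕ → ℂ) : ℝ := ∑' n : ℕ, ((n : ℝ) + 1) * ‖a n‖ ^ 2

/-- The summands of the trilinear form `∫ a b c̄`. -/
def triTerm (a b c : ℕ → ℂ) (q : ℕ × ℕ) : ℂ := a q.1 * b q.2 * conj (c (q.1 + q.2))

/-- The trilinear form `∫ a b c̄` in terms of coefficients. -/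
def tri (a b c : ℕ → ℂ) : ℂ := ∑' q, triTerm a b c q

/-- The coefficients of the product of two functions. -/
def conv (a b : ℕ → ℂ) (n : ℕ) : ℂ := ∑ q ∈ antidiagonal n, a q.1 * b q.2

/-- The nonnegative coefficients of the product of a function with the conjugate of another. -/
def corr (a b : ℕ → ℂ) (n : ℕ) : ℂ := ∑' k, a (n + k) * conj (b k)

/-- The cubic functional `J` in terms of coefficients. -/
def cubic (a : ℕ → ℂ) : ℂ := tri a a a

/-- The right-hand side of the quadratic Szegő equation in terms of coefficients. -/
def field (a : ℕ → ℂ) (n : ℕ) : ℂ :=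
  -Complex.I * (2 * cubic a * corr a a n + conj (cubic a) * conv a a n)

/-! ### Summation over pairs and elementary norm inequalities. -/

theorem cauchySchwarz_tsum {ι : Type*} {x y : ι → ℝ} (hx : Summable fun i => x i ^ 2)
    (hy : Summable fun i => y i ^ 2) :
    Summable (fun i => x i * y i) ∧
      (∑' i, x i * y i) ^ 2 ≤ (∑' i, x i ^ 2) * ∑' i, y i ^ 2 := by
  have hs : Summable fun i => x i * y i := by
    refine Summable.of_norm_bounded (g := fun i => x i ^ 2 + y i ^ 2) (hx.add hy) fun i => ?_
    rw [Real.norm_eq_abs, abs_mul]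
    nlinarith [sq_nonneg (|x i| - |y i|), sq_abs (x i), sq_abs (y i), sq_nonneg (x i),
      sq_nonneg (y i)]
  refine ⟨hs, ?_⟩
  refine le_of_tendsto' (hs.hasSum.pow 2) fun s => ?_
  calc (∑ i ∈ s, x i * y i) ^ 2 ≤ (∑ i ∈ s, x i ^ 2) * ∑ i ∈ s, y i ^ 2 :=
        Finset.sum_mul_sq_le_sq_mul_sq _ _ _
    _ ≤ _ := by
        gcongr
        · exact hx.sum_le_tsum _ fun i _ => sq_nonneg _
        · exact hy.sum_le_tsum _ fun i _ => sq_nonneg _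

theorem summable_prod_of_antidiagonal {g : ℕ × ℕ → ℝ} (hg : ∀ q, 0 ≤ g q)
    (h : Summable fun n => ∑ q ∈ antidiagonal n, g q) : Summable g := by
  rw [← Finset.HasAntidiagonal.sigmaAntidiagonalEquivProd.summable_iff]
  refine (summable_sigma_of_nonneg fun x => hg _).2 ⟨fun n => Summable.of_finite, ?_⟩
  refine h.congr fun n => ?_
  rw [tsum_fintype, ← Finset.sum_coe_sort]
  rfl

theorem tsum_prod_eq_antidiagonal {E : Type*} [NormedAddCommGroup E] [CompleteSpace E]
    {g : ℕ × ℕ → E} (h : Summable g) :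
    HasSum (fun n => ∑ q ∈ antidiagonal n, g q) (∑' q, g q) := by
  have h1 := (Finset.HasAntidiagonal.sigmaAntidiagonalEquivProd.hasSum_iff (f := g)).2 h.hasSum
  refine h1.sigma fun n => ?_
  rw [← Finset.sum_coe_sort]
  exact hasSum_fintype _

/-- There are n+1 terms, and (k+1)(m+1) ≥ k+m+1 = n+1. This uniform bound is what makes products of
H^{1/2} functions square integrable. -/
theorem sum_antidiagonal_inv_le (n : ℕ) :
    ∑ q ∈ antidiagonal n, (((q.1 : ℝ) + 1) * ((q.2 : ℝ) + 1))⁻¹ ≤ 1 := by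
  have h : ∀ q ∈ antidiagonal n, (((q.1 : ℝ) + 1) * ((q.2 : ℝ) + 1))⁻¹ ≤ ((n : ℝ) + 1)⁻¹ := by
    intro q hq
    have hq' : (q.1 : ℝ) + q.2 = n := by exact_mod_cast Finset.HasAntidiagonal.mem_antidiagonal.1 hq
    have h1 : (0 : ℝ) ≤ q.1 := Nat.cast_nonneg _
    have h2 : (0 : ℝ) ≤ q.2 := Nat.cast_nonneg _
    refine inv_anti₀ (by positivity) ?_
    nlinarith [mul_nonneg h1 h2]
  refine (Finset.sum_le_card_nsmul _ _ _ h).trans ?_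
  rw [Finset.Nat.card_antidiagonal, nsmul_eq_mul]
  push_cast
  rw [mul_inv_cancel₀ (by positivity)]

theorem massSq_nonneg (a : ℕ → ℂ) : 0 ≤ massSq a := tsum_nonneg fun _ => sq_nonneg _

theorem energySq_nonneg (a : ℕ → ℂ) : 0 ≤ energySq a := tsum_nonneg fun _ => by positivity

theorem FinEnergy.summable {a : ℕ → ℂ} (h : FinEnergy a) : Summable fun n => ‖a n‖ ^ 2 := by
  refine Summable.of_nonneg_of_le (fun _ => sq_nonneg _) (fun n => ?_) h
  exact le_mul_of_one_le_left (sq_nonneg _) (by linarith [Nat.cast_nonneg (α := ℝ) n])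

theorem FinEnergy.massSq_le {a : ℕ → ℂ} (h : FinEnergy a) : massSq a ≤ energySq a :=
  h.summable.tsum_le_tsum
    (fun n => le_mul_of_one_le_left (sq_nonneg _) (by linarith [Nat.cast_nonneg (α := ℝ) n])) h

theorem summable_sq_sub {a b : ℕ → ℂ} (ha : Summable fun n => ‖a n‖ ^ 2)
    (hb : Summable fun n => ‖b n‖ ^ 2) : Summable fun n => ‖(a - b) n‖ ^ 2 := by
  refine Summable.of_nonneg_of_le (fun _ => sq_nonneg _) (fun n => ?_)
    ((ha.mul_left 2).add (hb.mul_left 2))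
  have := norm_sub_le (a n) (b n)
  have h0 := norm_nonneg ((a - b) n)
  simp only [Pi.sub_apply] at h0 ⊢
  nlinarith [sq_nonneg (‖a n‖ - ‖b n‖)]

theorem norm_sub_sq_le (x y : ℂ) : ‖x - y‖ ^ 2 ≤ 2 * ‖x‖ ^ 2 + 2 * ‖y‖ ^ 2 := by
  have := norm_sub_le x y
  nlinarith [sq_nonneg (‖x‖ - ‖y‖), norm_nonneg (x - y)]

theorem FinEnergy.sub {a b : ℕ → ℂ} (ha : FinEnergy a) (hb : FinEnergy b) :
    FinEnergy (a - b) := by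
  refine Summable.of_nonneg_of_le (fun _ => by positivity) (fun n => ?_)
    ((Summable.mul_left 2 ha).add (Summable.mul_left 2 hb))
  have := mul_le_mul_of_nonneg_left (norm_sub_sq_le (a n) (b n))
    (by positivity : (0 : ℝ) ≤ (n : ℝ) + 1)
  simp only [Pi.sub_apply]
  linarith

theorem energySq_sub_le {a b : ℕ → ℂ} (ha : FinEnergy a) (hb : FinEnergy b) :
    energySq (a - b) ≤ 2 * energySq a + 2 * energySq b := by
  unfold energySq
  rw [← tsum_mul_left, ← tsum_mul_left, ← (Summable.mul_left 2 ha).tsum_add (Summable.mul_left 2 hb)]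
  refine (ha.sub hb).tsum_le_tsum (fun n => ?_) ((Summable.mul_left 2 ha).add (Summable.mul_left 2 hb))
  have := mul_le_mul_of_nonneg_left (norm_sub_sq_le (a n) (b n))
    (by positivity : (0 : ℝ) ≤ (n : ℝ) + 1)
  simp only [Pi.sub_apply]
  linarith

theorem FinEnergy.neg {a : ℕ → ℂ} (ha : FinEnergy a) : FinEnergy (-a) := by
  simpa [FinEnergy] using ha

theorem energySq_neg (a : ℕ → ℂ) : energySq (-a) = energySq a := by simp [energySq]

theorem FinEnergy.add {a b : ℕ → ℂ} (ha : FinEnergy a) (hb : FinEnergy b) :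
    FinEnergy (a + b) := by
  simpa using ha.sub hb.neg

theorem energySq_add_le {a b : ℕ → ℂ} (ha : FinEnergy a) (hb : FinEnergy b) :
    energySq (a + b) ≤ 2 * energySq a + 2 * energySq b := by
  simpa [energySq_neg] using energySq_sub_le ha hb.neg

theorem finEnergy_of_support {a : ℕ → ℂ} {K : ℕ} (h : ∀ n, K ≤ n → a n = 0) : FinEnergy a :=
  summable_of_ne_finset_zero (s := Finset.range K) fun n hn => by
    rw [h n (by simpa using hn)]; simp

/-- The index n is k+m in exactly n+1 ways. This turns the H^{1/2} norm into the Hilbert–Schmidt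
norm of a Hankel matrix, on which all later estimates and the rigidity argument rest. -/
theorem energySq_eq_tsum_prod {a : ℕ → ℂ} (h : FinEnergy a) :
    HasSum (fun q : ℕ × ℕ => ‖a (q.1 + q.2)‖ ^ 2) (energySq a) := by
  have key : ∀ n, ∑ q ∈ antidiagonal n, ‖a (q.1 + q.2)‖ ^ 2 = ((n : ℝ) + 1) * ‖a n‖ ^ 2 := by
    intro n
    rw [Finset.sum_congr rfl (fun q hq => by rw [Finset.HasAntidiagonal.mem_antidiagonal.1 hq]),
      Finset.sum_const, Finset.Nat.card_antidiagonal, nsmul_eq_mul]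
    push_cast; rfl
  have hs : Summable fun q : ℕ × ℕ => ‖a (q.1 + q.2)‖ ^ 2 :=
    summable_prod_of_antidiagonal (fun _ => sq_nonneg _) (by simpa only [key] using! h)
  have := tsum_prod_eq_antidiagonal hs
  simp only [key] at this
  rw [energySq, this.tsum_eq]
  exact hs.hasSum

theorem summable_mul_mul {a b : ℕ → ℝ} {z : ℕ × ℕ → ℝ} (ha : Summable fun n => a n ^ 2)
    (hb : Summable fun n => b n ^ 2) (hz : Summable fun q => z q ^ 2) :
    Summable (fun q : ℕ × ℕ => a q.1 * b q.2 * z q) ∧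
      (∑' q : ℕ × ℕ, a q.1 * b q.2 * z q) ^ 2 ≤
        (∑' n, a n ^ 2) * (∑' n, b n ^ 2) * ∑' q, z q ^ 2 := by
  have hab : Summable fun q : ℕ × ℕ => (a q.1 * b q.2) ^ 2 := by
    simp only [mul_pow]
    exact ha.mul_of_nonneg hb (fun _ => sq_nonneg _) fun _ => sq_nonneg _
  have h := cauchySchwarz_tsum hab hz
  refine ⟨h.1, h.2.trans_eq ?_⟩
  congr 1
  simp only [mul_pow] at hab ⊢
  rw [ha.tsum_mul_tsum hb hab]

/-! ### Trilinear and bilinear estimates. -/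

theorem norm_triTerm (a b c : ℕ → ℂ) (q : ℕ × ℕ) :
    ‖triTerm a b c q‖ = ‖a q.1‖ * ‖b q.2‖ * ‖c (q.1 + q.2)‖ := by
  simp [triTerm]

/-- Cauchy–Schwarz between the tensor a ⊗ b and the Hankel matrix of c. Together with
`triTerm_high`, it allows any one factor to be measured in ℓ² only. -/
theorem triTerm_low {a b c : ℕ → ℂ} (ha : Summable fun n => ‖a n‖ ^ 2)
    (hb : Summable fun n => ‖b n‖ ^ 2) (hc : FinEnergy c) :
    Summable (fun q => ‖triTerm a b c q‖) ∧
      (∑' q, ‖triTerm a b c q‖) ^ 2 ≤ massSq a * massSq b * energySq c := by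
  simp only [norm_triTerm]
  have := summable_mul_mul (z := fun q => ‖c (q.1 + q.2)‖) ha hb (energySq_eq_tsum_prod hc).summable
  rwa [(energySq_eq_tsum_prod hc).tsum_eq] at this

theorem weighted_sq (a : ℕ → ℂ) (n : ℕ) :
    (√((n : ℝ) + 1) * ‖a n‖) ^ 2 = ((n : ℝ) + 1) * ‖a n‖ ^ 2 := by
  rw [mul_pow, Real.sq_sqrt (by positivity)]

/-- Weights √(k+1)√(m+1) are given to a and b and divided out of the Hankel matrix of c, whose norm
then drops to the ℓ² norm of c by `sum_antidiagonal_inv_le`. -/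
theorem triTerm_high {a b c : ℕ → ℂ} (ha : FinEnergy a) (hb : FinEnergy b)
    (hc : Summable fun n => ‖c n‖ ^ 2) :
    Summable (fun q => ‖triTerm a b c q‖) ∧
      (∑' q, ‖triTerm a b c q‖) ^ 2 ≤ energySq a * energySq b * massSq c := by
  set z : ℕ × ℕ → ℝ := fun q => (√((q.1 : ℝ) + 1) * √((q.2 : ℝ) + 1))⁻¹ * ‖c (q.1 + q.2)‖ with hzdef
  have hz2 : ∀ q : ℕ × ℕ, z q ^ 2 = (((q.1 : ℝ) + 1) * ((q.2 : ℝ) + 1))⁻¹ * ‖c (q.1 + q.2)‖ ^ 2 := by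
    intro q
    rw [hzdef]
    simp only [mul_pow, inv_pow]
    rw [Real.sq_sqrt (by positivity), Real.sq_sqrt (by positivity)]
  have hanti : ∀ n, ∑ q ∈ antidiagonal n, z q ^ 2 ≤ ‖c n‖ ^ 2 := by
    intro n
    calc ∑ q ∈ antidiagonal n, z q ^ 2
        = (∑ q ∈ antidiagonal n, (((q.1 : ℝ) + 1) * ((q.2 : ℝ) + 1))⁻¹) * ‖c n‖ ^ 2 := by
          rw [Finset.sum_mul]
          exact Finset.sum_congr rfl fun q hq => by rw [hz2, Finset.HasAntidiagonal.mem_antidiagonal.1 hq]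
      _ ≤ 1 * ‖c n‖ ^ 2 := by gcongr; exact sum_antidiagonal_inv_le n
      _ = _ := one_mul _
  have hanti' : Summable fun n => ∑ q ∈ antidiagonal n, z q ^ 2 :=
    Summable.of_nonneg_of_le (fun n => Finset.sum_nonneg fun _ _ => sq_nonneg _) hanti hc
  have hz : Summable fun q => z q ^ 2 :=
    summable_prod_of_antidiagonal (fun _ => sq_nonneg _) hanti'
  have hzle : ∑' q, z q ^ 2 ≤ massSq c := by
    rw [← (tsum_prod_eq_antidiagonal hz).tsum_eq]
    exact hanti'.tsum_le_tsum hanti hc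
  have h := summable_mul_mul (a := fun n => √((n : ℝ) + 1) * ‖a n‖)
    (b := fun n => √((n : ℝ) + 1) * ‖b n‖) (z := z) (by simpa only [weighted_sq] using! ha)
    (by simpa only [weighted_sq] using! hb) hz
  have heq : (fun q : ℕ × ℕ => √((q.1 : ℝ) + 1) * ‖a q.1‖ * (√((q.2 : ℝ) + 1) * ‖b q.2‖) * z q)
      = fun q => ‖triTerm a b c q‖ := by
    funext q
    have h1 : √((q.1 : ℝ) + 1) ≠ 0 := by positivity
    have h2 : √((q.2 : ℝ) + 1) ≠ 0 := by positivity
    rw [norm_triTerm, hzdef]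
    field_simp
  simp only [weighted_sq] at h
  rw [heq] at h
  refine ⟨h.1, h.2.trans ?_⟩
  exact mul_le_mul_of_nonneg_left hzle (mul_nonneg (energySq_nonneg a) (energySq_nonneg b))

/-- The commutator weight `1 + 2 min(k, l)` costs no more than three `H^{1/2}` norms. -/
theorem triTerm_weighted {a b c : ℕ → ℂ} (ha : FinEnergy a) (hb : FinEnergy b) (hc : FinEnergy c) :
    Summable (fun q : ℕ × ℕ => (1 + 2 * ((min q.1 q.2 : ℕ) : ℝ)) * ‖triTerm a b c q‖) ∧
      (∑' q : ℕ × ℕ, (1 + 2 * ((min q.1 q.2 : ℕ) : ℝ)) * ‖triTerm a b c q‖) ^ 2 ≤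
        4 * (energySq a * energySq b * energySq c) := by
  have h := summable_mul_mul (a := fun n => √((n : ℝ) + 1) * ‖a n‖)
    (b := fun n => √((n : ℝ) + 1) * ‖b n‖) (z := fun q => ‖c (q.1 + q.2)‖)
    (by simpa only [weighted_sq] using! ha)
    (by simpa only [weighted_sq] using! hb) (energySq_eq_tsum_prod hc).summable
  simp only [weighted_sq] at h
  rw [(energySq_eq_tsum_prod hc).tsum_eq] at h
  have hle : ∀ q : ℕ × ℕ, (1 + 2 * ((min q.1 q.2 : ℕ) : ℝ)) * ‖triTerm a b c q‖ ≤
      2 * (√((q.1 : ℝ) + 1) * ‖a q.1‖ * (√((q.2 : ℝ) + 1) * ‖b q.2‖) * ‖c (q.1 + q.2)‖) := by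
    intro q
    have hm : (1 + ((min q.1 q.2 : ℕ) : ℝ)) ≤ √((q.1 : ℝ) + 1) * √((q.2 : ℝ) + 1) := by
      rw [← Real.sqrt_mul (by positivity)]
      refine Real.le_sqrt_of_sq_le ?_
      have h1 : ((min q.1 q.2 : ℕ) : ℝ) ≤ q.1 := by exact_mod_cast min_le_left _ _
      have h2 : ((min q.1 q.2 : ℕ) : ℝ) ≤ q.2 := by exact_mod_cast min_le_right _ _
      have h0 : (0 : ℝ) ≤ ((min q.1 q.2 : ℕ) : ℝ) := Nat.cast_nonneg _
      nlinarith
    rw [norm_triTerm]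
    have h0 : (0 : ℝ) ≤ ((min q.1 q.2 : ℕ) : ℝ) := Nat.cast_nonneg _
    calc (1 + 2 * ((min q.1 q.2 : ℕ) : ℝ)) * (‖a q.1‖ * ‖b q.2‖ * ‖c (q.1 + q.2)‖)
        ≤ (2 * (√((q.1 : ℝ) + 1) * √((q.2 : ℝ) + 1))) * (‖a q.1‖ * ‖b q.2‖ * ‖c (q.1 + q.2)‖) := by
          gcongr; linarith
      _ = _ := by ring
  have hs : Summable (fun q : ℕ × ℕ => (1 + 2 * ((min q.1 q.2 : ℕ) : ℝ)) * ‖triTerm a b c q‖) :=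
    Summable.of_nonneg_of_le (fun _ => by positivity) hle (h.1.mul_left 2)
  refine ⟨hs, ?_⟩
  have h3 := hs.tsum_le_tsum hle (h.1.mul_left 2)
  rw [tsum_mul_left] at h3
  have h4 : 0 ≤ ∑' q : ℕ × ℕ, (1 + 2 * ((min q.1 q.2 : ℕ) : ℝ)) * ‖triTerm a b c q‖ :=
    tsum_nonneg fun _ => by positivity
  calc _ ≤ (2 * ∑' q : ℕ × ℕ, √((q.1 : ℝ) + 1) * ‖a q.1‖ * (√((q.2 : ℝ) + 1) * ‖b q.2‖) *
        ‖c (q.1 + q.2)‖) ^ 2 := by gcongr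
    _ ≤ _ := by
      rw [mul_pow]
      norm_num only
      exact mul_le_mul_of_nonneg_left h.2 (by norm_num)

theorem norm_sq_tsum_le {ι : Type*} {f : ι → ℂ} {C : ℝ} (h : Summable fun i => ‖f i‖)
    (hC : (∑' i, ‖f i‖) ^ 2 ≤ C) : ‖∑' i, f i‖ ^ 2 ≤ C :=
  le_trans (by gcongr; exact norm_tsum_le_tsum_norm h) hC

theorem norm_sq_tri_le_low {a b c : ℕ → ℂ} (ha : Summable fun n => ‖a n‖ ^ 2)
    (hb : Summable fun n => ‖b n‖ ^ 2) (hc : FinEnergy c) :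
    ‖tri a b c‖ ^ 2 ≤ massSq a * massSq b * energySq c :=
  norm_sq_tsum_le (triTerm_low ha hb hc).1 (triTerm_low ha hb hc).2

theorem norm_sq_tri_le_high {a b c : ℕ → ℂ} (ha : FinEnergy a) (hb : FinEnergy b)
    (hc : Summable fun n => ‖c n‖ ^ 2) :
    ‖tri a b c‖ ^ 2 ≤ energySq a * energySq b * massSq c :=
  norm_sq_tsum_le (triTerm_high ha hb hc).1 (triTerm_high ha hb hc).2

theorem norm_sq_conv_le {a b : ℕ → ℂ} (ha : FinEnergy a) (hb : FinEnergy b) :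
    Summable (fun n => ‖conv a b n‖ ^ 2) ∧ massSq (conv a b) ≤ energySq a * energySq b := by
  have hs : Summable fun q : ℕ × ℕ =>
      (((q.1 : ℝ) + 1) * ‖a q.1‖ ^ 2) * (((q.2 : ℝ) + 1) * ‖b q.2‖ ^ 2) :=
    Summable.mul_of_nonneg (f := fun n : ℕ => ((n : ℝ) + 1) * ‖a n‖ ^ 2)
      (g := fun n : ℕ => ((n : ℝ) + 1) * ‖b n‖ ^ 2) ha hb
      (fun _ => by positivity) fun _ => by positivity
  have hsum := tsum_prod_eq_antidiagonal hs
  have hle : ∀ n, ‖conv a b n‖ ^ 2 ≤ ∑ q ∈ antidiagonal n,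
      (((q.1 : ℝ) + 1) * ‖a q.1‖ ^ 2) * (((q.2 : ℝ) + 1) * ‖b q.2‖ ^ 2) := by
    intro n
    have h1 : ‖conv a b n‖ ≤ ∑ q ∈ antidiagonal n,
        (√((q.1 : ℝ) + 1) * √((q.2 : ℝ) + 1))⁻¹ *
          ((√((q.1 : ℝ) + 1) * ‖a q.1‖) * (√((q.2 : ℝ) + 1) * ‖b q.2‖)) := by
      refine (norm_sum_le _ _).trans_eq (Finset.sum_congr rfl fun q _ => ?_)
      have h1 : √((q.1 : ℝ) + 1) ≠ 0 := by positivity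
      have h2 : √((q.2 : ℝ) + 1) ≠ 0 := by positivity
      rw [norm_mul]
      field_simp
    calc ‖conv a b n‖ ^ 2 ≤ _ := by gcongr
      _ ≤ _ := Finset.sum_mul_sq_le_sq_mul_sq _ _ _
      _ ≤ 1 * ∑ q ∈ antidiagonal n,
          (((q.1 : ℝ) + 1) * ‖a q.1‖ ^ 2) * (((q.2 : ℝ) + 1) * ‖b q.2‖ ^ 2) := by
        gcongr with q hq
        · refine le_trans (le_of_eq (Finset.sum_congr rfl fun q _ => ?_)) (sum_antidiagonal_inv_le n)
          rw [inv_pow, mul_pow, Real.sq_sqrt (by positivity), Real.sq_sqrt (by positivity)]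
        · rw [mul_pow, weighted_sq, weighted_sq]
      _ = _ := one_mul _
  have hs' := Summable.of_nonneg_of_le (fun n => sq_nonneg ‖conv a b n‖) hle hsum.summable
  refine ⟨hs', (hs'.tsum_le_tsum hle hsum.summable).trans_eq ?_⟩
  rw [hsum.tsum_eq, energySq, energySq,
    Summable.tsum_mul_tsum (f := fun n : ℕ => ((n : ℝ) + 1) * ‖a n‖ ^ 2)
      (g := fun n : ℕ => ((n : ℝ) + 1) * ‖b n‖ ^ 2) ha hb hs]

theorem summable_corr {a b : ℕ → ℂ} (ha : Summable fun n => ‖a n‖ ^ 2)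
    (hb : Summable fun n => ‖b n‖ ^ 2) (n : ℕ) :
    Summable (fun k => ‖a (n + k) * conj (b k)‖) ∧
      ‖corr a b n‖ ^ 2 ≤ (∑' k, ‖a (n + k)‖ ^ 2) * massSq b := by
  have ha' : Summable fun k => ‖a (n + k)‖ ^ 2 :=
    ha.comp_injective (add_right_injective n)
  have h := cauchySchwarz_tsum (x := fun k => ‖a (n + k)‖) (y := fun k => ‖b k‖) ha' hb
  have heq : (fun k => ‖a (n + k) * conj (b k)‖) = fun k => ‖a (n + k)‖ * ‖b k‖ := by
    funext k; simp
  refine ⟨heq ▸ h.1, norm_sq_tsum_le (heq ▸ h.1) ?_⟩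
  rw [heq]; exact h.2

theorem norm_sq_corr_apply_le {a b : ℕ → ℂ} (ha : Summable fun n => ‖a n‖ ^ 2)
    (hb : Summable fun n => ‖b n‖ ^ 2) (n : ℕ) :
    ‖corr a b n‖ ^ 2 ≤ massSq a * massSq b :=
  (summable_corr ha hb n).2.trans (mul_le_mul_of_nonneg_right
    (tsum_comp_le_tsum_of_inj ha (fun _ => sq_nonneg _) (add_right_injective n)) (massSq_nonneg b))

/-- Each value is a row of the Hankel matrix of a paired with b; summing the Cauchy–Schwarz bounds
over the rows gives the Hilbert–Schmidt norm. -/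
theorem norm_sq_corr_le {a b : ℕ → ℂ} (ha : FinEnergy a) (hb : Summable fun n => ‖b n‖ ^ 2) :
    Summable (fun n => ‖corr a b n‖ ^ 2) ∧ massSq (corr a b) ≤ energySq a * massSq b := by
  have h := energySq_eq_tsum_prod ha
  have h1 := h.summable.prod
  have h2 := h.summable.tsum_prod
  rw [h.tsum_eq] at h2
  have hs := Summable.of_nonneg_of_le (fun n => sq_nonneg ‖corr a b n‖)
    (fun n => (summable_corr ha.summable hb n).2) (h1.mul_right (massSq b))
  refine ⟨hs, (hs.tsum_le_tsum (fun n => (summable_corr ha.summable hb n).2)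
    (h1.mul_right (massSq b))).trans_eq ?_⟩
  rw [tsum_mul_right, h2]

/-! ### Continuity of the nonlinear quantities under bounded energy -/

theorem cubic_sub_cubic {a b : ℕ → ℂ} (ha : FinEnergy a) (hb : FinEnergy b) :
    cubic a - cubic b = tri (a - b) a a + tri b (a - b) a + tri b b (a - b) := by
  have hab := ha.sub hb
  have s1 := (triTerm_low ha.summable ha.summable ha).1.of_norm
  have s2 := (triTerm_low hb.summable hb.summable hb).1.of_norm
  have s3 := (triTerm_low hab.summable ha.summable ha).1.of_norm
  have s4 := (triTerm_low hb.summable hab.summable ha).1.of_norm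
  have s5 := (triTerm_low hb.summable hb.summable hab).1.of_norm
  unfold cubic tri
  rw [← s1.tsum_sub s2, ← s3.tsum_add s4, ← (s3.add s4).tsum_add s5]
  congr 1
  funext q
  simp only [triTerm, Pi.sub_apply, map_sub]
  ring

theorem corr_sub_corr {a b : ℕ → ℂ} (ha : Summable fun n => ‖a n‖ ^ 2)
    (hb : Summable fun n => ‖b n‖ ^ 2) (n : ℕ) :
    corr a a n - corr b b n = corr (a - b) a n + corr b (a - b) n := by
  have hab := summable_sq_sub ha hb
  have s1 := (summable_corr ha ha n).1.of_norm
  have s2 := (summable_corr hb hb n).1.of_norm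
  have s3 := (summable_corr hab ha n).1.of_norm
  have s4 := (summable_corr hb hab n).1.of_norm
  unfold corr
  rw [← s1.tsum_sub s2, ← s3.tsum_add s4]
  congr 1
  funext k
  simp only [Pi.sub_apply, map_sub]
  ring

theorem conv_sub_conv (a b : ℕ → ℂ) (n : ℕ) :
    conv a a n - conv b b n = conv (a - b) a n + conv b (a - b) n := by
  unfold conv
  rw [← Finset.sum_sub_distrib, ← Finset.sum_add_distrib]
  refine Finset.sum_congr rfl fun q _ => ?_
  simp only [Pi.sub_apply]
  ring

section Limits

variable {ι : Type*} {l : Filter ι}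

theorem tendsto_zero_of_sq_le {f : ι → ℂ} {g : ι → ℝ} (h : ∀ᶠ i in l, ‖f i‖ ^ 2 ≤ g i)
    (hg : Tendsto g l (𝓝 0)) : Tendsto f l (𝓝 0) := by
  have h1 : Tendsto (fun i => ‖f i‖ ^ 2) l (𝓝 0) :=
    squeeze_zero' (Eventually.of_forall fun i => sq_nonneg _) h hg
  have h2 := h1.sqrt
  simp only [Real.sqrt_sq (norm_nonneg _), Real.sqrt_zero] at h2
  exact tendsto_zero_iff_norm_tendsto_zero.2 h2

/-- Lower semicontinuity, seen on finite partial sums. -/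
theorem finEnergy_of_tendsto [l.NeBot] {A : ι → ℕ → ℂ} {a : ℕ → ℂ} {C : ℝ}
    (hA : ∀ n, Tendsto (fun i => A i n) l (𝓝 (a n)))
    (hC : ∀ᶠ i in l, FinEnergy (A i) ∧ energySq (A i) ≤ C) :
    FinEnergy a ∧ energySq a ≤ C := by
  have hs : ∀ s : Finset ℕ, ∑ n ∈ s, ((n : ℝ) + 1) * ‖a n‖ ^ 2 ≤ C := by
    intro s
    have ht : Tendsto (fun i => ∑ n ∈ s, ((n : ℝ) + 1) * ‖A i n‖ ^ 2) l
        (𝓝 (∑ n ∈ s, ((n : ℝ) + 1) * ‖a n‖ ^ 2)) :=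
      tendsto_finsetSum _ fun n _ => (((hA n).norm).pow 2).const_mul _
    refine le_of_tendsto ht ?_
    filter_upwards [hC] with i hi
    exact (Summable.sum_le_tsum s (fun n _ => by positivity) hi.1).trans hi.2
  have hf : FinEnergy a := summable_of_sum_le (fun n => by positivity) hs
  exact ⟨hf, hf.tsum_le_of_sum_le hs⟩

theorem massSq_le_head_add {a : ℕ → ℂ} (ha : FinEnergy a) (m : ℕ) :
    massSq a ≤ ∑ n ∈ Finset.range m, ‖a n‖ ^ 2 + energySq a / (m + 1) := by
  have hs := ha.summable
  unfold massSq energySq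
  rw [← hs.sum_add_tsum_nat_add m]
  have h1 : Summable fun n => ‖a (n + m)‖ ^ 2 := (summable_nat_add_iff m).2 hs
  have h2 : Summable fun n : ℕ => (((n + m : ℕ) : ℝ) + 1) * ‖a (n + m)‖ ^ 2 :=
    (summable_nat_add_iff (f := fun n : ℕ => ((n : ℝ) + 1) * ‖a n‖ ^ 2) m).2 ha
  have h3 : ∑' n : ℕ, (((n + m : ℕ) : ℝ) + 1) * ‖a (n + m)‖ ^ 2 ≤
      ∑' n : ℕ, ((n : ℝ) + 1) * ‖a n‖ ^ 2 := by
    rw [← Summable.sum_add_tsum_nat_add m ha]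
    have : 0 ≤ ∑ n ∈ Finset.range m, ((n : ℝ) + 1) * ‖a n‖ ^ 2 :=
      Finset.sum_nonneg fun _ _ => by positivity
    linarith
  have h4 : ((m : ℝ) + 1) * ∑' n, ‖a (n + m)‖ ^ 2 ≤
      ∑' n : ℕ, (((n + m : ℕ) : ℝ) + 1) * ‖a (n + m)‖ ^ 2 := by
    rw [← tsum_mul_left]
    refine (h1.mul_left _).tsum_le_tsum (fun n => ?_) h2
    gcongr
    linarith
  have h5 : ∑' n, ‖a (n + m)‖ ^ 2 ≤ (∑' n : ℕ, ((n : ℝ) + 1) * ‖a n‖ ^ 2) / (m + 1) := by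
    rw [le_div_iff₀ (by positivity)]
    linarith
  linarith

/-- Rellich compactness: bounded energy makes the ℓ² tails uniformly small, and the head is a finite
sum. -/
theorem tendsto_massSq_sub [l.NeBot] {A : ι → ℕ → ℂ} {a : ℕ → ℂ} {C : ℝ}
    (hA : ∀ n, Tendsto (fun i => A i n) l (𝓝 (a n)))
    (hC : ∀ᶠ i in l, FinEnergy (A i) ∧ energySq (A i) ≤ C) :
    Tendsto (fun i => massSq (A i - a)) l (𝓝 0) := by
  obtain ⟨ha, hac⟩ := finEnergy_of_tendsto hA hC
  rw [tendsto_order]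
  refine ⟨fun x hx => Eventually.of_forall fun i => hx.trans_le (massSq_nonneg _), fun ε hε => ?_⟩
  -- The difference has energy at most 2C + 2C, so its tail beyond m has mass at most 4C/(m+1).
  obtain ⟨m, hm⟩ := exists_nat_gt (4 * C / (ε / 2))
  have hC0 : 0 ≤ C := (energySq_nonneg a).trans hac
  have hm' : 4 * C / ((m : ℝ) + 1) < ε / 2 := by
    rw [div_lt_iff₀ (by positivity)]
    rw [div_lt_iff₀ (by positivity)] at hm
    nlinarith
  have ht : Tendsto (fun i => ∑ n ∈ Finset.range m, ‖(A i - a) n‖ ^ 2) l (𝓝 0) := by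
    have : Tendsto (fun i => ∑ n ∈ Finset.range m, ‖(A i - a) n‖ ^ 2) l
        (𝓝 (∑ n ∈ Finset.range m, ‖a n - a n‖ ^ 2)) :=
      tendsto_finsetSum _ fun n _ => (((hA n).sub tendsto_const_nhds).norm).pow 2
    simpa using this
  filter_upwards [hC, ht.eventually_lt_const (half_pos hε)] with i hi hi2
  have h1 := massSq_le_head_add (hi.1.sub ha) m
  have h2 : energySq (A i - a) / ((m : ℝ) + 1) ≤ 4 * C / (m + 1) := by
    gcongr
    linarith [energySq_sub_le hi.1 ha, hi.2]
  linarith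

theorem tendsto_cubic [l.NeBot] {A : ι → ℕ → ℂ} {a : ℕ → ℂ} {C : ℝ}
    (hA : ∀ n, Tendsto (fun i => A i n) l (𝓝 (a n)))
    (hC : ∀ᶠ i in l, FinEnergy (A i) ∧ energySq (A i) ≤ C) :
    Tendsto (fun i => cubic (A i)) l (𝓝 (cubic a)) := by
  obtain ⟨ha, hac⟩ := finEnergy_of_tendsto hA hC
  have hC0 : 0 ≤ C := (energySq_nonneg a).trans hac
  have hm := tendsto_massSq_sub hA hC
  have hm' : Tendsto (fun i => C * C * massSq (A i - a)) l (𝓝 0) := by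
    simpa using hm.const_mul (C * C)
  have h1 : Tendsto (fun i => tri (A i - a) (A i) (A i)) l (𝓝 0) := by
    refine tendsto_zero_of_sq_le (hC.mono fun i hi => ?_) hm'
    refine (norm_sq_tri_le_low (hi.1.sub ha).summable hi.1.summable hi.1).trans ?_
    have := massSq_nonneg (A i - a)
    calc massSq (A i - a) * massSq (A i) * energySq (A i) ≤ massSq (A i - a) * C * C := by
          gcongr
          · exact energySq_nonneg _
          · exact hi.1.massSq_le.trans hi.2
          · exact hi.2
      _ = _ := by ring
  have h2 : Tendsto (fun i => tri a (A i - a) (A i)) l (𝓝 0) := by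
    refine tendsto_zero_of_sq_le (hC.mono fun i hi => ?_) hm'
    refine (norm_sq_tri_le_low ha.summable (hi.1.sub ha).summable hi.1).trans ?_
    have := massSq_nonneg (A i - a)
    calc massSq a * massSq (A i - a) * energySq (A i) ≤ C * massSq (A i - a) * C := by
          gcongr
          · exact energySq_nonneg _
          · exact ha.massSq_le.trans hac
          · exact hi.2
      _ = _ := by ring
  have h3 : Tendsto (fun i => tri a a (A i - a)) l (𝓝 0) := by
    refine tendsto_zero_of_sq_le (hC.mono fun i hi => ?_) hm'
    refine (norm_sq_tri_le_high ha ha (hi.1.sub ha).summable).trans ?_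
    have := massSq_nonneg (A i - a)
    have := energySq_nonneg a
    gcongr
  rw [← tendsto_sub_nhds_zero_iff]
  have h := (h1.add h2).add h3
  simp only [add_zero] at h
  refine h.congr' (hC.mono fun i hi => ?_)
  exact (cubic_sub_cubic hi.1 ha).symm

theorem tendsto_corr [l.NeBot] {A : ι → ℕ → ℂ} {a : ℕ → ℂ} {C : ℝ}
    (hA : ∀ n, Tendsto (fun i => A i n) l (𝓝 (a n)))
    (hC : ∀ᶠ i in l, FinEnergy (A i) ∧ energySq (A i) ≤ C) (n : ℕ) :
    Tendsto (fun i => corr (A i) (A i) n) l (𝓝 (corr a a n)) := by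
  obtain ⟨ha, hac⟩ := finEnergy_of_tendsto hA hC
  have hC0 : 0 ≤ C := (energySq_nonneg a).trans hac
  have hm' : Tendsto (fun i => C * massSq (A i - a)) l (𝓝 0) := by
    simpa using (tendsto_massSq_sub hA hC).const_mul C
  have h1 : Tendsto (fun i => corr (A i - a) (A i) n) l (𝓝 0) := by
    refine tendsto_zero_of_sq_le (hC.mono fun i hi => ?_) hm'
    refine (norm_sq_corr_apply_le (hi.1.sub ha).summable hi.1.summable n).trans ?_
    have := massSq_nonneg (A i - a)
    rw [mul_comm]
    gcongr
    exact hi.1.massSq_le.trans hi.2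
  have h2 : Tendsto (fun i => corr a (A i - a) n) l (𝓝 0) := by
    refine tendsto_zero_of_sq_le (hC.mono fun i hi => ?_) hm'
    refine (norm_sq_corr_apply_le ha.summable (hi.1.sub ha).summable n).trans ?_
    have := massSq_nonneg (A i - a)
    gcongr
    exact ha.massSq_le.trans hac
  rw [← tendsto_sub_nhds_zero_iff]
  have h := h1.add h2
  simp only [add_zero] at h
  refine h.congr' (hC.mono fun i hi => ?_)
  exact (corr_sub_corr hi.1.summable ha.summable n).symm

theorem tendsto_conv {A : ι → ℕ → ℂ} {a : ℕ → ℂ}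
    (hA : ∀ n, Tendsto (fun i => A i n) l (𝓝 (a n))) (n : ℕ) :
    Tendsto (fun i => conv (A i) (A i) n) l (𝓝 (conv a a n)) :=
  tendsto_finsetSum _ fun q _ => (hA q.1).mul (hA q.2)

theorem tendsto_field [l.NeBot] {A : ι → ℕ → ℂ} {a : ℕ → ℂ} {C : ℝ}
    (hA : ∀ n, Tendsto (fun i => A i n) l (𝓝 (a n)))
    (hC : ∀ᶠ i in l, FinEnergy (A i) ∧ energySq (A i) ≤ C) (n : ℕ) :
    Tendsto (fun i => field (A i) n) l (𝓝 (field a n)) := by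
  have hJ := tendsto_cubic hA hC
  have hJ' := (Complex.continuous_conj.tendsto (cubic a)).comp hJ
  exact (((hJ.const_mul 2).mul (tendsto_corr hA hC n)).add
    (hJ'.mul (tendsto_conv hA n))).const_mul _

end Limits

/-! ### Conservation laws -/

theorem norm_sq_cubic_le {a : ℕ → ℂ} (ha : FinEnergy a) : ‖cubic a‖ ^ 2 ≤ energySq a ^ 3 := by
  refine (norm_sq_tri_le_high ha ha ha.summable).trans ?_
  calc energySq a * energySq a * massSq a ≤ energySq a * energySq a * energySq a := by
        have := energySq_nonneg a
        gcongr
        exact ha.massSq_le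
    _ = _ := by ring

/-- Summation of the trilinear form along the diagonals k+m = n, with a weight on the output
frequency; `hasSum_mul_conj_corr` sums by rows, with a weight on an input frequency. -/
theorem hasSum_conj_mul_conv {a b c : ℕ → ℂ} (h : Summable fun q => ‖triTerm a b c q‖)
    {w : ℕ → ℂ} {B : ℝ} (hw : ∀ n, ‖w n‖ ≤ B) :
    HasSum (fun n => w n * (conj (c n) * conv a b n)) (∑' q, w (q.1 + q.2) * triTerm a b c q) := by
  have hs : Summable fun q : ℕ × ℕ => w (q.1 + q.2) * triTerm a b c q := by
    refine Summable.of_norm_bounded (h.mul_left B) fun q => ?_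
    rw [norm_mul]
    gcongr
    exact hw _
  suffices h : (fun n => w n * (conj (c n) * conv a b n)) =
      fun n => ∑ q ∈ antidiagonal n, w (q.1 + q.2) * triTerm a b c q from
    h ▸ tsum_prod_eq_antidiagonal hs
  funext n
  unfold conv
  rw [Finset.mul_sum, Finset.mul_sum]
  refine Finset.sum_congr rfl fun q hq => ?_
  rw [triTerm, Finset.HasAntidiagonal.mem_antidiagonal.1 hq]
  ring

theorem conj_corr (a b : ℕ → ℂ) (n : ℕ) : conj (corr a b n) = ∑' k, b k * conj (a (n + k)) := by
  unfold corr
  rw [Complex.conj_tsum]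
  congr 1
  funext k
  simp [mul_comm]

theorem hasSum_mul_conj_corr {a b c : ℕ → ℂ} (h : Summable fun q => ‖triTerm a b c q‖)
    {w : ℕ → ℂ} {B : ℝ} (hw : ∀ n, ‖w n‖ ≤ B) :
    HasSum (fun n => w n * (a n * conj (corr c b n))) (∑' q, w q.1 * triTerm a b c q) := by
  have hs : Summable fun q : ℕ × ℕ => w q.1 * triTerm a b c q := by
    refine Summable.of_norm_bounded (h.mul_left B) fun q => ?_
    rw [norm_mul]
    gcongr
    exact hw _
  have h2 := hs.hasSum.prod_fiberwise fun n => (hs.prod_factor n).hasSum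
  convert h2 using 2 with n
  rw [conj_corr, ← tsum_mul_left, ← tsum_mul_left]
  congr 1
  funext k
  simp only [triTerm]
  ring

theorem triTerm_swap (a c : ℕ → ℂ) (q : ℕ × ℕ) : triTerm a a c q.swap = triTerm a a c q := by
  simp only [triTerm, Prod.fst_swap, Prod.snd_swap, add_comm q.2 q.1]
  ring

/-- The product u² contributes w at the output frequency k+m, while Π(|u|²) contributes twice w at
one input, which the symmetry k ↔ m splits as w_k + w_m. The support condition makes the left side a
finite sum, so no convergence beyond that of the trilinear form is involved. -/
theorem sum_weight_mul_flux {a : ℕ → ℂ} (ha : FinEnergy a) {w : ℕ → ℝ} {K : ℕ}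
    (hw : ∀ n, K ≤ n → w n = 0) :
    ∑ n ∈ Finset.range K, w n * (conj (a n) * field a n).re =
      (conj (cubic a) * ∑' q : ℕ × ℕ,
        ((w (q.1 + q.2) - w q.1 - w q.2 : ℝ) : ℂ) * triTerm a a a q).im := by
  have hT := (triTerm_low ha.summable ha.summable ha).1
  obtain ⟨B, hB⟩ : ∃ B : ℝ, ∀ n, ‖(w n : ℂ)‖ ≤ B := by
    refine ⟨∑ n ∈ Finset.range K, ‖(w n : ℂ)‖, fun n => ?_⟩
    by_cases hn : n < K
    · exact Finset.single_le_sum (f := fun n => ‖(w n : ℂ)‖) (fun _ _ => norm_nonneg _)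
        (Finset.mem_range.2 hn)
    · rw [hw n (not_lt.1 hn)]
      simpa using Finset.sum_nonneg fun (i : ℕ) (_ : i ∈ Finset.range K) => abs_nonneg (w i)
  have h1 := hasSum_conj_mul_conv hT hB
  have h2 := hasSum_mul_conj_corr hT hB
  have e1 : ∑ n ∈ Finset.range K, (w n : ℂ) * (conj (a n) * conv a a n) = _ :=
    (hasSum_sum_of_ne_finset_zero (s := Finset.range K) fun n hn => by
      rw [hw n (by simpa using hn)]; simp).unique h1
  have e2 : ∑ n ∈ Finset.range K, (w n : ℂ) * (a n * conj (corr a a n)) = _ :=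
    (hasSum_sum_of_ne_finset_zero (s := Finset.range K) fun n hn => by
      rw [hw n (by simpa using hn)]; simp).unique h2
  have hsum : ∀ f : ℕ × ℕ → ℕ, Summable fun q => (w (f q) : ℂ) * triTerm a a a q := by
    intro f
    refine Summable.of_norm_bounded (hT.mul_left B) fun q => ?_
    rw [norm_mul]
    gcongr
    exact hB _
  have e3 : ∑' q : ℕ × ℕ, (w q.2 : ℂ) * triTerm a a a q = ∑' q : ℕ × ℕ, (w q.1 : ℂ) * triTerm a a a q := by
    rw [← (Equiv.prodComm ℕ ℕ).tsum_eq]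
    congr 1
    funext q
    rw [Equiv.prodComm_apply, triTerm_swap, Prod.snd_swap]
  have e4 : ∑' q : ℕ × ℕ, ((w (q.1 + q.2) - w q.1 - w q.2 : ℝ) : ℂ) * triTerm a a a q =
      ∑' q : ℕ × ℕ, (w (q.1 + q.2) : ℂ) * triTerm a a a q -
        2 * ∑' q : ℕ × ℕ, (w q.1 : ℂ) * triTerm a a a q := by
    have : ∀ q : ℕ × ℕ, ((w (q.1 + q.2) - w q.1 - w q.2 : ℝ) : ℂ) * triTerm a a a q =
        (w (q.1 + q.2) : ℂ) * triTerm a a a q - (w q.1 : ℂ) * triTerm a a a q -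
          (w q.2 : ℂ) * triTerm a a a q := by
      intro q; push_cast; ring
    simp only [this]
    rw [((hsum fun q => q.1 + q.2).sub (hsum fun q => q.1)).tsum_sub (hsum fun q => q.2),
      (hsum fun q => q.1 + q.2).tsum_sub (hsum fun q => q.1), e3]
    ring
  rw [e4, ← e1, ← e2, Finset.mul_sum, ← Finset.sum_sub_distrib, Finset.mul_sum, Complex.im_sum]
  refine Finset.sum_congr rfl fun n _ => ?_
  simp only [field, Complex.mul_re, Complex.mul_im, Complex.add_re, Complex.add_im, Complex.sub_re,
    Complex.sub_im, Complex.conj_re, Complex.conj_im, Complex.ofReal_re, Complex.ofReal_im,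
    Complex.neg_re, Complex.neg_im, Complex.I_re, Complex.I_im, Complex.re_ofNat, Complex.im_ofNat]
  ring

/-- A limit of functions whose derivatives are locally bounded and tend to zero is constant. -/
theorem eq_of_tendsto_of_hasDerivAt {F F' : ℕ → ℝ → ℝ} {G : ℝ → ℝ}
    (hd : ∀ K t, HasDerivAt (F K) (F' K t) t)
    (hb : ∀ T : ℝ, ∃ C, ∀ K, ∀ s ∈ Set.Icc (-T) T, |F' K s| ≤ C)
    (h0 : ∀ s, Tendsto (fun K => F' K s) atTop (𝓝 0))
    (hF : ∀ t, Tendsto (fun K => F K t) atTop (𝓝 (G t))) (t : ℝ) : G t = G 0 := by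
  have hm : ∀ K, F' K = deriv (F K) := fun K => funext fun s => (hd K s).deriv.symm
  obtain ⟨C, hC⟩ := hb |t|
  have hsub : ∀ s ∈ Set.uIoc 0 t, s ∈ Set.Icc (-|t|) |t| := by
    intro s hs
    rcases Set.mem_uIoc.1 hs with h | h
    · rw [abs_of_pos (h.1.trans_le h.2)]; constructor <;> linarith
    · rw [abs_of_neg (h.1.trans_le h.2)]; constructor <;> linarith
  have hmeas : ∀ K (μ : Measure ℝ), AEStronglyMeasurable (F' K) μ := fun K μ => by
    rw [hm K]; exact (measurable_deriv _).aestronglyMeasurable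
  have hint : ∀ K, IntervalIntegrable (F' K) volume 0 t := by
    intro K
    rw [intervalIntegrable_iff]
    refine Measure.integrableOn_of_bounded (M := C) (by simp) (hmeas K _) ?_
    exact (ae_restrict_mem measurableSet_uIoc).mono fun s hs => hC K s (hsub s hs)
  have h1 : ∀ K, ∫ s in 0..t, F' K s = F K t - F K 0 := fun K =>
    intervalIntegral.integral_eq_sub_of_hasDerivAt (fun s _ => hd K s) (hint K)
  have h2 : Tendsto (fun K => ∫ s in 0..t, F' K s) atTop (𝓝 (∫ _ in 0..t, (0 : ℝ))) :=
    intervalIntegral.tendsto_integral_filter_of_dominated_convergence (fun _ => C)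
      (Eventually.of_forall fun K => hmeas K _)
      (Eventually.of_forall fun K => Eventually.of_forall fun s hs => hC K s (hsub s hs))
      intervalIntegrable_const (Eventually.of_forall fun s _ => h0 s)
  simp only [h1, intervalIntegral.integral_zero] at h2
  exact sub_eq_zero.1 (tendsto_nhds_unique ((hF t).sub (hF 0)) h2)

/-- The quadratic Szegő equation in terms of coefficients, with locally bounded `H^{1/2}` norm. -/
structure CoeffSolution (a : ℝ → ℕ → ℂ) : Prop where
  fin : ∀ t, FinEnergy (a t)
  bdd : ∀ T : ℝ, ∃ C, ∀ t ∈ Set.Icc (-T) T, energySq (a t) ≤ C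
  deriv : ∀ t n, HasDerivAt (fun s => a s n) (field (a t) n) t

theorem hasDerivAt_norm_sq {f : ℝ → ℂ} {f' : ℂ} {t : ℝ} (h : HasDerivAt f f' t) :
    HasDerivAt (fun s => ‖f s‖ ^ 2) (2 * (conj (f t) * f').re) t := by
  have := h.norm_sq
  rwa [Complex.inner, mul_comm f'] at this

/-- As the cutoff is removed, w_{k+m} - w_k - w_m tends to -1 and the flux to a multiple of
Im(-|J|²) = 0. The Lipschitz condition dominates the bracket by 1 + 2 min(k, m), which
`triTerm_weighted` controls by energies alone; a sharp cutoff would not allow this. -/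
theorem CoeffSolution.weighted_conservation {a : ℝ → ℕ → ℂ} (h : CoeffSolution a)
    {w : ℕ → ℕ → ℝ} {W : ℕ → ℝ} (hsupp : ∀ K n, K + 1 ≤ n → w K n = 0)
    (hlip : ∀ K m n, |w K (m + n) - w K m| ≤ n) (hzero : ∀ K, |w K 0| ≤ 1)
    (hlim : ∀ n, Tendsto (fun K => w K n) atTop (𝓝 (W n)))
    (hW : ∀ m n, W (m + n) - W m - W n = -1) (t : ℝ) :
    ∑' n, W n * ‖a t n‖ ^ 2 = ∑' n, W n * ‖a 0 n‖ ^ 2 := by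
  have hgrow : ∀ K n, |w K n| ≤ (n : ℝ) + 1 := by
    intro K n
    have h1 := hlip K 0 n
    rw [zero_add] at h1
    calc |w K n| = |(w K n - w K 0) + w K 0| := by ring_nf
      _ ≤ |w K n - w K 0| + |w K 0| := abs_add_le _ _
      _ ≤ _ := add_le_add h1 (hzero K)
  -- The Lipschitz bound compares the weight at k+m with that at the larger index, at cost min; the
  -- weight at the smaller index is at most min + 1.
  have hdef : ∀ K (q : ℕ × ℕ), |w K (q.1 + q.2) - w K q.1 - w K q.2| ≤
      1 + 2 * ((min q.1 q.2 : ℕ) : ℝ) := by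
    intro K q
    rcases le_total q.1 q.2 with hq | hq
    · rw [min_eq_left hq]
      have h1 := hlip K q.2 q.1
      rw [add_comm q.2] at h1
      have h2 := hgrow K q.1
      rw [abs_le] at *
      constructor <;> linarith [h1.1, h1.2, h2.1, h2.2]
    · rw [min_eq_right hq]
      have h1 := hlip K q.1 q.2
      have h2 := hgrow K q.2
      rw [abs_le] at *
      constructor <;> linarith [h1.1, h1.2, h2.1, h2.2]
  have hterm : ∀ K s (q : ℕ × ℕ),
      ‖((w K (q.1 + q.2) - w K q.1 - w K q.2 : ℝ) : ℂ) * triTerm (a s) (a s) (a s) q‖ ≤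
        (1 + 2 * ((min q.1 q.2 : ℕ) : ℝ)) * ‖triTerm (a s) (a s) (a s) q‖ := by
    intro K s q
    rw [norm_mul, Complex.norm_real, Real.norm_eq_abs]
    gcongr
    exact hdef K q
  refine eq_of_tendsto_of_hasDerivAt (G := fun t => ∑' n, W n * ‖a t n‖ ^ 2)
    (F := fun K s => ∑ n ∈ Finset.range (K + 1), w K n * ‖a s n‖ ^ 2)
    (F' := fun K s => 2 * (conj (cubic (a s)) * ∑' q : ℕ × ℕ,
        ((w K (q.1 + q.2) - w K q.1 - w K q.2 : ℝ) : ℂ) * triTerm (a s) (a s) (a s) q).im)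
    ?_ ?_ ?_ ?_ t
  · intro K s
    rw [← sum_weight_mul_flux (h.fin s) (hsupp K), Finset.mul_sum]
    have := HasDerivAt.fun_sum (u := Finset.range (K + 1))
      fun n _ => (hasDerivAt_norm_sq (h.deriv s n)).const_mul (w K n)
    refine this.congr_deriv (Finset.sum_congr rfl fun n _ => by ring)
  · intro T
    obtain ⟨C, hC⟩ := h.bdd T
    -- From |J|² ≤ E³ and `triTerm_weighted`, whose bound is 4E³, the product is at most 2E³, and
    -- the flux carries a factor 2.
    refine ⟨4 * C ^ 3, fun K s hs => ?_⟩
    have hE := hC s hs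
    have hE0 := energySq_nonneg (a s)
    have hw := triTerm_weighted (h.fin s) (h.fin s) (h.fin s)
    have hsm := Summable.of_nonneg_of_le (fun _ => norm_nonneg _) (hterm K s) hw.1
    have h1 := norm_sq_tsum_le hsm ((pow_le_pow_left₀ (tsum_nonneg fun _ => norm_nonneg _)
      (hsm.tsum_le_tsum (hterm K s) hw.1) 2).trans hw.2)
    have h2 := norm_sq_cubic_le (h.fin s)
    set X := ∑' q : ℕ × ℕ,
        ((w K (q.1 + q.2) - w K q.1 - w K q.2 : ℝ) : ℂ) * triTerm (a s) (a s) (a s) q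
    have h3 : |(conj (cubic (a s)) * X).im| ≤ ‖cubic (a s)‖ * ‖X‖ := by
      refine (Complex.abs_im_le_norm _).trans_eq ?_
      rw [norm_mul, Complex.norm_conj]
    have h4 : ‖cubic (a s)‖ * ‖X‖ ≤ 2 * energySq (a s) ^ 3 := by
      refine abs_le_of_sq_le_sq' ?_ (by positivity) |>.2
      rw [mul_pow, mul_pow]
      calc _ ≤ energySq (a s) ^ 3 * (4 * (energySq (a s) * energySq (a s) * energySq (a s))) := by
            gcongr
        _ = _ := by ring
    have h5 : energySq (a s) ^ 3 ≤ C ^ 3 := by gcongr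
    rw [abs_mul, abs_two]
    linarith
  · intro s
    have hw := (triTerm_weighted (h.fin s) (h.fin s) (h.fin s)).1
    have h1 : Tendsto (fun K => ∑' q : ℕ × ℕ,
        ((w K (q.1 + q.2) - w K q.1 - w K q.2 : ℝ) : ℂ) * triTerm (a s) (a s) (a s) q) atTop
        (𝓝 (∑' q : ℕ × ℕ, ((-1 : ℝ) : ℂ) * triTerm (a s) (a s) (a s) q)) := by
      refine tendsto_tsum_of_dominated_convergence hw (fun q => ?_)
        (Eventually.of_forall fun K q => hterm K s q)
      refine Tendsto.mul_const _ ((Complex.continuous_ofReal.tendsto _).comp ?_)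
      rw [← hW q.1 q.2]
      exact ((hlim _).sub (hlim _)).sub (hlim _)
    have h2 : (∑' q : ℕ × ℕ, ((-1 : ℝ) : ℂ) * triTerm (a s) (a s) (a s) q) = -cubic (a s) := by
      rw [tsum_mul_left]
      simp [cubic, tri]
    rw [h2] at h1
    have h3 := ((Complex.continuous_im.tendsto _).comp
      (h1.const_mul (conj (cubic (a s))))).const_mul 2
    have h4 : (2 : ℝ) * (conj (cubic (a s)) * -cubic (a s)).im = 0 := by
      simp only [Complex.mul_im, Complex.conj_re, Complex.conj_im, Complex.neg_re, Complex.neg_im]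
      ring
    rw [h4] at h3
    exact h3
  · intro s
    have h1 : ∀ K, ∑ n ∈ Finset.range (K + 1), w K n * ‖a s n‖ ^ 2 =
        ∑' n, w K n * ‖a s n‖ ^ 2 := fun K =>
      (tsum_eq_sum fun n hn => by rw [hsupp K n (by simpa using hn), zero_mul]).symm
    simp only [h1]
    refine tendsto_tsum_of_dominated_convergence (h.fin s) (fun n => (hlim n).mul_const _)
      (Eventually.of_forall fun K n => ?_)
    rw [norm_mul, Real.norm_eq_abs, Real.norm_eq_abs, abs_of_nonneg (sq_nonneg ‖a s n‖)]
    gcongr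
    exact hgrow K n

theorem CoeffSolution.massSq_eq {a : ℝ → ℕ → ℂ} (h : CoeffSolution a) (t : ℝ) :
    massSq (a t) = massSq (a 0) := by
  -- A ramp of slope -1/(K+1) replaces the sharp cutoff of the constant weight.
  have := h.weighted_conservation (w := fun K n => max 0 (1 - (n : ℝ) / (K + 1))) (W := fun _ => 1)
    ?_ ?_ ?_ ?_ ?_ t
  · simpa [massSq] using this
  · intro K n hn
    refine max_eq_left ?_
    rw [sub_nonpos, le_div_iff₀ (by positivity)]
    have : ((K + 1 : ℕ) : ℝ) ≤ n := by exact_mod_cast hn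
    push_cast at this
    linarith
  · intro K m n
    have hmax : ∀ x y : ℝ, |max 0 x - max 0 y| ≤ |x - y| := fun x y => by
      simpa only [max_comm] using abs_max_sub_max_le_abs x y 0
    refine (hmax _ _).trans ?_
    have : (1 - ((m + n : ℕ) : ℝ) / (K + 1)) - (1 - (m : ℝ) / (K + 1)) = -((n : ℝ) / (K + 1)) := by
      push_cast; ring
    rw [this, abs_neg, abs_of_nonneg (by positivity)]
    exact div_le_self (by positivity) (by linarith [Nat.cast_nonneg (α := ℝ) K])
  · intro K; simp
  · intro n
    have h1 : Tendsto (fun K : ℕ => (n : ℝ) / ((K : ℝ) + 1)) atTop (𝓝 0) :=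
      tendsto_const_nhds.div_atTop
        (tendsto_atTop_add_const_right _ _ tendsto_natCast_atTop_atTop)
    have h2 := (tendsto_const_nhds (x := (0 : ℝ))).max (h1.const_sub 1)
    simpa using h2
  · intro m n; norm_num

theorem CoeffSolution.energySq_eq {a : ℝ → ℕ → ℂ} (h : CoeffSolution a) (t : ℝ) :
    energySq (a t) = energySq (a 0) := by
  refine h.weighted_conservation
    -- A tent with slopes ±1: it agrees with n+1 as soon as K ≥ 2n and returns to 0 at n = K+1,
    -- without exceeding Lipschitz constant 1.
    (w := fun K n => max 0 (min ((n : ℝ) + 1) ((K : ℝ) + 1 - n))) (W := fun n => (n : ℝ) + 1)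
    ?_ ?_ ?_ ?_ ?_ t
  · intro K n hn
    refine max_eq_left ((min_le_right _ _).trans ?_)
    have : ((K + 1 : ℕ) : ℝ) ≤ n := by exact_mod_cast hn
    push_cast at this
    linarith
  · intro K m n
    have hn : (0 : ℝ) ≤ n := Nat.cast_nonneg n
    push_cast
    rw [abs_le]
    constructor
    · rcases max_cases (0 : ℝ) (min ((m : ℝ) + n + 1) ((K : ℝ) + 1 - (m + n))) with h1 | h1 <;>
      rcases max_cases (0 : ℝ) (min ((m : ℝ) + 1) ((K : ℝ) + 1 - m)) with h2 | h2 <;>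
      rcases min_cases ((m : ℝ) + n + 1) ((K : ℝ) + 1 - (m + n)) with h3 | h3 <;>
      rcases min_cases ((m : ℝ) + 1) ((K : ℝ) + 1 - m) with h4 | h4 <;>
      linarith [h1.1, h1.2, h2.1, h2.2, h3.1, h3.2, h4.1, h4.2]
    · rcases max_cases (0 : ℝ) (min ((m : ℝ) + n + 1) ((K : ℝ) + 1 - (m + n))) with h1 | h1 <;>
      rcases max_cases (0 : ℝ) (min ((m : ℝ) + 1) ((K : ℝ) + 1 - m)) with h2 | h2 <;>
      rcases min_cases ((m : ℝ) + n + 1) ((K : ℝ) + 1 - (m + n)) with h3 | h3 <;>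
      rcases min_cases ((m : ℝ) + 1) ((K : ℝ) + 1 - m) with h4 | h4 <;>
      linarith [h1.1, h1.2, h2.1, h2.2, h3.1, h3.2, h4.1, h4.2]
  · intro K
    have : (1 : ℝ) ≤ (K : ℝ) + 1 := by linarith [Nat.cast_nonneg (α := ℝ) K]
    simp [this]
  · intro n
    refine tendsto_const_nhds.congr' ?_
    filter_upwards [eventually_ge_atTop (2 * n)] with K hK
    have : ((2 * n : ℕ) : ℝ) ≤ K := by exact_mod_cast hK
    push_cast at this
    rw [min_eq_left (by linarith), max_eq_right (by positivity)]
  · intro m n; push_cast; ring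

theorem norm_sq_field_le {a : ℕ → ℂ} (ha : FinEnergy a) :
    Summable (fun n => ‖field a n‖ ^ 2) ∧ massSq (field a) ≤ 10 * energySq a ^ 5 := by
  have h1 := norm_sq_corr_le ha ha.summable
  have h2 := norm_sq_conv_le ha ha
  -- The inequality (2x+y)² ≤ 8x² + 2y² is the source of the constant 10 = 8 + 2.
  have hle : ∀ n, ‖field a n‖ ^ 2 ≤
      8 * ‖cubic a‖ ^ 2 * ‖corr a a n‖ ^ 2 + 2 * ‖cubic a‖ ^ 2 * ‖conv a a n‖ ^ 2 := by
    intro n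
    have h3 : ‖field a n‖ ≤ 2 * ‖cubic a‖ * ‖corr a a n‖ + ‖cubic a‖ * ‖conv a a n‖ := by
      unfold field
      rw [norm_mul, norm_neg, Complex.norm_I, one_mul]
      refine (norm_add_le _ _).trans_eq ?_
      simp
    have h4 := norm_nonneg (field a n)
    have h5 : ‖field a n‖ ^ 2 ≤ (2 * ‖cubic a‖ * ‖corr a a n‖ + ‖cubic a‖ * ‖conv a a n‖) ^ 2 := by
      gcongr
    nlinarith [sq_nonneg (2 * ‖cubic a‖ * ‖corr a a n‖ - ‖cubic a‖ * ‖conv a a n‖)]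
  have hsum := (h1.1.mul_left (8 * ‖cubic a‖ ^ 2)).add (h2.1.mul_left (2 * ‖cubic a‖ ^ 2))
  have hs := Summable.of_nonneg_of_le (fun n => sq_nonneg ‖field a n‖) hle hsum
  refine ⟨hs, (hs.tsum_le_tsum hle hsum).trans ?_⟩
  rw [(h1.1.mul_left _).tsum_add (h2.1.mul_left _), tsum_mul_left, tsum_mul_left]
  have hJ := norm_sq_cubic_le ha
  have hE := energySq_nonneg a
  have h6 : ∑' n, ‖corr a a n‖ ^ 2 ≤ energySq a * energySq a :=
    h1.2.trans (by gcongr; exact ha.massSq_le)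
  have h7 : ∑' n, ‖conv a a n‖ ^ 2 ≤ energySq a * energySq a := h2.2
  calc _ ≤ 8 * energySq a ^ 3 * (energySq a * energySq a) +
        2 * energySq a ^ 3 * (energySq a * energySq a) := by gcongr
    _ = _ := by ring

theorem conv_comm (a b : ℕ → ℂ) (n : ℕ) : conv a b n = conv b a n := by
  unfold conv
  rw [← Finset.Nat.sum_antidiagonal_swap]
  exact Finset.sum_congr rfl fun q _ => mul_comm _ _

theorem hasDerivAt_conv {a : ℝ → ℕ → ℂ} {a' : ℕ → ℂ} {t : ℝ}
    (h : ∀ n, HasDerivAt (fun s => a s n) (a' n) t) (n : ℕ) :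
    HasDerivAt (fun s => conv (a s) (a s) n) (2 * conv a' (a t) n) t := by
  have h1 : HasDerivAt (fun s => conv (a s) (a s) n) (conv a' (a t) n + conv (a t) a' n) t := by
    unfold conv
    rw [← Finset.sum_add_distrib]
    exact HasDerivAt.fun_sum fun q _ => (h q.1).mul (h q.2)
  rw [conv_comm (a t)] at h1
  rwa [two_mul]

/-- The vector field is -iG with G = 2J Π(|u|²) + conj(J) u², the gradient of |J|² up to
normalization, so the derivative of |J|² along it is a multiple of Re(-i‖G‖²) = 0. The cancellation
already takes place at each frequency. -/
theorem cubic_flux_re {a : ℕ → ℂ} (ha : FinEnergy a) :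
    (conj (cubic a) * (2 * tri (field a) a a + ∑' n, conv a a n * conj (field a n))).re = 0 := by
  have hf := (norm_sq_field_le ha).1
  have h1 : HasSum (fun n => field a n * conj (corr a a n)) (tri (field a) a a) := by
    have := hasSum_mul_conj_corr (triTerm_low hf ha.summable ha).1 (w := fun _ => 1) (B := 1)
      (by simp)
    simpa [tri] using this
  have hs : Summable fun n => conv a a n * conj (field a n) := by
    refine Summable.of_norm ?_
    simpa using (cauchySchwarz_tsum (norm_sq_conv_le ha ha).1 hf).1
  have h2 := (((h1.mul_left 2).add hs.hasSum).mul_left (conj (cubic a)))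
  have h3 := Complex.hasSum_re h2
  refine h3.unique ?_
  convert hasSum_zero using 2 with n
  simp only [field, Complex.mul_re, Complex.mul_im, Complex.add_re, Complex.add_im,
    Complex.conj_re, Complex.conj_im, Complex.neg_re, Complex.neg_im, Complex.I_re, Complex.I_im,
    Complex.re_ofNat, Complex.im_ofNat]
  ring

theorem norm_sum_conj_mul_conv_le {a b c : ℕ → ℂ} (h : Summable fun q => ‖triTerm a b c q‖)
    (K : ℕ) : ‖∑ n ∈ Finset.range K, conj (c n) * conv a b n‖ ≤ ∑' q, ‖triTerm a b c q‖ := by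
  have hsum := tsum_prod_eq_antidiagonal h
  calc _ ≤ ∑ n ∈ Finset.range K, ∑ q ∈ antidiagonal n, ‖triTerm a b c q‖ := by
        refine (norm_sum_le _ _).trans (Finset.sum_le_sum fun n _ => ?_)
        unfold conv
        rw [Finset.mul_sum]
        refine (norm_sum_le _ _).trans_eq (Finset.sum_congr rfl fun q hq => ?_)
        rw [norm_triTerm, Finset.HasAntidiagonal.mem_antidiagonal.1 hq]
        simp only [norm_mul, Complex.norm_conj]
        ring
    _ ≤ _ := hsum.tsum_eq ▸ hsum.summable.sum_le_tsum _ fun n _ =>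
        Finset.sum_nonneg fun _ _ => norm_nonneg _

theorem CoeffSolution.norm_cubic_eq {a : ℝ → ℕ → ℂ} (h : CoeffSolution a) (t : ℝ) :
    ‖cubic (a t)‖ = ‖cubic (a 0)‖ := by
  have hE : ∀ t, energySq (a t) = energySq (a 0) := h.energySq_eq
  set E := energySq (a 0) with hEdef
  have hE0 : 0 ≤ E := energySq_nonneg _
  have hlow : ∀ s, Summable fun q => ‖triTerm (a s) (a s) (a s) q‖ := fun s =>
    (triTerm_low (h.fin s).summable (h.fin s).summable (h.fin s)).1
  have hlow' : ∀ s, Summable fun q => ‖triTerm (field (a s)) (a s) (a s) q‖ := fun s =>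
    (triTerm_low (norm_sq_field_le (h.fin s)).1 (h.fin s).summable (h.fin s)).1
  have hCS : ∀ s, Summable fun n => ‖conv (a s) (a s) n‖ * ‖field (a s) n‖ := fun s =>
    (cauchySchwarz_tsum (norm_sq_conv_le (h.fin s) (h.fin s)).1 (norm_sq_field_le (h.fin s)).1).1
  -- J is cut off in the output frequency: each partial sum involves finitely many coefficients,
  -- hence is differentiable, and D is its derivative.
  set P : ℕ → ℝ → ℂ := fun K s => ∑ n ∈ Finset.range K, conv (a s) (a s) n * conj (a s n) with hP
  set D : ℕ → ℝ → ℂ := fun K s => ∑ n ∈ Finset.range K,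
    (2 * conv (field (a s)) (a s) n * conj (a s n) + conv (a s) (a s) n * conj (field (a s) n))
    with hD
  have hPeq : ∀ K s, P K s = ∑ n ∈ Finset.range K, conj (a s n) * conv (a s) (a s) n :=
    fun K s => Finset.sum_congr rfl fun n _ => mul_comm _ _
  have hDeq : ∀ K s, D K s = 2 * (∑ n ∈ Finset.range K, conj (a s n) * conv (field (a s)) (a s) n) +
      ∑ n ∈ Finset.range K, conv (a s) (a s) n * conj (field (a s) n) := by
    intro K s
    rw [Finset.mul_sum, ← Finset.sum_add_distrib]
    exact Finset.sum_congr rfl fun n _ => by ring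
  have hPlim : ∀ s, Tendsto (fun K => P K s) atTop (𝓝 (cubic (a s))) := by
    intro s
    have := hasSum_conj_mul_conv (hlow s) (w := fun _ => 1) (B := 1) (by simp)
    simp only [one_mul] at this
    simp only [hPeq]
    exact this.tendsto_sum_nat
  have hDlim : ∀ s, Tendsto (fun K => D K s) atTop (𝓝 (2 * tri (field (a s)) (a s) (a s) +
      ∑' n, conv (a s) (a s) n * conj (field (a s) n))) := by
    intro s
    have h1 := hasSum_conj_mul_conv (hlow' s) (w := fun _ => 1) (B := 1) (by simp)
    simp only [one_mul] at h1
    have h2 : Summable fun n => conv (a s) (a s) n * conj (field (a s) n) :=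
      Summable.of_norm (by simpa using hCS s)
    simp only [hDeq]
    exact (h1.tendsto_sum_nat.const_mul 2).add h2.hasSum.tendsto_sum_nat
  have hPb : ∀ K s, ‖P K s‖ ^ 2 ≤ E ^ 3 := by
    intro K s
    rw [hPeq]
    have h1 := norm_sum_conj_mul_conv_le (hlow s) K
    have h2 := (triTerm_high (h.fin s) (h.fin s) (h.fin s).summable).2
    have h3 := (h.fin s).massSq_le
    rw [hE] at h2 h3
    calc _ ≤ (∑' q, ‖triTerm (a s) (a s) (a s) q‖) ^ 2 := by gcongr
      _ ≤ E * E * massSq (a s) := h2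
      _ ≤ E * E * E := by gcongr
      _ = _ := by ring
  -- With X² and Y² at most 10E⁷, (2X+Y)² ≤ 8X² + 2Y² ≤ 100E⁷.
  have hDb : ∀ K s, ‖D K s‖ ^ 2 ≤ 100 * E ^ 7 := by
    intro K s
    have hf := norm_sq_field_le (h.fin s)
    have hm := (h.fin s).massSq_le
    have h1 := norm_sum_conj_mul_conv_le (hlow' s) K
    have h2 := (triTerm_low hf.1 (h.fin s).summable (h.fin s)).2
    have h3 := cauchySchwarz_tsum (norm_sq_conv_le (h.fin s) (h.fin s)).1 hf.1
    have h4 := (norm_sq_conv_le (h.fin s) (h.fin s)).2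
    have h5 := hf.2
    rw [hE] at h2 h4 h5 hm
    have h6 : ‖∑ n ∈ Finset.range K, conv (a s) (a s) n * conj (field (a s) n)‖ ≤
        ∑' n, ‖conv (a s) (a s) n‖ * ‖field (a s) n‖ := by
      refine (norm_sum_le _ _).trans ?_
      simp only [norm_mul, Complex.norm_conj]
      exact (hCS s).sum_le_tsum _ fun _ _ => by positivity
    set X := ∑' q, ‖triTerm (field (a s)) (a s) (a s) q‖
    set Y := ∑' n, ‖conv (a s) (a s) n‖ * ‖field (a s) n‖
    have hX : X ^ 2 ≤ 10 * E ^ 7 := by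
      refine h2.trans ?_
      calc _ ≤ (10 * E ^ 5) * E * E := by
            have := massSq_nonneg (a s)
            gcongr
        _ = _ := by ring
    have hY : Y ^ 2 ≤ 10 * E ^ 7 := by
      refine h3.2.trans ?_
      calc _ ≤ (E * E) * (10 * E ^ 5) := by
            gcongr
            · exact h4
            · exact h5
        _ = _ := by ring
    have h7 : ‖D K s‖ ≤ 2 * X + Y := by
      rw [hDeq]
      refine (norm_add_le _ _).trans ?_
      rw [norm_mul, Complex.norm_ofNat]
      gcongr
    have h8 : ‖D K s‖ ^ 2 ≤ (2 * X + Y) ^ 2 := by gcongr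
    nlinarith [sq_nonneg (2 * X - Y), pow_nonneg hE0 7]
  have hconst := eq_of_tendsto_of_hasDerivAt (F := fun K s => ‖P K s‖ ^ 2)
    (F' := fun K s => 2 * (conj (P K s) * D K s).re) (G := fun s => ‖cubic (a s)‖ ^ 2)
    ?_ ?_ ?_ (fun s => ((hPlim s).norm).pow 2) t
  · exact (sq_eq_sq₀ (norm_nonneg _) (norm_nonneg _)).1 hconst
  · intro K s
    refine hasDerivAt_norm_sq ?_
    refine HasDerivAt.fun_sum fun n _ => ?_
    exact (hasDerivAt_conv (h.deriv s) n).mul (h.deriv s n).star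
  · intro T
    refine ⟨E ^ 3 + 100 * E ^ 7, fun K s _ => ?_⟩
    have h1 : |(conj (P K s) * D K s).re| ≤ ‖P K s‖ * ‖D K s‖ := by
      refine (Complex.abs_re_le_norm _).trans_eq ?_
      rw [norm_mul, Complex.norm_conj]
    rw [abs_mul, abs_two]
    nlinarith [hPb K s, hDb K s, sq_nonneg (‖P K s‖ - ‖D K s‖)]
  · intro s
    have h1 := ((Complex.continuous_conj.tendsto _).comp (hPlim s)).mul (hDlim s)
    have h2 := ((Complex.continuous_re.tendsto _).comp h1).const_mul 2
    rw [cubic_flux_re (h.fin s), mul_zero] at h2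
    exact h2

/-! ### Galerkin approximations -/

/-- Extension of a finite vector by zero. -/
def zeroExtend {K : ℕ} (x : Fin K → ℂ) (n : ℕ) : ℂ := if h : n < K then x ⟨n, h⟩ else 0

theorem zeroExtend_of_le {K : ℕ} (x : Fin K → ℂ) {n : ℕ} (h : K ≤ n) : zeroExtend x n = 0 :=
  dif_neg (not_lt.2 h)

theorem zeroExtend_coe {K : ℕ} (x : Fin K → ℂ) (i : Fin K) : zeroExtend x i = x i := by
  simp [zeroExtend]

theorem contDiff_zeroExtend {K : ℕ} (n : ℕ) :
    ContDiff ℝ 1 fun x : Fin K → ℂ => zeroExtend x n := by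
  unfold zeroExtend
  split_ifs with h
  · exact contDiff_apply ℝ ℂ _
  · exact contDiff_const

theorem contDiff_conj_zeroExtend {K : ℕ} (n : ℕ) :
    ContDiff ℝ 1 fun x : Fin K → ℂ => conj (zeroExtend x n) :=
  Complex.conjCLE.contDiff.comp (contDiff_zeroExtend n)

theorem contDiff_cubic_zeroExtend {K : ℕ} :
    ContDiff ℝ 1 fun x : Fin K → ℂ => cubic (zeroExtend x) := by
  have h : (fun x : Fin K → ℂ => cubic (zeroExtend x)) = fun x =>
      ∑ q ∈ Finset.range K ×ˢ Finset.range K,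
        zeroExtend x q.1 * zeroExtend x q.2 * conj (zeroExtend x (q.1 + q.2)) := by
    funext x
    refine tsum_eq_sum fun q hq => ?_
    have : K ≤ q.1 + q.2 := by
      simp only [Finset.mem_product, Finset.mem_range, not_and_or, not_lt] at hq
      omega
    rw [triTerm, zeroExtend_of_le x this, map_zero, mul_zero]
  rw [h]
  exact ContDiff.sum fun q _ => ((contDiff_zeroExtend _).mul (contDiff_zeroExtend _)).mul
    (contDiff_conj_zeroExtend _)

theorem contDiff_field_zeroExtend {K : ℕ} (n : ℕ) :
    ContDiff ℝ 1 fun x : Fin K → ℂ => field (zeroExtend x) n := by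
  have h1 : ContDiff ℝ 1 fun x : Fin K → ℂ => corr (zeroExtend x) (zeroExtend x) n := by
    have h : (fun x : Fin K → ℂ => corr (zeroExtend x) (zeroExtend x) n) = fun x =>
        ∑ k ∈ Finset.range K, zeroExtend x (n + k) * conj (zeroExtend x k) := by
      funext x
      refine tsum_eq_sum fun k hk => ?_
      rw [zeroExtend_of_le x (n := k) (by simpa using hk), map_zero, mul_zero]
    rw [h]
    exact ContDiff.sum fun k _ => (contDiff_zeroExtend _).mul (contDiff_conj_zeroExtend _)
  have h2 : ContDiff ℝ 1 fun x : Fin K → ℂ => conv (zeroExtend x) (zeroExtend x) n :=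
    ContDiff.sum fun q _ => (contDiff_zeroExtend _).mul (contDiff_zeroExtend _)
  exact contDiff_const.mul (((contDiff_const.mul contDiff_cubic_zeroExtend).mul h1).add
    ((Complex.conjCLE.contDiff.comp contDiff_cubic_zeroExtend).mul h2))

/-- A compactly supported `C¹` vector field has integral curves on arbitrarily long intervals. -/
theorem exists_integralCurve {E : Type*} [NormedAddCommGroup E] [NormedSpace ℝ E] [CompleteSpace E]
    {V : E → E} (hV : ContDiff ℝ 1 V) (hc : HasCompactSupport V) (x : E) {T : ℝ} (hT : 0 ≤ T) :
    ∃ α : ℝ → E, α 0 = x ∧ ∀ t ∈ Set.Icc (-T) T,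
      HasDerivWithinAt α (V (α t)) (Set.Icc (-T) T) t := by
  obtain ⟨C, hC⟩ := hV.lipschitzWith_of_hasCompactSupport hc one_ne_zero
  obtain ⟨L, hL⟩ := hc.exists_bound_of_continuous hV.continuous
  have hL0 : 0 ≤ L := (norm_nonneg _).trans (hL x)
  have h0 : (0 : ℝ) ∈ Set.Icc (-T) T := ⟨by linarith, hT⟩
  have hp : IsPicardLindelof (fun _ => V) (⟨0, h0⟩ : Set.Icc (-T) T) x
      (⟨L, hL0⟩ * ⟨T, hT⟩) 0 ⟨L, hL0⟩ C :=
    { lipschitzOnWith := fun t _ => hC.lipschitzOnWith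
      continuousOn := fun y _ => continuousOn_const
      norm_le := fun t _ y _ => hL y
      mul_max_le := by simp; exact le_rfl }
  exact hp.exists_eq_forall_mem_Icc_hasDerivWithinAt₀

theorem eq_of_hasDerivWithinAt_zero {f : ℝ → ℝ} {T : ℝ}
    (h : ∀ t ∈ Set.Icc (-T) T, HasDerivWithinAt f 0 (Set.Icc (-T) T) t) {t : ℝ}
    (ht : t ∈ Set.Icc (-T) T) : f t = f 0 := by
  have h0 : (0 : ℝ) ∈ Set.Icc (-T) T := by
    constructor <;> linarith [ht.1, ht.2]
  have := (convex_Icc (-T) T).norm_image_sub_le_of_norm_hasDerivWithin_le h (C := 0)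
    (fun x _ => by simp) h0 ht
  rw [zero_mul] at this
  exact sub_eq_zero.1 (norm_le_zero_iff.1 this)

/-- Terms with k+m ≥ K vanish because a does; in the others all three indices lie below K and the
bracket is exactly -1. Hence truncation to K modes preserves both quadratic laws. -/
theorem sum_weight_mul_flux_eq_zero {a : ℕ → ℂ} {K : ℕ} (ha : ∀ n, K ≤ n → a n = 0) {w : ℕ → ℝ}
    (hw : ∀ m n, w (m + n) - w m - w n = -1) :
    ∑ n ∈ Finset.range K, w n * (conj (a n) * field a n).re = 0 := by
  have h := sum_weight_mul_flux (finEnergy_of_support ha)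
    (w := fun n => if n < K then w n else 0) (K := K) (fun n hn => if_neg (not_lt.2 hn))
  rw [Finset.sum_congr rfl (fun n hn => by rw [← if_pos (c := n < K) (t := w n) (e := 0)
    (Finset.mem_range.1 hn)]), h]
  have h1 : ∀ q : ℕ × ℕ, (((if q.1 + q.2 < K then w (q.1 + q.2) else 0) -
      (if q.1 < K then w q.1 else 0) - (if q.2 < K then w q.2 else 0) : ℝ) : ℂ) * triTerm a a a q =
      -triTerm a a a q := by
    intro q
    by_cases hq : q.1 + q.2 < K
    · rw [if_pos hq, if_pos (by omega), if_pos (by omega), hw]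
      simp
    · rw [triTerm, ha _ (not_lt.1 hq)]
      simp
  simp only [h1, tsum_neg]
  change (conj (cubic a) * -cubic a).im = 0
  simp only [Complex.mul_im, Complex.conj_re, Complex.conj_im, Complex.neg_re, Complex.neg_im]
  ring

theorem energySq_of_support {a : ℕ → ℂ} {K : ℕ} (ha : ∀ n, K ≤ n → a n = 0) :
    energySq a = ∑ n ∈ Finset.range K, ((n : ℝ) + 1) * ‖a n‖ ^ 2 :=
  tsum_eq_sum fun n hn => by rw [ha n (by simpa using hn)]; simp

/-- The truncated equation is an ODE with smooth field in finite dimension. Multiplying the field by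
a cutoff of the mass makes it compactly supported, hence globally solvable, and mass conservation
shows that the cutoff was never active. -/
theorem exists_galerkin {a₀ : ℕ → ℂ} (h₀ : FinEnergy a₀) (K : ℕ) {T : ℝ} (hT : 0 ≤ T) :
    ∃ A : ℝ → ℕ → ℂ, (∀ n < K, A 0 n = a₀ n) ∧ ∀ t ∈ Set.Icc (-T) T,
      (∀ n, K ≤ n → A t n = 0) ∧ energySq (A t) ≤ energySq a₀ ∧
      ∀ n < K, HasDerivWithinAt (fun s => A s n) (field (A t) n) (Set.Icc (-T) T) t := by
  set M := massSq a₀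
  have hM : 0 ≤ M := massSq_nonneg a₀
  let S : (Fin K → ℂ) → ℝ := fun x => ∑ i, ‖x i‖ ^ 2
  have hS : ContDiff ℝ 1 S := ContDiff.sum fun i _ => (contDiff_apply ℝ ℂ i).norm_sq ℝ
  -- This is 1 where S ≤ M + 1 and 0 where S ≥ M + 2. Outside the ball of radius M + 2 one has S >
  -- (M+2)² ≥ M + 2, whence the compact support.
  let χ : (Fin K → ℂ) → ℝ := fun x => Real.smoothTransition (M + 2 - S x)
  have hχ : ContDiff ℝ 1 χ := Real.smoothTransition.contDiff.comp (contDiff_const.sub hS)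
  let V : (Fin K → ℂ) → Fin K → ℂ := fun x i => χ x • field (zeroExtend x) i
  have hV : ContDiff ℝ 1 V :=
    contDiff_pi.2 fun i => hχ.smul (contDiff_field_zeroExtend i)
  have hVc : HasCompactSupport V := by
    refine HasCompactSupport.intro (isCompact_closedBall (0 : Fin K → ℂ) (M + 2)) fun x hx => ?_
    have hx' : ¬ ∀ i, ‖x i‖ ≤ M + 2 := by
      rwa [mem_closedBall_zero_iff, pi_norm_le_iff_of_nonneg (by linarith)] at hx
    push Not at hx'
    obtain ⟨i, hi⟩ := hx'
    have h1 : ‖x i‖ ^ 2 ≤ S x :=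
      Finset.single_le_sum (f := fun i => ‖x i‖ ^ 2) (fun _ _ => sq_nonneg _) (Finset.mem_univ i)
    have h2 : χ x = 0 := Real.smoothTransition.zero_of_nonpos (by nlinarith)
    funext j
    change χ x • _ = 0
    rw [h2, zero_smul]
  obtain ⟨α, hα0, hα⟩ := exists_integralCurve hV hVc (fun i : Fin K => a₀ i) hT
  let A : ℝ → ℕ → ℂ := fun t => zeroExtend (α t)
  have hsupp : ∀ t n, K ≤ n → A t n = 0 := fun t n hn => zeroExtend_of_le _ hn
  have hA0 : ∀ n < K, A 0 n = a₀ n := by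
    intro n hn
    change zeroExtend (α 0) n = _
    rw [hα0, zeroExtend, dif_pos hn]
  have hderiv : ∀ t ∈ Set.Icc (-T) T, ∀ n < K, HasDerivWithinAt (fun s => A s n)
      (χ (α t) • field (A t) n) (Set.Icc (-T) T) t := by
    intro t ht n hn
    have h1 := (hasDerivWithinAt_pi.1 (hα t ht)) ⟨n, hn⟩
    refine h1.congr_of_eventuallyEq (Eventually.of_forall fun s => ?_) ?_ <;>
    simp [A, zeroExtend, hn]
  -- The cutoff multiplies the field by a real scalar, so the vanishing flux stays zero.
  have hcons : ∀ w : ℕ → ℝ, (∀ m n, w (m + n) - w m - w n = -1) → ∀ t ∈ Set.Icc (-T) T,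
      ∑ n ∈ Finset.range K, w n * ‖A t n‖ ^ 2 = ∑ n ∈ Finset.range K, w n * ‖a₀ n‖ ^ 2 := by
    intro w hw t ht
    have h1 := eq_of_hasDerivWithinAt_zero (f := fun t => ∑ n ∈ Finset.range K, w n * ‖A t n‖ ^ 2)
      (fun t ht => ?_) ht
    · refine h1.trans (Finset.sum_congr rfl fun n hn => ?_)
      rw [hA0 n (Finset.mem_range.1 hn)]
    · have h2 : HasDerivWithinAt (fun t => ∑ n ∈ Finset.range K, w n * ‖A t n‖ ^ 2)
          (∑ n ∈ Finset.range K, w n * (2 * inner ℝ (A t n) (χ (α t) • field (A t) n)))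
          (Set.Icc (-T) T) t :=
        HasDerivWithinAt.fun_sum fun n hn =>
          ((hderiv t ht n (Finset.mem_range.1 hn)).norm_sq).const_mul (w n)
      convert h2 using 1
      have h3 := sum_weight_mul_flux_eq_zero (hsupp t) hw
      calc (0 : ℝ) = 2 * χ (α t) *
            ∑ n ∈ Finset.range K, w n * (conj (A t n) * field (A t) n).re := by rw [h3, mul_zero]
        _ = _ := by
          rw [Finset.mul_sum]
          refine Finset.sum_congr rfl fun n _ => ?_
          rw [inner_smul_right, Complex.inner, mul_comm (field (A t) n)]
          ring
  have hχ1 : ∀ t ∈ Set.Icc (-T) T, χ (α t) = 1 := by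
    intro t ht
    have h1 := hcons (fun _ => 1) (fun _ _ => by norm_num) t ht
    simp only [one_mul] at h1
    have h2 : S (α t) = ∑ n ∈ Finset.range K, ‖A t n‖ ^ 2 := by
      rw [Finset.sum_range]
      exact Finset.sum_congr rfl fun i _ => by rw [← zeroExtend_coe (α t) i]
    have h3 : ∑ n ∈ Finset.range K, ‖a₀ n‖ ^ 2 ≤ M :=
      h₀.summable.sum_le_tsum _ fun _ _ => sq_nonneg _
    refine Real.smoothTransition.one_of_one_le ?_
    rw [h2, h1]
    linarith
  refine ⟨A, hA0, fun t ht => ⟨hsupp t, ?_, fun n hn => ?_⟩⟩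
  · rw [energySq_of_support (hsupp t), hcons (fun n => (n : ℝ) + 1)
      (fun _ _ => by push_cast; ring) t ht]
    exact Summable.sum_le_tsum _ (fun _ _ => by positivity) h₀
  · simpa only [hχ1 t ht, one_smul] using hderiv t ht n hn

/-! ### Existence of global solutions -/

theorem FinEnergy.norm_apply_sq_le {a : ℕ → ℂ} (ha : FinEnergy a) (n : ℕ) :
    ‖a n‖ ^ 2 ≤ energySq a :=
  (ha.summable.le_tsum n fun _ _ => sq_nonneg _).trans ha.massSq_le

theorem norm_field_apply_le {a : ℕ → ℂ} (ha : FinEnergy a) {E : ℝ} (hE : energySq a ≤ E) (n : ℕ) :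
    ‖field a n‖ ≤ √(10 * E ^ 5) := by
  have h := norm_sq_field_le ha
  refine Real.le_sqrt_of_sq_le (((h.1.le_tsum n fun _ _ => sq_nonneg _).trans h.2).trans ?_)
  have := energySq_nonneg a
  gcongr

/-- Equi-Lipschitz bounded families of functions on growing intervals have a pointwise convergent
subsequence. -/
theorem exists_subseq_tendsto {A : ℕ → ℝ → ℕ → ℂ} {R L : ℝ} (hL : 0 ≤ L) (hR : 0 ≤ R)
    (hb : ∀ K : ℕ, ∀ t ∈ Set.Icc (-(K : ℝ)) K, ∀ n, ‖A K t n‖ ≤ R)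
    (hl : ∀ K : ℕ, ∀ s ∈ Set.Icc (-(K : ℝ)) K, ∀ t ∈ Set.Icc (-(K : ℝ)) K, ∀ n,
      ‖A K t n - A K s n‖ ≤ L * |t - s|) :
    ∃ (φ : ℕ → ℕ) (a : ℝ → ℕ → ℂ), StrictMono φ ∧
      ∀ t n, Tendsto (fun j => A (φ j) t n) atTop (𝓝 (a t n)) := by
  classical
  -- Restriction to rational times gives points of a countable product of closed balls. The default
  -- 0 keeps B in the ball when the time lies outside the interval, which for a given time concerns
  -- only finitely many K.
  let B : ℕ → ℚ × ℕ → ℂ := fun K q => if |(q.1 : ℝ)| ≤ K then A K q.1 q.2 else 0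
  have hB : ∀ K, B K ∈ Set.univ.pi fun _ : ℚ × ℕ => Metric.closedBall (0 : ℂ) R := by
    intro K q _
    rw [mem_closedBall_zero_iff]
    change ‖if |(q.1 : ℝ)| ≤ K then A K q.1 q.2 else 0‖ ≤ R
    split_ifs with h
    · exact hb K _ (abs_le.1 h) _
    · simpa using hR
  obtain ⟨b, -, φ, hφ, hlim⟩ := (isCompact_univ_pi fun _ : ℚ × ℕ =>
    isCompact_closedBall (0 : ℂ) R).tendsto_subseq hB
  rw [tendsto_pi_nhds] at hlim
  -- A real time is compared with a rational q at cost L|t-q| ≤ ε/4, uniformly in j.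
  have hcauchy : ∀ t n, CauchySeq fun j => A (φ j) t n := by
    intro t n
    rw [Metric.cauchySeq_iff']
    intro ε hε
    obtain ⟨q, hq1, hq2⟩ := exists_rat_btwn (show t < t + min 1 (ε / (4 * (L + 1))) by
      have : 0 < min 1 (ε / (4 * (L + 1))) := lt_min one_pos (by positivity)
      linarith)
    have hq3 : |t - q| ≤ 1 := by
      rw [abs_sub_comm, abs_of_pos (by linarith)]
      linarith [min_le_left 1 (ε / (4 * (L + 1)))]
    have hq4 : L * |t - q| ≤ ε / 4 := by
      have h1 : |t - q| ≤ ε / (4 * (L + 1)) := by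
        rw [abs_sub_comm, abs_of_pos (by linarith)]
        linarith [min_le_right 1 (ε / (4 * (L + 1)))]
      calc L * |t - q| ≤ (L + 1) * (ε / (4 * (L + 1))) := by gcongr; linarith
        _ = ε / 4 := by field_simp
    obtain ⟨N₀, hN₀⟩ := exists_nat_ge (|t| + 1)
    obtain ⟨N₁, hN₁⟩ := Metric.tendsto_atTop.1 (hlim (q, n)) (ε / 8) (by positivity)
    have hclose : ∀ j ≥ max N₀ N₁, ‖A (φ j) t n - b (q, n)‖ < ε / 2 := by
      intro j hj
      have hj0 : |t| + 1 ≤ (φ j : ℝ) := hN₀.trans (by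
        exact_mod_cast (le_max_left _ _).trans (hj.trans (hφ.id_le j)))
      have htm : t ∈ Set.Icc (-(φ j : ℝ)) (φ j) := abs_le.1 (by linarith)
      have hqa : |(q : ℝ)| ≤ φ j := by
        have := abs_sub_abs_le_abs_sub (q : ℝ) t
        rw [abs_sub_comm] at this
        linarith
      have h1 := hN₁ j ((le_max_right _ _).trans hj)
      simp only [Function.comp_apply, B, hqa, if_true, dist_eq_norm] at h1
      have h2 := hl (φ j) q (abs_le.1 hqa) t htm n
      calc ‖A (φ j) t n - b (q, n)‖
          ≤ ‖A (φ j) t n - A (φ j) q n‖ + ‖A (φ j) q n - b (q, n)‖ := norm_sub_le_norm_sub_add_norm_sub _ _ _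
        _ < ε / 2 := by linarith
    refine ⟨max N₀ N₁, fun j hj => ?_⟩
    rw [dist_eq_norm]
    calc _ ≤ ‖A (φ j) t n - b (q, n)‖ + ‖b (q, n) - A (φ (max N₀ N₁)) t n‖ :=
          norm_sub_le_norm_sub_add_norm_sub _ _ _
      _ < ε := by
        rw [norm_sub_rev (b (q, n))]
        linarith [hclose j hj, hclose _ le_rfl]
  choose a ha using fun t n => cauchySeq_tendsto_of_complete (hcauchy t n)
  exact ⟨φ, a, hφ, ha⟩

theorem continuousOn_field {A : ℝ → ℕ → ℂ} {s : Set ℝ} {E : ℝ}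
    (hA : ∀ n, ContinuousOn (fun t => A t n) s)
    (hE : ∀ t ∈ s, FinEnergy (A t) ∧ energySq (A t) ≤ E) (n : ℕ) :
    ContinuousOn (fun t => field (A t) n) s := by
  intro t ht
  have : (𝓝[s] t).NeBot := mem_closure_iff_nhdsWithin_neBot.1 (subset_closure ht)
  exact tendsto_field (fun m => hA m t ht) (eventually_mem_nhdsWithin.mono hE) n

/-- Galerkin solutions have uniformly bounded energy, hence uniformly Lipschitz coefficients. A
coefficientwise limit suffices, since `tendsto_field` passes the nonlinearity to the limit under
bounded energy. -/
theorem exists_coeffSolution {a₀ : ℕ → ℂ} (h₀ : FinEnergy a₀) :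
    ∃ a : ℝ → ℕ → ℂ, CoeffSolution a ∧ a 0 = a₀ := by
  set E := energySq a₀ with hEdef
  have hE0 : 0 ≤ E := energySq_nonneg a₀
  -- The same integer serves as the number of modes and as the half-length of the time interval.
  choose A hA0 hA using fun K : ℕ => exists_galerkin h₀ K (Nat.cast_nonneg (α := ℝ) K)
  have hfin : ∀ K : ℕ, ∀ t ∈ Set.Icc (-(K : ℝ)) K, FinEnergy (A K t) ∧ energySq (A K t) ≤ E :=
    fun K t ht => ⟨finEnergy_of_support (hA K t ht).1, (hA K t ht).2.1⟩
  set L := √(10 * E ^ 5)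
  have hlip : ∀ K : ℕ, ∀ s ∈ Set.Icc (-(K : ℝ)) K, ∀ t ∈ Set.Icc (-(K : ℝ)) K, ∀ n,
      ‖A K t n - A K s n‖ ≤ L * |t - s| := by
    intro K s hs t ht n
    by_cases hn : n < K
    · exact (convex_Icc (-(K : ℝ)) K).norm_image_sub_le_of_norm_hasDerivWithin_le
        (fun r hr => (hA K r hr).2.2 n hn)
        (fun r hr => norm_field_apply_le (hfin K r hr).1 (hfin K r hr).2 n) hs ht
    · rw [(hA K t ht).1 n (not_lt.1 hn), (hA K s hs).1 n (not_lt.1 hn), sub_zero, norm_zero]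
      positivity
  obtain ⟨φ, a, hφ, ha⟩ := exists_subseq_tendsto (A := A) (R := √E) (Real.sqrt_nonneg (10 * E ^ 5))
    (Real.sqrt_nonneg _) (fun K t ht n => Real.le_sqrt_of_sq_le
      (((hfin K t ht).1.norm_apply_sq_le n).trans (hfin K t ht).2)) hlip
  have hev : ∀ T : ℝ, ∀ᶠ j in atTop, T < (φ j : ℝ) := fun T =>
    (tendsto_natCast_atTop_atTop.comp hφ.tendsto_atTop).eventually_gt_atTop T
  have hfin' : ∀ t, ∀ᶠ j in atTop, FinEnergy (A (φ j) t) ∧ energySq (A (φ j) t) ≤ E := by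
    intro t
    filter_upwards [hev |t|] with j hj
    exact hfin _ t (abs_le.1 hj.le)
  have hafin : ∀ t, FinEnergy (a t) ∧ energySq (a t) ≤ E := fun t =>
    finEnergy_of_tendsto (ha t) (hfin' t)
  have halip : ∀ n s t, ‖a t n - a s n‖ ≤ L * |t - s| := by
    intro n s t
    refine le_of_tendsto ((ha t n).sub (ha s n)).norm ?_
    filter_upwards [hev |t|, hev |s|] with j hj hj'
    exact hlip _ s (abs_le.1 hj'.le) t (abs_le.1 hj.le) n
  have hacont : ∀ n, Continuous fun t => a t n := by
    intro n
    refine (LipschitzWith.of_dist_le_mul (K := ⟨L, Real.sqrt_nonneg _⟩) fun t s => ?_).continuous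
    rw [dist_eq_norm, Real.dist_eq]
    exact halip n s t
  have hfcont : ∀ n, Continuous fun t => field (a t) n := fun n =>
    continuousOn_univ.1 (continuousOn_field (fun m => (hacont m).continuousOn)
      (fun t _ => hafin t) n)
  have ha0 : ∀ n, a 0 n = a₀ n := by
    intro n
    refine tendsto_nhds_unique (ha 0 n) (tendsto_const_nhds.congr' ?_)
    filter_upwards [hev n] with j hj
    exact (hA0 (φ j) n (by exact_mod_cast hj)).symm
  -- The limit is taken in the integral equation by dominated convergence; differentiability returns
  -- from continuity of the limiting field.
  have hint : ∀ t n, a t n = a₀ n + ∫ s in 0..t, field (a s) n := by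
    intro t n
    have hsub : ∀ j, |t| < (φ j : ℝ) → Set.uIcc 0 t ⊆ Set.Ioo (-(φ j : ℝ)) (φ j) := by
      intro j hj s hs
      have h1 := abs_le.1 (le_refl |t|)
      rcases Set.mem_uIcc.1 hs with h | h <;> constructor <;> linarith [h.1, h.2, h1.1, h1.2]
    have hAc : ∀ j, ∀ m, ContinuousOn (fun s => A (φ j) s m) (Set.Icc (-(φ j : ℝ)) (φ j)) := by
      intro j m
      by_cases hm : m < φ j
      · exact fun s hs => ((hA (φ j) s hs).2.2 m hm).continuousWithinAt
      · exact continuousOn_const.congr fun s hs => (hA (φ j) s hs).1 m (not_lt.1 hm)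
    have hFc : ∀ j, |t| < (φ j : ℝ) →
        ContinuousOn (fun s => field (A (φ j) s) n) (Set.uIcc 0 t) := fun j hj =>
      (continuousOn_field (hAc j) (hfin (φ j)) n).mono
        ((hsub j hj).trans Set.Ioo_subset_Icc_self)
    have h1 : Tendsto (fun j => ∫ s in 0..t, field (A (φ j) s) n) atTop
        (𝓝 (∫ s in 0..t, field (a s) n)) := by
      refine intervalIntegral.tendsto_integral_filter_of_dominated_convergence (fun _ => L)
        ?_ ?_ intervalIntegrable_const ?_
      · filter_upwards [hev |t|] with j hj
        exact ((hFc j hj).mono Set.uIoc_subset_uIcc).aestronglyMeasurable measurableSet_uIoc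
      · filter_upwards [hev |t|] with j hj
        refine Eventually.of_forall fun s hs => ?_
        have hs' := Set.Ioo_subset_Icc_self (hsub j hj (Set.uIoc_subset_uIcc hs))
        exact norm_field_apply_le (hfin _ s hs').1 (hfin _ s hs').2 n
      · exact Eventually.of_forall fun s _ => tendsto_field (ha s) (hfin' s) n
    have h2 : Tendsto (fun j => ∫ s in 0..t, field (A (φ j) s) n) atTop (𝓝 (a t n - a 0 n)) := by
      refine ((ha t n).sub (ha 0 n)).congr' ?_
      filter_upwards [hev |t|, hev n] with j hj hn
      refine (intervalIntegral.integral_eq_sub_of_hasDerivAt (f := fun s => A (φ j) s n)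
        (fun s hs => ?_) (hFc j hj).intervalIntegrable).symm
      have hs' := hsub j hj hs
      exact ((hA (φ j) s (Set.Ioo_subset_Icc_self hs')).2.2 n (by exact_mod_cast hn)).hasDerivAt
        (Icc_mem_nhds hs'.1 hs'.2)
    rw [tendsto_nhds_unique h1 h2, ha0]
    ring
  refine ⟨a, ⟨fun t => (hafin t).1, fun T => ⟨E, fun t _ => (hafin t).2⟩, fun t n => ?_⟩,
    funext ha0⟩
  have h1 := ((hfcont n).integral_hasStrictDerivAt 0 t).hasDerivAt.const_add (a₀ n)
  exact h1.congr_of_eventuallyEq (Eventually.of_forall fun s => hint s n)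

/-! ### Strong continuity in H^{1/2}. -/

theorem energySq_sub_head_le {a b : ℕ → ℂ} (ha : FinEnergy a) (hb : FinEnergy b) (m : ℕ) :
    energySq (a - b) ≤ ∑ n ∈ Finset.range m, ((n : ℝ) + 1) * ‖(a - b) n‖ ^ 2 +
      (2 * (energySq a - ∑ n ∈ Finset.range m, ((n : ℝ) + 1) * ‖a n‖ ^ 2) +
        2 * (energySq b - ∑ n ∈ Finset.range m, ((n : ℝ) + 1) * ‖b n‖ ^ 2)) := by
  have key : ∀ {c : ℕ → ℂ}, FinEnergy c →
      Summable (fun n => (((n + m : ℕ) : ℝ) + 1) * ‖c (n + m)‖ ^ 2) ∧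
      energySq c - ∑ n ∈ Finset.range m, ((n : ℝ) + 1) * ‖c n‖ ^ 2 =
        ∑' n, (((n + m : ℕ) : ℝ) + 1) * ‖c (n + m)‖ ^ 2 := by
    intro c hc
    refine ⟨(summable_nat_add_iff (f := fun n : ℕ => ((n : ℝ) + 1) * ‖c n‖ ^ 2) m).2 hc, ?_⟩
    rw [energySq, ← Summable.sum_add_tsum_nat_add m hc, add_sub_cancel_left]
  obtain ⟨sa, ea⟩ := key ha
  obtain ⟨sb, eb⟩ := key hb
  obtain ⟨sd, ed⟩ := key (ha.sub hb)
  rw [ea, eb, ← tsum_mul_left, ← tsum_mul_left, ← (sa.mul_left 2).tsum_add (sb.mul_left 2),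
    ← sub_le_iff_le_add', ed]
  refine sd.tsum_le_tsum (fun n => ?_) ((sa.mul_left 2).add (sb.mul_left 2))
  have := mul_le_mul_of_nonneg_left (norm_sub_sq_le (a (n + m)) (b (n + m)))
    (by positivity : (0 : ℝ) ≤ (((n + m : ℕ) : ℝ) + 1))
  simp only [Pi.sub_apply]
  linarith

/-- Convergence of coefficients and of the `H^{1/2}` norms implies strong convergence. -/
theorem tendsto_energySq_sub {ι : Type*} {l : Filter ι} {A : ι → ℕ → ℂ} {a : ℕ → ℂ}
    (hA : ∀ n, Tendsto (fun i => A i n) l (𝓝 (a n))) (hfin : ∀ i, FinEnergy (A i))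
    (ha : FinEnergy a) (hE : Tendsto (fun i => energySq (A i)) l (𝓝 (energySq a))) :
    Tendsto (fun i => energySq (A i - a)) l (𝓝 0) := by
  rw [tendsto_order]
  refine ⟨fun x hx => Eventually.of_forall fun i => hx.trans_le (energySq_nonneg _), fun ε hε => ?_⟩
  have hhead : Tendsto (fun m => 2 * (energySq a -
      ∑ n ∈ Finset.range m, ((n : ℝ) + 1) * ‖a n‖ ^ 2)) atTop (𝓝 0) := by
    have h := (tendsto_const_nhds (x := energySq a)).sub (Summable.hasSum ha).tendsto_sum_nat
    have h' := h.const_mul 2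
    rw [← energySq, sub_self, mul_zero] at h'
    exact h'
  obtain ⟨m, hm⟩ := (hhead.eventually_lt_const (show (0 : ℝ) < ε / 2 by positivity)).exists
  have h1 : Tendsto (fun i => ∑ n ∈ Finset.range m, ((n : ℝ) + 1) * ‖(A i - a) n‖ ^ 2 +
      (2 * (energySq (A i) - ∑ n ∈ Finset.range m, ((n : ℝ) + 1) * ‖A i n‖ ^ 2) +
        2 * (energySq a - ∑ n ∈ Finset.range m, ((n : ℝ) + 1) * ‖a n‖ ^ 2))) l
      (𝓝 (∑ n ∈ Finset.range m, ((n : ℝ) + 1) * ‖a n - a n‖ ^ 2 +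
      (2 * (energySq a - ∑ n ∈ Finset.range m, ((n : ℝ) + 1) * ‖a n‖ ^ 2) +
        2 * (energySq a - ∑ n ∈ Finset.range m, ((n : ℝ) + 1) * ‖a n‖ ^ 2)))) :=
    (tendsto_finsetSum _ fun n _ =>
      ((((hA n).sub tendsto_const_nhds).norm).pow 2).const_mul _).add
      (((hE.sub (tendsto_finsetSum _ fun n _ => (((hA n).norm).pow 2).const_mul _)).const_mul
        2).add tendsto_const_nhds)
  refine (h1.eventually_lt_const ?_).mono fun i hi => (energySq_sub_head_le (hfin i) ha m).trans_lt hi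
  simp only [sub_self, norm_zero, ne_eq, OfNat.ofNat_ne_zero, not_false_eq_true, zero_pow,
    mul_zero, Finset.sum_const_zero, zero_add]
  linarith

theorem CoeffSolution.tendsto_energySq_sub {a : ℝ → ℕ → ℂ} (h : CoeffSolution a) (t : ℝ) :
    Tendsto (fun s => energySq (a s - a t)) (𝓝 t) (𝓝 0) := by
  refine QuadSzego.tendsto_energySq_sub (fun n => (h.deriv t n).continuousAt) h.fin (h.fin t) ?_
  simp only [h.energySq_eq]
  exact tendsto_const_nhds

/-! ### Rigidity of the ground states -/

theorem hasSum_of_eq {ι : Type*} {f g : ι → ℝ} {x y : ℝ} (h : HasSum f x) (hfg : ∀ i, g i = f i)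
    (hxy : y = x) : HasSum g y := by
  rw [hxy, funext hfg]
  exact h

theorem sqrt_tsum_norm_sq_add_le {ι : Type*} {f g : ι → ℂ} (hf : Summable fun i => ‖f i‖ ^ 2)
    (hg : Summable fun i => ‖g i‖ ^ 2) :
    √(∑' i, ‖f i + g i‖ ^ 2) ≤ √(∑' i, ‖f i‖ ^ 2) + √(∑' i, ‖g i‖ ^ 2) := by
  have hcs := cauchySchwarz_tsum hf hg
  have hf0 : 0 ≤ ∑' i, ‖f i‖ ^ 2 := tsum_nonneg fun _ => sq_nonneg _
  have hg0 : 0 ≤ ∑' i, ‖g i‖ ^ 2 := tsum_nonneg fun _ => sq_nonneg _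
  have hle : ∀ i, ‖f i + g i‖ ^ 2 ≤ ‖f i‖ ^ 2 + 2 * (‖f i‖ * ‖g i‖) + ‖g i‖ ^ 2 := by
    intro i
    have := norm_add_le (f i) (g i)
    calc ‖f i + g i‖ ^ 2 ≤ (‖f i‖ + ‖g i‖) ^ 2 := by gcongr
      _ = _ := by ring
  have hs := (hf.add (hcs.1.mul_left 2)).add hg
  have h1 := (Summable.of_nonneg_of_le (fun _ => sq_nonneg _) hle hs).tsum_le_tsum hle hs
  rw [(hf.add (hcs.1.mul_left 2)).tsum_add hg, hf.tsum_add (hcs.1.mul_left 2), tsum_mul_left] at h1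
  have h2 : ∑' i, ‖f i‖ * ‖g i‖ ≤ √(∑' i, ‖f i‖ ^ 2) * √(∑' i, ‖g i‖ ^ 2) := by
    rw [← Real.sqrt_mul hf0]
    exact Real.le_sqrt_of_sq_le hcs.2
  refine Real.sqrt_le_iff.2 ⟨by positivity, h1.trans ?_⟩
  nlinarith [Real.sq_sqrt hf0, Real.sq_sqrt hg0]

/-- Radial projection onto the circle of radius ρ; at z = 0 any point of the circle will do. -/
theorem exists_norm_eq_norm_sub_eq (z : ℂ) {ρ : ℝ} (hρ : 0 ≤ ρ) :
    ∃ w : ℂ, ‖w‖ = ρ ∧ ‖z - w‖ = |‖z‖ - ρ| := by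
  by_cases hz : z = 0
  · refine ⟨ρ, by simp [abs_of_nonneg hρ], by simp [hz]⟩
  · have hz' : (‖z‖ : ℂ) ≠ 0 := by simpa using hz
    refine ⟨(ρ / ‖z‖ : ℝ) * z, ?_, ?_⟩
    · rw [norm_mul, Complex.norm_real, Real.norm_eq_abs, abs_of_nonneg (by positivity)]
      exact div_mul_cancel₀ _ (by simpa using hz)
    · have : z - (ρ / ‖z‖ : ℝ) * z = ((‖z‖ - ρ) / ‖z‖ : ℝ) * z := by
        push_cast
        field_simp
      rw [this, norm_mul, Complex.norm_real, Real.norm_eq_abs, abs_div, abs_norm]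
      exact div_mul_cancel₀ _ (by simpa using hz)

/-- The coefficients of `z ↦ l / (1 - p z)`. -/
def geom (l p : ℂ) (n : ℕ) : ℂ := l * p ^ n

theorem norm_geom_sq (l p : ℂ) (n : ℕ) : ‖geom l p n‖ ^ 2 = ‖l‖ ^ 2 * (‖p‖ ^ 2) ^ n := by
  rw [geom, norm_mul, norm_pow]
  ring

theorem hasSum_geom_mass (l : ℂ) {p : ℂ} (hp : ‖p‖ < 1) :
    HasSum (fun n => ‖geom l p n‖ ^ 2) (‖l‖ ^ 2 / (1 - ‖p‖ ^ 2)) := by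
  have hr : ‖p‖ ^ 2 < 1 := by nlinarith [norm_nonneg p]
  simp only [norm_geom_sq]
  exact (hasSum_geometric_of_lt_one (sq_nonneg _) hr).mul_left _

theorem hasSum_geom_energy (l : ℂ) {p : ℂ} (hp : ‖p‖ < 1) :
    HasSum (fun n : ℕ => ((n : ℝ) + 1) * ‖geom l p n‖ ^ 2) (‖l‖ ^ 2 / (1 - ‖p‖ ^ 2) ^ 2) := by
  have hr : ‖p‖ ^ 2 < 1 := by nlinarith [norm_nonneg p]
  have h1 := hasSum_geometric_of_lt_one (sq_nonneg ‖p‖) hr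
  have h2 := hasSum_coe_mul_geometric_of_norm_lt_one (r := ‖p‖ ^ 2)
    (by rwa [Real.norm_of_nonneg (sq_nonneg _)])
  refine hasSum_of_eq ((h2.add h1).mul_left (‖l‖ ^ 2)) (fun n => ?_) ?_
  · rw [norm_geom_sq]
    ring
  · have : 1 - ‖p‖ ^ 2 ≠ 0 := by linarith
    field_simp
    ring

theorem finEnergy_geom (l : ℂ) {p : ℂ} (hp : ‖p‖ < 1) : FinEnergy (geom l p) :=
  (hasSum_geom_energy l hp).summable

theorem massSq_geom (l : ℂ) {p : ℂ} (hp : ‖p‖ < 1) :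
    massSq (geom l p) = ‖l‖ ^ 2 / (1 - ‖p‖ ^ 2) := (hasSum_geom_mass l hp).tsum_eq

theorem energySq_geom (l : ℂ) {p : ℂ} (hp : ‖p‖ < 1) :
    energySq (geom l p) = ‖l‖ ^ 2 / (1 - ‖p‖ ^ 2) ^ 2 := (hasSum_geom_energy l hp).tsum_eq

/-- For a geometric sequence a_k a_m = l a_{k+m}, so each summand of J is l|a_{k+m}|²: the equality
case of Cauchy–Schwarz. -/
theorem cubic_geom (l : ℂ) {p : ℂ} (hp : ‖p‖ < 1) :
    cubic (geom l p) = l * energySq (geom l p) := by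
  have h := (energySq_eq_tsum_prod (finEnergy_geom l hp))
  have h2 := (Complex.hasSum_ofReal.2 h).mul_left l
  rw [← h2.tsum_eq]
  unfold cubic tri
  congr 1
  funext q
  rw [Complex.ofReal_pow, ← Complex.mul_conj', triTerm]
  simp only [geom, pow_add]
  ring

/-- The deviation of `a` from being geometric, as measured by the Cauchy–Schwarz defect in
`|J|² ≤ ‖a‖_{L²}⁴ ‖a‖²_{H^{1/2}}`. -/
theorem hasSum_defect {a : ℕ → ℂ} (ha : FinEnergy a) :
    HasSum (fun q : ℕ × ℕ => ‖a (q.1 + q.2) -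
        conj (cubic a) / (massSq a : ℂ) ^ 2 * (a q.1 * a q.2)‖ ^ 2)
      (energySq a - ‖cubic a‖ ^ 2 / massSq a ^ 2) := by
  -- This is the coefficient of the orthogonal projection of the Hankel matrix onto the line of a ⊗
  -- a. If the mass is 0, division by zero gives c = 0 and the identity persists.
  set c := conj (cubic a) / (massSq a : ℂ) ^ 2 with hc
  have hT : HasSum (triTerm a a a) (cubic a) :=
    (triTerm_low ha.summable ha.summable ha).1.of_norm.hasSum
  have h1 := energySq_eq_tsum_prod ha
  have h2 := (Complex.hasSum_re (hT.mul_left c)).mul_left 2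
  have hs : Summable fun q : ℕ × ℕ => ‖a q.1‖ ^ 2 * ‖a q.2‖ ^ 2 :=
    ha.summable.mul_of_nonneg ha.summable (fun _ => sq_nonneg _) fun _ => sq_nonneg _
  have h3 := hs.hasSum
  rw [← ha.summable.tsum_mul_tsum ha.summable hs] at h3
  have h4 := (h1.sub h2).add (h3.mul_left (‖c‖ ^ 2))
  refine hasSum_of_eq h4 (fun q => ?_) ?_
  · rw [← Complex.normSq_eq_norm_sq, Complex.normSq_sub, Complex.normSq_eq_norm_sq,
      Complex.normSq_eq_norm_sq, norm_mul, norm_mul, triTerm]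
    have : (a (q.1 + q.2) * conj (c * (a q.1 * a q.2))).re =
        (c * (a q.1 * a q.2 * conj (a (q.1 + q.2)))).re := by
      rw [← Complex.conj_re]
      simp only [map_mul, Complex.conj_conj]
      congr 1
      ring
    rw [this]
    ring
  · change _ = energySq a - 2 * (c * cubic a).re + ‖c‖ ^ 2 * (massSq a * massSq a)
    have e1 : c * cubic a = ((‖cubic a‖ ^ 2 / massSq a ^ 2 : ℝ) : ℂ) := by
      rw [hc]
      push_cast
      rw [← Complex.conj_mul']
      ring
    have e2 : ‖c‖ = ‖cubic a‖ / massSq a ^ 2 := by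
      rw [hc, norm_div, Complex.norm_conj, norm_pow, Complex.norm_real,
        Real.norm_of_nonneg (massSq_nonneg a)]
    rw [e1, Complex.ofReal_re, e2]
    by_cases h0 : massSq a = 0
    · simp [h0]
    · field_simp
      ring

theorem tsum_slice_le {g : ℕ × ℕ → ℝ} (hg : Summable g) (h0 : ∀ q, 0 ≤ g q) (l : ℕ) :
    ∑' k, g (k, l) ≤ ∑' q, g q :=
  tsum_comp_le_tsum_of_inj hg h0 (i := fun k => (k, l)) fun _ _ h => (Prod.mk.inj h).1

theorem summable_slice {g : ℕ × ℕ → ℝ} (hg : Summable g) (l : ℕ) : Summable fun k => g (k, l) :=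
  hg.comp_injective (i := fun k : ℕ => (k, l)) fun _ _ h => (Prod.mk.inj h).1

theorem summable_shift {a : ℕ → ℂ} (ha : Summable fun n => ‖a n‖ ^ 2) :
    Summable fun n => ‖a (n + 1)‖ ^ 2 :=
  (summable_nat_add_iff (f := fun n => ‖a n‖ ^ 2) 1).2 ha

theorem massSq_eq_zero_add {a : ℕ → ℂ} (ha : Summable fun n => ‖a n‖ ^ 2) :
    massSq a = ‖a 0‖ ^ 2 + ∑' n, ‖a (n + 1)‖ ^ 2 := ha.tsum_eq_zero_add

/-- A sequence which is nearly geometric with ratio `p`, `|p| < 1`, is close to a geometric one. -/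
theorem sqrt_massSq_sub_geom_le {b : ℕ → ℂ} (hb : FinEnergy b) (l : ℂ) {p : ℂ} (hp : ‖p‖ < 1) :
    (1 - ‖p‖) * √(massSq (b - geom l p)) ≤
      ‖b 0 - l‖ + √(∑' n, ‖b (n + 1) - p * b n‖ ^ 2) := by
  set d := b - geom l p with hd
  have hds : Summable fun n => ‖d n‖ ^ 2 := (hb.sub (finEnergy_geom l hp)).summable
  -- The difference obeys the geometric recurrence with the residual as source; taking ℓ² norms,
  -- |p|‖d‖ is absorbed on the left because |p| < 1.
  have hrec : ∀ n, d (n + 1) = p * d n + (b (n + 1) - p * b n) := by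
    intro n
    simp only [hd, Pi.sub_apply, geom, pow_succ]
    ring
  have hpd : Summable fun n => ‖p * d n‖ ^ 2 := by
    simp only [norm_mul, mul_pow]
    exact hds.mul_left _
  have hres : Summable fun n => ‖b (n + 1) - p * b n‖ ^ 2 := by
    have : ∀ n, b (n + 1) - p * b n = d (n + 1) - p * d n := fun n => by rw [hrec]; ring
    simp only [this]
    exact summable_sq_sub (a := fun n => d (n + 1)) (b := fun n => p * d n) (summable_shift hds) hpd
  have h1 := sqrt_tsum_norm_sq_add_le hpd hres
  simp only [← hrec] at h1
  have h2 : √(∑' n, ‖p * d n‖ ^ 2) = ‖p‖ * √(massSq d) := by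
    simp only [norm_mul, mul_pow, tsum_mul_left]
    rw [Real.sqrt_mul (sq_nonneg _), Real.sqrt_sq (norm_nonneg _)]
    rfl
  have h3 : √(massSq d) ≤ ‖d 0‖ + √(∑' n, ‖d (n + 1)‖ ^ 2) := by
    rw [massSq_eq_zero_add hds]
    have h0 : 0 ≤ ∑' n, ‖d (n + 1)‖ ^ 2 := tsum_nonneg fun _ => sq_nonneg _
    refine Real.sqrt_le_iff.2 ⟨by positivity, ?_⟩
    have := mul_nonneg (norm_nonneg (d 0)) (Real.sqrt_nonneg (∑' n, ‖d (n + 1)‖ ^ 2))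
    nlinarith [Real.sq_sqrt h0]
  have h4 : d 0 = b 0 - l := by simp [hd, geom]
  rw [h4] at h3
  linarith

theorem norm_add_sq_le (x y : ℂ) : ‖x + y‖ ^ 2 ≤ 2 * ‖x‖ ^ 2 + 2 * ‖y‖ ^ 2 := by
  simpa using norm_sub_sq_le x (-y)

theorem hasSum_norm_sq_mul {x y : ℕ → ℂ} (hx : Summable fun n => ‖x n‖ ^ 2)
    (hy : Summable fun n => ‖y n‖ ^ 2) :
    HasSum (fun q : ℕ × ℕ => ‖x q.1‖ ^ 2 * ‖y q.2‖ ^ 2) (massSq x * massSq y) := by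
  have hs : Summable fun q : ℕ × ℕ => ‖x q.1‖ ^ 2 * ‖y q.2‖ ^ 2 :=
    hx.mul_of_nonneg hy (fun _ => sq_nonneg _) fun _ => sq_nonneg _
  rw [massSq, massSq, hx.tsum_mul_tsum hy hs]
  exact hs.hasSum

/-- Upgrade from ℓ² to H^{1/2}: both Hankel matrices are (nearly) rank-one tensors, so their
difference is the defect plus tensors containing a factor c - l⁻¹ or d, and these are controlled by
masses only. The constants 2, 4, 8 come from nested uses of |x+y|² ≤ 2|x|² + 2|y|². -/
theorem energySq_sub_geom_le {b : ℕ → ℂ} (hb : FinEnergy b) {l p : ℂ} (hl : l ≠ 0) (hp : ‖p‖ < 1)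
    (c : ℂ) (hs : Summable fun q : ℕ × ℕ => ‖b (q.1 + q.2) - c * (b q.1 * b q.2)‖ ^ 2) :
    energySq (b - geom l p) ≤
      2 * ∑' q : ℕ × ℕ, ‖b (q.1 + q.2) - c * (b q.1 * b q.2)‖ ^ 2 +
      (4 * ‖c - l⁻¹‖ ^ 2 * (massSq b * massSq b) +
        (8 * ‖l⁻¹‖ ^ 2 * (massSq (b - geom l p) * massSq b) +
          8 * ‖l⁻¹‖ ^ 2 * (massSq (geom l p) * massSq (b - geom l p)))) := by
  set w := geom l p with hw
  set d := b - w with hd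
  have hws := (finEnergy_geom l hp).summable
  have hds : Summable fun n => ‖d n‖ ^ 2 := (hb.sub (finEnergy_geom l hp)).summable
  have hwmul : ∀ k m, w (k + m) = l⁻¹ * (w k * w m) := by
    intro k m
    simp only [hw, geom, pow_add]
    field_simp
  have h1 := energySq_eq_tsum_prod (hb.sub (finEnergy_geom l hp))
  have h2 := (hs.hasSum.mul_left 2).add
    (((hasSum_norm_sq_mul hb.summable hb.summable).mul_left (4 * ‖c - l⁻¹‖ ^ 2)).add
    (((hasSum_norm_sq_mul hds hb.summable).mul_left (8 * ‖l⁻¹‖ ^ 2)).add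
      ((hasSum_norm_sq_mul hws hds).mul_left (8 * ‖l⁻¹‖ ^ 2))))
  refine hasSum_le (fun q => ?_) h1 h2
  have e : d (q.1 + q.2) = (b (q.1 + q.2) - c * (b q.1 * b q.2)) +
      ((c - l⁻¹) * (b q.1 * b q.2) + (l⁻¹ * (d q.1 * b q.2) + l⁻¹ * (w q.1 * d q.2))) := by
    simp only [hd, Pi.sub_apply]
    rw [hwmul]
    ring
  change ‖d (q.1 + q.2)‖ ^ 2 ≤ _
  rw [e]
  have i1 := norm_add_sq_le (b (q.1 + q.2) - c * (b q.1 * b q.2))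
    ((c - l⁻¹) * (b q.1 * b q.2) + (l⁻¹ * (d q.1 * b q.2) + l⁻¹ * (w q.1 * d q.2)))
  have i2 := norm_add_sq_le ((c - l⁻¹) * (b q.1 * b q.2))
    (l⁻¹ * (d q.1 * b q.2) + l⁻¹ * (w q.1 * d q.2))
  have i3 := norm_add_sq_le (l⁻¹ * (d q.1 * b q.2)) (l⁻¹ * (w q.1 * d q.2))
  simp only [norm_mul, mul_pow] at i2 i3
  linarith

/-- A family whose mass, energy and `|J|` converge to those of a ground state converges to the
orbit of the ground state in `H^{1/2}`. -/
theorem exists_tendsto_geom {ι : Type*} {f : Filter ι} {l p : ℂ} (hl : l ≠ 0) (hp : ‖p‖ < 1)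
    {b : ι → ℕ → ℂ} (hb : ∀ i, FinEnergy (b i))
    (hQ : Tendsto (fun i => massSq (b i)) f (𝓝 (massSq (geom l p))))
    (hN : Tendsto (fun i => energySq (b i)) f (𝓝 (energySq (geom l p))))
    (hJ : Tendsto (fun i => ‖cubic (b i)‖) f (𝓝 ‖cubic (geom l p)‖)) :
    ∃ l' p' : ι → ℂ, (∀ i, ‖l' i‖ = ‖l‖) ∧ (∀ i, ‖p' i‖ = ‖p‖) ∧
      Tendsto (fun i => energySq (b i - geom (l' i) (p' i))) f (𝓝 0) := by
  have hr : 0 < 1 - ‖p‖ ^ 2 := by nlinarith [norm_nonneg p]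
  have hl0 : 0 < ‖l‖ := norm_pos_iff.2 hl
  set Q₀ := massSq (geom l p) with hQ₀
  set N₀ := energySq (geom l p) with hN₀
  have eQ : Q₀ = ‖l‖ ^ 2 / (1 - ‖p‖ ^ 2) := massSq_geom l hp
  have eN : N₀ = ‖l‖ ^ 2 / (1 - ‖p‖ ^ 2) ^ 2 := energySq_geom l hp
  have hQ0 : 0 < Q₀ := by rw [eQ]; positivity
  have hN0 : 0 < N₀ := by rw [eN]; positivity
  have hQN : Q₀ ^ 2 = ‖l‖ ^ 2 * N₀ := by rw [eQ, eN]; field_simp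
  have eJ : ‖cubic (geom l p)‖ = ‖l‖ * N₀ := by
    rw [cubic_geom l hp, norm_mul, Complex.norm_real, Real.norm_of_nonneg (energySq_nonneg _)]
  rw [eJ] at hJ
  set c : ι → ℂ := fun i => conj (cubic (b i)) / (massSq (b i) : ℂ) ^ 2 with hc
  set δ : ι → ℝ := fun i => energySq (b i) - ‖cubic (b i)‖ ^ 2 / massSq (b i) ^ 2 with hδdef
  have hdef := fun i => hasSum_defect (hb i)
  -- The ground state is an extremal: Q₀² = |l|² N₀ and |J| = |l| N₀, so its own defect is 0.
  have hδ : Tendsto δ f (𝓝 0) := by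
    have h := hN.sub ((hJ.pow 2).div (hQ.pow 2) (by positivity))
    have e : N₀ - (‖l‖ * N₀) ^ 2 / Q₀ ^ 2 = 0 := by
      rw [hQN]; field_simp; ring
    rwa [e] at h
  have hcn : Tendsto (fun i => ‖c i‖) f (𝓝 ‖l‖⁻¹) := by
    have h := hJ.div (hQ.pow 2) (by positivity)
    have e : ‖l‖ * N₀ / Q₀ ^ 2 = ‖l‖⁻¹ := by rw [hQN]; field_simp
    rw [e] at h
    refine h.congr fun i => ?_
    simp only [hc, norm_div, Complex.norm_conj, norm_pow, Complex.norm_real, Pi.div_apply,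
      Real.norm_of_nonneg (massSq_nonneg (b i))]
  have hQpos : ∀ᶠ i in f, Q₀ / 2 < massSq (b i) := hQ.eventually_const_lt (by linarith)
  -- Column m = 0 of the defect is (1 - c b_0) b_k.
  have hslice0 : ∀ i, ‖1 - c i * b i 0‖ ^ 2 * massSq (b i) ≤ δ i := by
    intro i
    have h := tsum_slice_le (hdef i).summable (fun _ => sq_nonneg _) 0
    rw [(hdef i).tsum_eq] at h
    refine le_trans (le_of_eq ?_) h
    conv_lhs => rw [massSq, ← tsum_mul_left]
    congr 1
    funext k
    rw [← mul_pow, ← norm_mul, add_zero]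
    congr 2
    ring
  have hcb0 : Tendsto (fun i => c i * b i 0) f (𝓝 1) := by
    have h1 : Tendsto (fun i => 1 - c i * b i 0) f (𝓝 0) := by
      refine tendsto_zero_of_sq_le (g := fun i => δ i / (Q₀ / 2)) ?_ ?_
      · filter_upwards [hQpos] with i hi
        rw [le_div_iff₀ (by positivity)]
        refine le_trans ?_ (hslice0 i)
        gcongr
      · simpa using hδ.div_const (Q₀ / 2)
    simpa using h1.const_sub 1
  have hb0 : Tendsto (fun i => ‖b i 0‖) f (𝓝 ‖l‖) := by
    have h := hcb0.norm.div hcn (by positivity)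
    rw [norm_one, one_div, inv_inv] at h
    refine h.congr' ?_
    filter_upwards [hcn.eventually_const_lt (show (0 : ℝ) < ‖l‖⁻¹ by positivity)] with i hi
    rw [Pi.div_apply, norm_mul, mul_comm, mul_div_assoc, div_self hi.ne', mul_one]
  -- Column m = 1 of the defect is b_{k+1} - q b_k, so q is the approximate ratio.
  set q : ι → ℂ := fun i => c i * b i 1 with hq
  have hslice1s : ∀ i, Summable fun k => ‖b i (k + 1) - q i * b i k‖ ^ 2 := by
    intro i
    refine (summable_slice (hdef i).summable 1).congr fun k => ?_
    simp only [hq, hc]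
    congr 2
    ring
  have hslice1 : ∀ i, ∑' k, ‖b i (k + 1) - q i * b i k‖ ^ 2 ≤ δ i := by
    intro i
    have h := tsum_slice_le (hdef i).summable (fun _ => sq_nonneg _) 1
    rw [(hdef i).tsum_eq] at h
    refine le_trans (le_of_eq ?_) h
    congr 1
    funext k
    simp only [hq, hc]
    congr 2
    ring
  set X : ι → ℝ := fun i => √(∑' k, ‖b i (k + 1)‖ ^ 2) with hX
  set Y : ι → ℝ := fun i => ‖q i‖ * √(massSq (b i)) with hY
  -- The modulus of q is found by comparing the mass of the shifted sequence, Q - |b_0|² → Q₀ - |l|²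
  -- = |p|² Q₀, with |q|² Q.
  have hXlim : Tendsto X f (𝓝 (‖p‖ * √Q₀)) := by
    have h := (hQ.sub (hb0.pow 2)).sqrt
    have e : √(Q₀ - ‖l‖ ^ 2) = ‖p‖ * √Q₀ := by
      have : Q₀ - ‖l‖ ^ 2 = ‖p‖ ^ 2 * Q₀ := by rw [eQ]; field_simp; ring
      rw [this, Real.sqrt_mul (sq_nonneg _), Real.sqrt_sq (norm_nonneg _)]
    rw [e] at h
    refine h.congr fun i => ?_
    rw [massSq_eq_zero_add (hb i).summable, add_sub_cancel_left]
  have hYs : ∀ i, Summable fun k => ‖q i * b i k‖ ^ 2 := fun i => by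
    simp only [norm_mul, mul_pow]
    exact (hb i).summable.mul_left _
  have hYeq : ∀ i, √(∑' k, ‖q i * b i k‖ ^ 2) = Y i := fun i => by
    simp only [norm_mul, mul_pow, tsum_mul_left]
    rw [Real.sqrt_mul (sq_nonneg _), Real.sqrt_sq (norm_nonneg _)]
    rfl
  have hXY : ∀ i, |X i - Y i| ≤ √(δ i) := by
    intro i
    have h1 := sqrt_tsum_norm_sq_add_le (hslice1s i) (hYs i)
    have h2 := sqrt_tsum_norm_sq_add_le (f := fun k => -(b i (k + 1) - q i * b i k))
      (by simpa only [norm_neg] using hslice1s i) (summable_shift (hb i).summable)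
    simp only [neg_sub, sub_add_cancel] at h1 h2
    simp only [fun k => norm_sub_rev (q i * b i k) (b i (k + 1))] at h2
    rw [hYeq] at h1 h2
    have h3 := Real.sqrt_le_sqrt (hslice1 i)
    rw [abs_le]
    constructor <;> linarith
  have hYlim : Tendsto Y f (𝓝 (‖p‖ * √Q₀)) := by
    have h0 : Tendsto (fun i => X i - Y i) f (𝓝 0) := by
      refine squeeze_zero_norm hXY ?_
      simpa using hδ.sqrt
    simpa using hXlim.sub h0
  have hqn : Tendsto (fun i => ‖q i‖) f (𝓝 ‖p‖) := by
    have h := hYlim.div hQ.sqrt (by positivity)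
    rw [mul_div_assoc, div_self (by positivity), mul_one] at h
    refine h.congr' ?_
    filter_upwards [hQpos] with i hi
    have : 0 < massSq (b i) := lt_trans (by positivity) hi
    simp only [hY, Pi.div_apply]
    rw [mul_div_assoc, div_self (by positivity), mul_one]
  -- Only the moduli of b_0 and q converge; their arguments are free, which is the freedom of the
  -- orbit.
  choose l' hl'n hl'd using fun i => exists_norm_eq_norm_sub_eq (b i 0) (norm_nonneg l)
  choose p' hp'n hp'd using fun i => exists_norm_eq_norm_sub_eq (q i) (norm_nonneg p)
  have hbl : Tendsto (fun i => ‖b i 0 - l' i‖) f (𝓝 0) := by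
    simp only [hl'd]
    simpa using (hb0.sub_const ‖l‖).abs
  have hqp : Tendsto (fun i => ‖q i - p' i‖) f (𝓝 0) := by
    simp only [hp'd]
    simpa using (hqn.sub_const ‖p‖).abs
  have hcl : Tendsto (fun i => ‖c i - (l' i)⁻¹‖) f (𝓝 0) := by
    have h1 : Tendsto (fun i => ‖c i * b i 0 - 1‖) f (𝓝 0) := by
      simpa using (hcb0.sub_const 1).norm
    have h2 := (h1.add (hcn.mul hbl)).mul_const ‖l‖⁻¹
    simp only [mul_zero, add_zero, zero_mul] at h2
    refine squeeze_zero (fun _ => norm_nonneg _) (fun i => ?_) h2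
    have hl'0 : l' i ≠ 0 := by rw [← norm_pos_iff, hl'n]; exact hl0
    have e : c i - (l' i)⁻¹ = ((c i * b i 0 - 1) - c i * (b i 0 - l' i)) * (l' i)⁻¹ := by
      field_simp
      ring
    rw [e, norm_mul, norm_inv, hl'n]
    gcongr
    refine (norm_sub_le _ _).trans_eq ?_
    rw [norm_mul]
  have hp1 : ∀ i, ‖p' i‖ < 1 := fun i => by rw [hp'n]; exact hp
  have hres : Tendsto (fun i => ∑' n, ‖b i (n + 1) - p' i * b i n‖ ^ 2) f (𝓝 0) := by
    have h1 := (hδ.const_mul 2).add (((hqp.pow 2).mul hQ).const_mul 2)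
    simp only [ne_eq, OfNat.ofNat_ne_zero, not_false_eq_true, zero_pow, zero_mul, mul_zero,
      add_zero] at h1
    refine squeeze_zero (fun _ => tsum_nonneg fun _ => sq_nonneg _) (fun i => ?_) h1
    have hs : Summable fun n => 2 * ‖b i (n + 1) - q i * b i n‖ ^ 2 +
        2 * (‖q i - p' i‖ ^ 2 * ‖b i n‖ ^ 2) :=
      ((hslice1s i).mul_left 2).add (((hb i).summable.mul_left _).mul_left 2)
    have hle : ∀ n, ‖b i (n + 1) - p' i * b i n‖ ^ 2 ≤ 2 * ‖b i (n + 1) - q i * b i n‖ ^ 2 +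
        2 * (‖q i - p' i‖ ^ 2 * ‖b i n‖ ^ 2) := by
      intro n
      have := norm_add_sq_le (b i (n + 1) - q i * b i n) ((q i - p' i) * b i n)
      rw [norm_mul, mul_pow] at this
      convert this using 3
      ring
    refine ((Summable.of_nonneg_of_le (fun _ => sq_nonneg _) hle hs).tsum_le_tsum hle hs).trans ?_
    rw [((hslice1s i).mul_left 2).tsum_add (((hb i).summable.mul_left _).mul_left 2),
      tsum_mul_left, tsum_mul_left, tsum_mul_left]
    have := hslice1 i
    change _ ≤ 2 * δ i + 2 * (‖q i - p' i‖ ^ 2 * massSq (b i))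
    unfold massSq
    linarith
  have hmass : Tendsto (fun i => massSq (b i - geom (l' i) (p' i))) f (𝓝 0) := by
    have h1 : Tendsto (fun i => √(massSq (b i - geom (l' i) (p' i)))) f (𝓝 0) := by
      have h2 := (hbl.add hres.sqrt).div_const (1 - ‖p‖)
      simp only [Real.sqrt_zero, add_zero, zero_div] at h2
      refine squeeze_zero (fun _ => Real.sqrt_nonneg _) (fun i => ?_) h2
      rw [le_div_iff₀ (by linarith), mul_comm, ← hp'n i]
      exact sqrt_massSq_sub_geom_le (hb i) (l' i) (hp1 i)
    have h3 := h1.pow 2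
    simpa [Real.sq_sqrt (massSq_nonneg _)] using h3
  refine ⟨l', p', hl'n, hp'n, ?_⟩
  have hup := (hδ.const_mul 2).add ((((hcl.pow 2).const_mul 4).mul (hQ.mul hQ)).add
    (((hmass.mul hQ).const_mul (8 * ‖l‖⁻¹ ^ 2)).add
      ((hmass.const_mul Q₀).const_mul (8 * ‖l‖⁻¹ ^ 2))))
  simp only [ne_eq, OfNat.ofNat_ne_zero, not_false_eq_true, zero_pow, zero_mul, mul_zero,
    add_zero] at hup
  refine squeeze_zero (fun _ => energySq_nonneg _) (fun i => ?_) hup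
  have hl'0 : l' i ≠ 0 := by rw [← norm_pos_iff, hl'n]; exact hl0
  have h := energySq_sub_geom_le (hb i) hl'0 (hp1 i) (c i) (hdef i).summable
  rw [(hdef i).tsum_eq, norm_inv, hl'n] at h
  have e : massSq (geom (l' i) (p' i)) = Q₀ := by
    rw [massSq_geom _ (hp1 i), hl'n, hp'n, eQ]
  rw [e] at h
  exact h

/-! ### Fourier coefficients of functions on the circle -/

theorem repr_eq_coeff (u : L2) (k : ℤ) : fourierBasis.repr u k = coeff u k :=
  fourierBasis_repr u k

/-- The `k`-th Fourier coefficient as a continuous linear functional. -/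
def coeffCLM (k : ℤ) : L2 →L[ℂ] ℂ := innerSL ℂ (fourierLp 2 k)

theorem coeffCLM_apply (k : ℤ) (u : L2) : coeffCLM k u = coeff u k := by
  rw [← repr_eq_coeff, fourierBasis.repr_apply_apply, coe_fourierBasis]
  rfl

theorem coeff_sub (u v : L2) (k : ℤ) : coeff (u - v) k = coeff u k - coeff v k := by
  simp only [← coeffCLM_apply, map_sub]

theorem coeff_add (u v : L2) (k : ℤ) : coeff (u + v) k = coeff u k + coeff v k := by
  simp only [← coeffCLM_apply, map_add]

theorem coeff_smul (c : ℂ) (u : L2) (k : ℤ) : coeff (c • u) k = c * coeff u k := by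
  simp only [← coeffCLM_apply, map_smul, smul_eq_mul]

theorem coeff_fourierLp (k n : ℤ) : coeff (fourierLp 2 n) k = if k = n then 1 else 0 := by
  rw [← coeffCLM_apply]
  exact orthonormal_iff_ite.1 orthonormal_fourier k n

theorem ext_coeff {u v : L2} (h : ∀ k, coeff u k = coeff v k) : u = v := by
  refine fourierBasis.repr.injective (lp.ext (funext fun k => ?_))
  rw [repr_eq_coeff, repr_eq_coeff, h]

theorem coeff_szego (u : L2) (k : ℤ) : coeff (szego u) k = if 0 ≤ k then coeff u k else 0 := by
  rw [← repr_eq_coeff, szego, LinearIsometryEquiv.apply_symm_apply, ← repr_eq_coeff]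

/-- The Fourier coefficients of nonnegative index. -/
def posCoeff (u : L2) (n : ℕ) : ℂ := coeff u n

theorem posCoeff_sub (u v : L2) : posCoeff (u - v) = posCoeff u - posCoeff v :=
  funext fun _ => coeff_sub u v _

theorem exists_coeff_eq {a : ℕ → ℂ} (ha : Summable fun n => ‖a n‖ ^ 2) :
    ∃ u : L2, posCoeff u = a ∧ ∀ k < 0, coeff u k = 0 := by
  have hmem : Memℓp (fun k : ℤ => if 0 ≤ k then a k.toNat else 0) 2 := by
    refine memℓp_gen ?_
    have hinj : Function.Injective (Nat.cast : ℕ → ℤ) := Nat.cast_injective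
    rw [← hinj.summable_iff]
    · refine ha.congr fun n => ?_
      simp
    · intro k hk
      have : ¬ 0 ≤ k := fun h => hk ⟨k.toNat, Int.toNat_of_nonneg h⟩
      simp [this]
  refine ⟨fourierBasis.repr.symm ⟨_, hmem⟩, funext fun n => ?_, fun k hk => ?_⟩
  · rw [posCoeff, ← repr_eq_coeff, LinearIsometryEquiv.apply_symm_apply]
    simp
  · rw [← repr_eq_coeff, LinearIsometryEquiv.apply_symm_apply]
    simp [not_le.2 hk]

theorem hasSum_nat_iff_int {E : Type*} [AddCommMonoid E] [TopologicalSpace E] {f : ℤ → E}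
    (hf : ∀ k < 0, f k = 0) {x : E} : HasSum (fun n : ℕ => f n) x ↔ HasSum f x := by
  have hinj : Function.Injective (Nat.cast : ℕ → ℤ) := Nat.cast_injective
  refine hinj.hasSum_iff fun k hk => hf k (not_le.1 fun h => hk ⟨k.toNat, Int.toNat_of_nonneg h⟩)

theorem mem_hHalfPlus_iff {u : L2} :
    u ∈ HHalfPlus ↔ (∀ k < 0, coeff u k = 0) ∧ FinEnergy (posCoeff u) := by
  refine and_congr_right fun h => ?_
  have hf : ∀ k : ℤ, k < 0 → (1 + |(k : ℝ)|) * ‖coeff u k‖ ^ 2 = 0 := fun k hk => by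
    rw [h k hk]; simp
  have e : (fun n : ℕ => (1 + |((n : ℤ) : ℝ)|) * ‖coeff u n‖ ^ 2) =
      fun n : ℕ => ((n : ℝ) + 1) * ‖posCoeff u n‖ ^ 2 := by
    funext n
    simp [posCoeff, add_comm]
  unfold FinEnergy Summable
  rw [← e]
  exact exists_congr fun x => (hasSum_nat_iff_int hf).symm

theorem hHalfNorm_eq {u : L2} (h : ∀ k < 0, coeff u k = 0) :
    hHalfNorm u = √(energySq (posCoeff u)) := by
  unfold hHalfNorm energySq
  have hinj : Function.Injective (Nat.cast : ℕ → ℤ) := Nat.cast_injective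
  rw [← hinj.tsum_eq]
  · congr 2
    funext n
    simp [posCoeff, add_comm]
  · intro k hk
    by_contra hne
    have : k < 0 := not_le.1 fun h => hne ⟨k.toNat, Int.toNat_of_nonneg h⟩
    exact hk (by simp [h k this])

theorem sub_mem_neg {u v : L2} (hu : ∀ k < 0, coeff u k = 0) (hv : ∀ k < 0, coeff v k = 0) :
    ∀ k < 0, coeff (u - v) k = 0 := fun k hk => by rw [coeff_sub, hu k hk, hv k hk, sub_zero]

theorem hHalfNorm_sub_eq {u v : L2} (hu : ∀ k < 0, coeff u k = 0) (hv : ∀ k < 0, coeff v k = 0) :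
    hHalfNorm (u - v) = √(energySq (posCoeff u - posCoeff v)) := by
  rw [hHalfNorm_eq (sub_mem_neg hu hv), posCoeff_sub]

theorem hasSum_inner_coeff (u v : L2) :
    HasSum (fun k => conj (coeff u k) * coeff v k)
      (∫ x, v x * conj (u x) ∂torusMeasure) := by
  have h := lp.hasSum_inner (𝕜 := ℂ) (fourierBasis.repr u) (fourierBasis.repr v)
  rw [fourierBasis.repr.inner_map_map, L2.inner_def] at h
  simp only [RCLike.inner_apply, repr_eq_coeff, mul_comm (coeff v _)] at h
  exact h

/-- The Fourier coefficients of a product of two functions in `L²`. -/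
theorem hasSum_coeff_mul (u v : L2) {H : Torus → ℂ}
    (hH : H =ᵐ[torusMeasure] fun x => u x * v x) (n : ℤ) :
    HasSum (fun k => coeff u (n - k) * coeff v k) (fourierCoeff H n) := by
  have hmeas : AEStronglyMeasurable (fun x : Torus => conj (fourier (-n) x * u x)) torusMeasure :=
    Complex.continuous_conj.comp_aestronglyMeasurable
      -- Parseval is applied to v and the conjugate of e^{-inx} u, whose conjugated k-th coefficient
      -- is û(n-k).
      ((map_continuous (fourier (-n))).aestronglyMeasurable.mul (Lp.aestronglyMeasurable u))
  have hmem : MemLp (fun x : Torus => conj (fourier (-n) x * u x)) 2 torusMeasure :=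
    (Lp.memLp u).of_le hmeas (ae_of_all _ fun x => by
      rw [Complex.norm_conj, norm_mul, fourier_apply, Circle.norm_coe, one_mul])
  have h := hasSum_inner_coeff (hmem.toLp _) v
  have e1 : ∫ x, v x * conj (hmem.toLp _ x) ∂torusMeasure = fourierCoeff H n := by
    refine integral_congr_ae ?_
    filter_upwards [hmem.coeFn_toLp, hH] with x hx hHx
    rw [hx, hHx, Complex.conj_conj, smul_eq_mul]
    ring
  have e2 : ∀ k, conj (coeff (hmem.toLp _) k) = coeff u (n - k) := by
    intro k
    unfold coeff fourierCoeff
    rw [← integral_conj]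
    refine integral_congr_ae ?_
    filter_upwards [hmem.coeFn_toLp] with x hx
    rw [hx, smul_eq_mul, smul_eq_mul, map_mul, Complex.conj_conj, ← fourier_neg, neg_neg,
      ← mul_assoc, ← fourier_add]
    congr 3
    ring
  simp only [e2] at h
  rwa [e1] at h

theorem exists_conj (u : L2) : ∃ v : L2, (v =ᵐ[torusMeasure] fun x => conj (u x)) ∧
    ∀ k, coeff v k = conj (coeff u (-k)) := by
  have hmem : MemLp (fun x : Torus => conj (u x)) 2 torusMeasure :=
    (Lp.memLp u).of_le (Complex.continuous_conj.comp_aestronglyMeasurable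
      (Lp.aestronglyMeasurable u)) (ae_of_all _ fun x => by rw [Complex.norm_conj])
  refine ⟨hmem.toLp _, hmem.coeFn_toLp, fun k => ?_⟩
  unfold coeff fourierCoeff
  rw [← integral_conj]
  refine integral_congr_ae ?_
  filter_upwards [hmem.coeFn_toLp] with x hx
  rw [hx, smul_eq_mul, smul_eq_mul, map_mul, ← fourier_neg, neg_neg]

theorem fourierCoeff_sq {u : L2} (hu : ∀ k < 0, coeff u k = 0) {H : Torus → ℂ}
    (hH : H =ᵐ[torusMeasure] fun x => u x ^ 2) :
    (∀ k < 0, fourierCoeff H k = 0) ∧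
      ∀ n : ℕ, fourierCoeff H n = conv (posCoeff u) (posCoeff u) n := by
  have h := hasSum_coeff_mul u u (H := H) (hH.trans (ae_of_all _ fun x => sq (u x)))
  constructor
  · intro k hk
    refine (h k).unique ?_
    convert hasSum_zero using 2 with j
    rcases lt_or_ge j 0 with hj | hj
    · rw [hu j hj, mul_zero]
    · rw [hu (k - j) (by omega), zero_mul]
  · intro n
    have h1 := (hasSum_nat_iff_int (fun j hj => by rw [hu j hj, mul_zero])).2 (h n)
    rw [conv, Finset.Nat.sum_antidiagonal_eq_sum_range_succ (fun i j => posCoeff u i * posCoeff u j)]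
    refine h1.unique ?_
    have : ∑ k ∈ Finset.range n.succ, posCoeff u k * posCoeff u (n - k) =
        ∑ k ∈ Finset.range n.succ, coeff u ((n : ℤ) - k) * coeff u k := by
      refine Finset.sum_congr rfl fun k hk => ?_
      have : k ≤ n := Nat.lt_succ_iff.1 (Finset.mem_range.1 hk)
      rw [posCoeff, posCoeff, Nat.cast_sub this, mul_comm]
    rw [this]
    refine hasSum_sum_of_ne_finset_zero fun k hk => ?_
    have : n < k := by simpa [Nat.lt_succ_iff] using hk
    rw [hu _ (by omega), zero_mul]

theorem fourierCoeff_norm_sq {u : L2} (hu : ∀ k < 0, coeff u k = 0) {H : Torus → ℂ}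
    (hH : H =ᵐ[torusMeasure] fun x => ((‖u x‖ ^ 2 : ℝ) : ℂ)) (n : ℕ) :
    fourierCoeff H n = corr (posCoeff u) (posCoeff u) n := by
  obtain ⟨v, hv, hvc⟩ := exists_conj u
  have hH' : H =ᵐ[torusMeasure] fun x => u x * v x := by
    filter_upwards [hH, hv] with x h1 h2
    rw [h1, h2, Complex.mul_conj']
    push_cast
    rfl
  have h := hasSum_coeff_mul u v hH' n
  rw [← (Equiv.neg ℤ).hasSum_iff] at h
  have h1 : HasSum (fun k : ℕ => coeff u ((n : ℤ) - -(k : ℤ)) * coeff v (-(k : ℤ)))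
      (fourierCoeff H n) :=
    (hasSum_nat_iff_int (f := fun k : ℤ => coeff u ((n : ℤ) - -k) * coeff v (-k)) fun j hj => by
      rw [hvc, neg_neg, hu j hj, map_zero, mul_zero]).2 h
  rw [corr, ← h1.tsum_eq]
  congr 1
  funext k
  rw [hvc, neg_neg, posCoeff, posCoeff]
  push_cast
  rw [sub_neg_eq_add]

/-- J(u) is the inner product of u² with u, so Parseval applies once u² is known to be in L². -/
theorem J_eq_cubic {u G : L2} (hu : u ∈ HHalfPlus)
    (hG : G =ᵐ[torusMeasure] fun x => u x ^ 2) : J u = cubic (posCoeff u) := by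
  obtain ⟨hneg, hfin⟩ := mem_hHalfPlus_iff.1 hu
  have h := hasSum_inner_coeff u G
  have e : ∫ x, G x * conj (u x) ∂torusMeasure = J u := by
    refine integral_congr_ae ?_
    filter_upwards [hG] with x hx
    rw [hx]
    push_cast
    rw [← Complex.mul_conj']
    ring
  rw [e] at h
  have h1 := (hasSum_nat_iff_int (fun j hj => by rw [hneg j hj, map_zero, zero_mul])).2 h
  have h2 := hasSum_conj_mul_conv (triTerm_low hfin.summable hfin.summable hfin).1
    (w := fun _ => 1) (B := 1) (by simp)
  simp only [one_mul] at h2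
  have e2 : (fun n : ℕ => conj (coeff u n) * coeff G n) =
      fun n => conj (posCoeff u n) * conv (posCoeff u) (posCoeff u) n := funext fun n => by
    rw [show coeff G n = _ from (fourierCoeff_sq hneg hG).2 n, posCoeff]
  rw [e2] at h1
  exact h1.unique h2

/-- The coefficients of a solution solve the coefficient equation. -/
theorem IsSolution.coeffSolution {u₀ : L2} {u : ℝ → L2} (h : IsSolution u₀ u) :
    CoeffSolution fun t => posCoeff (u t) := by
  have hm := fun t => mem_hHalfPlus_iff.1 (h.mem t)
  refine ⟨fun t => (hm t).2, fun T => ?_, fun t n => ?_⟩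
  -- Continuity in H^{1/2} bounds the energy near each time; compactness makes the bound uniform on
  -- the interval.
  · refine (isCompact_Icc (a := -T) (b := T)).induction_on
      (p := fun s => ∃ C, ∀ t ∈ s, energySq (posCoeff (u t)) ≤ C) ⟨0, by simp⟩ ?_ ?_ ?_
    · rintro s t hst ⟨C, hC⟩
      exact ⟨C, fun r hr => hC r (hst hr)⟩
    · rintro s t ⟨C, hC⟩ ⟨D, hD⟩
      refine ⟨max C D, fun r hr => ?_⟩
      rcases hr with hr | hr
      · exact (hC r hr).trans (le_max_left _ _)
      · exact (hD r hr).trans (le_max_right _ _)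
    · intro t _
      refine ⟨{s | hHalfNorm (u s - u t) < 1}, mem_nhdsWithin_of_mem_nhds
        ((h.cont t).eventually_lt_const one_pos), 2 * 1 + 2 * energySq (posCoeff (u t)),
        fun s hs => ?_⟩
      rw [Set.mem_ofPred_eq, hHalfNorm_sub_eq (hm s).1 (hm t).1, Real.sqrt_lt' one_pos,
        one_pow] at hs
      have h1 := energySq_add_le ((hm s).2.sub (hm t).2) (hm t).2
      rw [sub_add_cancel] at h1
      linarith
  · obtain ⟨F, G, u', hF, hG, hd, heq⟩ := h.eqn t
    have h1 : HasDerivAt (fun s => posCoeff (u s) n) (coeff u' n) t := by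
      have := ((coeffCLM n).restrictScalars ℝ).hasFDerivAt.comp_hasDerivAt t hd
      simp only [ContinuousLinearMap.coe_restrictScalars', Function.comp_def,
        coeffCLM_apply] at this
      exact this
    refine h1.congr_deriv ?_
    have h2 := congrArg (fun v => coeff v n) heq
    simp only [coeff_smul, coeff_add, coeff_szego, J_eq_cubic (h.mem t) hG] at h2
    rw [if_pos (Int.natCast_nonneg n)] at h2
    have h3 : coeff F n = _ := fourierCoeff_norm_sq (hm t).1 hF n
    have h4 : coeff G n = _ := (fourierCoeff_sq (hm t).1 hG).2 n
    rw [h3, h4] at h2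
    rw [field, ← h2, ← mul_assoc, neg_mul, Complex.I_mul_I]
    simp

/-! ### The square of a function in `H^{1/2}` -/

theorem norm_sq_eq_massSq {u : L2} (hu : ∀ k < 0, coeff u k = 0) :
    ‖u‖ ^ 2 = massSq (posCoeff u) := by
  have h2 := hasSum_inner_coeff u u
  have h3 := (hasSum_nat_iff_int (f := fun k => conj (coeff u k) * coeff u k)
    fun j hj => by rw [hu j hj]; simp).2 h2
  have e : ∫ x, u x * conj (u x) ∂torusMeasure = ((‖u‖ ^ 2 : ℝ) : ℂ) := by
    have := L2.inner_def (𝕜 := ℂ) u u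
    rw [inner_self_eq_norm_sq_to_K] at this
    simp only [RCLike.inner_apply] at this
    rw [← this]
    simp
  rw [e] at h3
  have h4 : HasSum (fun n : ℕ => ((‖coeff u n‖ ^ 2 : ℝ) : ℂ)) ((‖u‖ ^ 2 : ℝ) : ℂ) := by
    convert h3 using 2 with n
    rw [Complex.conj_mul']
    push_cast
    rfl
  exact (Complex.hasSum_ofReal.1 h4).tsum_eq.symm

theorem coeff_sum {ι : Type*} (s : Finset ι) (f : ι → L2) (k : ℤ) :
    coeff (∑ i ∈ s, f i) k = ∑ i ∈ s, coeff (f i) k := by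
  simp only [← coeffCLM_apply, map_sum]

/-- Functions in `H^{1/2}_+` are in `L⁴`. -/
theorem memLp_sq {u : L2} (hu : u ∈ HHalfPlus) :
    MemLp (fun x => u x ^ 2) 2 torusMeasure := by
  obtain ⟨hneg, hfin⟩ := mem_hHalfPlus_iff.1 hu
  set a := posCoeff u with ha
  let v : ℕ → C(Torus, ℂ) := fun K => ∑ n ∈ Finset.range K, a n • fourier (n : ℤ)
  let V : ℕ → L2 := fun K => ContinuousMap.toLp 2 torusMeasure ℂ (v K)
  have hVsum : ∀ K, V K = ∑ n ∈ Finset.range K, a n • fourierLp 2 (n : ℤ) := fun K => by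
    simp only [V, v, map_sum, map_smul]
  have hVneg : ∀ K, ∀ k < 0, coeff (V K) k = 0 := by
    intro K k hk
    rw [hVsum, coeff_sum]
    refine Finset.sum_eq_zero fun n _ => ?_
    rw [coeff_smul, coeff_fourierLp, if_neg (by omega), mul_zero]
  have hVpos : ∀ K, posCoeff (V K) = fun n => if n < K then a n else 0 := by
    intro K
    funext n
    rw [posCoeff, hVsum, coeff_sum]
    simp only [coeff_smul, coeff_fourierLp, Nat.cast_inj, mul_ite, mul_one, mul_zero,
      Finset.sum_ite_eq, Finset.mem_range]
  have hVlim : Tendsto V atTop (𝓝 u) := by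
    have h1 : HasSum (fun n : ℕ => a n • (fourierLp 2 (n : ℤ) : L2)) u :=
      (hasSum_nat_iff_int (f := fun k : ℤ => coeff u k • (fourierLp 2 k : L2))
        fun j hj => by rw [hneg j hj, zero_smul]).2 (hasSum_fourier_series_L2 u)
    have h2 := h1.tendsto_sum_nat
    simpa only [← hVsum] using h2
  have hVfin : ∀ K, FinEnergy (posCoeff (V K)) ∧ energySq (posCoeff (V K)) ≤ energySq a := by
    intro K
    have hle : ∀ n : ℕ, ((n : ℝ) + 1) * ‖posCoeff (V K) n‖ ^ 2 ≤ ((n : ℝ) + 1) * ‖a n‖ ^ 2 := by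
      intro n
      rw [hVpos]
      dsimp only
      split_ifs
      · exact le_rfl
      · simpa using by positivity
    have hs : FinEnergy (posCoeff (V K)) := Summable.of_nonneg_of_le (fun _ => by positivity) hle hfin
    exact ⟨hs, hs.tsum_le_tsum hle hfin⟩
  let W : ℕ → L2 := fun K => ContinuousMap.toLp 2 torusMeasure ℂ (v K ^ 2)
  have hWV : ∀ K, W K =ᵐ[torusMeasure] fun x => V K x ^ 2 := by
    intro K
    filter_upwards [ContinuousMap.coeFn_toLp (p := 2) (𝕜 := ℂ) torusMeasure (v K ^ 2),
      ContinuousMap.coeFn_toLp (p := 2) (𝕜 := ℂ) torusMeasure (v K)] with x h1 h2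
    rw [h1, h2]
    rfl
  -- The squares of the partial Fourier sums are bounded in L² by the convolution estimate; Fatou
  -- along an almost everywhere convergent subsequence then gives u².
  have hWnorm : ∀ K, ‖W K‖ ≤ energySq a := by
    intro K
    have hc := fourierCoeff_sq (hVneg K) (hWV K)
    have h1 : ‖W K‖ ^ 2 = massSq (posCoeff (W K)) := norm_sq_eq_massSq hc.1
    have h2 : posCoeff (W K) = conv (posCoeff (V K)) (posCoeff (V K)) := funext hc.2
    have h3 := (norm_sq_conv_le (hVfin K).1 (hVfin K).1).2
    have h4 := (hVfin K).2
    have h5 := energySq_nonneg (posCoeff (V K))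
    refine abs_le_of_sq_le_sq' ?_ (energySq_nonneg a) |>.2
    rw [h1, h2]
    nlinarith
  obtain ⟨ns, -, hns⟩ := (tendstoInMeasure_of_tendsto_Lp hVlim).exists_seq_tendsto_ae
  have hmeas : AEStronglyMeasurable (fun x => u x ^ 2) torusMeasure :=
    (Lp.aestronglyMeasurable u).pow 2
  have hae : ∀ᵐ x ∂torusMeasure, Tendsto (fun i => W (ns i) x) atTop (𝓝 (u x ^ 2)) := by
    filter_upwards [hns, ae_all_iff.2 fun i => hWV (ns i)] with x h1 h2
    simp only [h2]
    exact h1.pow 2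
  refine ⟨hmeas, lt_of_le_of_lt (Lp.eLpNorm_le_of_ae_tendsto (Eventually.of_forall fun i => ?_)
    (fun i => Lp.aestronglyMeasurable (W (ns i))) hae) (ENNReal.ofReal_lt_top (r := energySq a))⟩
  rw [← Lp.enorm_def, ← ofReal_norm]
  exact ENNReal.ofReal_le_ofReal (hWnorm _)

/-! ### Existence of solutions -/

theorem massSq_smul (c : ℂ) (a : ℕ → ℂ) : massSq (c • a) = ‖c‖ ^ 2 * massSq a := by
  simp only [massSq, Pi.smul_apply, smul_eq_mul, norm_mul, mul_pow, tsum_mul_left]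

theorem massSq_add_le {a b : ℕ → ℂ} (ha : Summable fun n => ‖a n‖ ^ 2)
    (hb : Summable fun n => ‖b n‖ ^ 2) :
    Summable (fun n => ‖(a + b) n‖ ^ 2) ∧ massSq (a + b) ≤ 2 * massSq a + 2 * massSq b := by
  have hle : ∀ n, ‖(a + b) n‖ ^ 2 ≤ 2 * ‖a n‖ ^ 2 + 2 * ‖b n‖ ^ 2 := fun n => norm_add_sq_le _ _
  have hs := (ha.mul_left 2).add (hb.mul_left 2)
  have h := Summable.of_nonneg_of_le (fun _ => sq_nonneg _) hle hs
  refine ⟨h, (h.tsum_le_tsum hle hs).trans_eq ?_⟩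
  rw [(ha.mul_left 2).tsum_add (hb.mul_left 2), tsum_mul_left, tsum_mul_left]
  rfl

theorem summable_smul {a : ℕ → ℂ} (ha : Summable fun n => ‖a n‖ ^ 2) (c : ℂ) :
    Summable fun n => ‖(c • a) n‖ ^ 2 := by
  simp only [Pi.smul_apply, smul_eq_mul, norm_mul, mul_pow]
  exact ha.mul_left _

theorem norm_sub_sq_le_energySq_sub {a b : ℕ → ℂ} (ha : FinEnergy a) (hb : FinEnergy b) (n : ℕ) :
    ‖a n - b n‖ ^ 2 ≤ energySq (a - b) := (ha.sub hb).norm_apply_sq_le n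

/-! ### Continuity of the norms and of the vector field under H^{1/2} convergence. -/

section StrongLimits

variable {ι : Type*} {l : Filter ι} {A : ι → ℕ → ℂ} {a : ℕ → ℂ}

theorem tendsto_apply_of_energySq (hA : ∀ i, FinEnergy (A i)) (ha : FinEnergy a)
    (h : Tendsto (fun i => energySq (A i - a)) l (𝓝 0)) (n : ℕ) :
    Tendsto (fun i => A i n) l (𝓝 (a n)) := by
  rw [← tendsto_sub_nhds_zero_iff]
  exact tendsto_zero_of_sq_le
    (Eventually.of_forall fun i => norm_sub_sq_le_energySq_sub (hA i) ha n) h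

theorem eventually_energySq_le (hA : ∀ i, FinEnergy (A i)) (ha : FinEnergy a)
    (h : Tendsto (fun i => energySq (A i - a)) l (𝓝 0)) :
    ∀ᶠ i in l, FinEnergy (A i) ∧ energySq (A i) ≤ 2 + 2 * energySq a := by
  filter_upwards [h.eventually_lt_const one_pos] with i hi
  refine ⟨hA i, ?_⟩
  have h1 := energySq_add_le ((hA i).sub ha) ha
  rw [sub_add_cancel] at h1
  linarith

/-- Supplies the continuity in L² of the time derivative of a constructed solution, required by
`hasDerivAt_of_coeff`. -/
theorem tendsto_massSq_field_sub [l.NeBot] (hA : ∀ i, FinEnergy (A i)) (ha : FinEnergy a)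
    (h : Tendsto (fun i => energySq (A i - a)) l (𝓝 0)) :
    Tendsto (fun i => massSq (field (A i) - field a)) l (𝓝 0) := by
  have hb := eventually_energySq_le hA ha h
  set E := 2 + 2 * energySq a
  have ha0 := energySq_nonneg a
  have haE : energySq a ≤ E := by simp only [E]; linarith
  have hJ := tendsto_cubic (tendsto_apply_of_energySq hA ha h) hb
  have hJ0 : Tendsto (fun i => ‖cubic (A i) - cubic a‖ ^ 2) l (𝓝 0) := by
    simpa using ((hJ.sub_const (cubic a)).norm).pow 2
  have hcorr : Tendsto (fun i => massSq (corr (A i) (A i) - corr a a)) l (𝓝 0) := by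
    have h0 : Tendsto (fun i => 2 * (energySq (A i - a) * E) + 2 * (E * energySq (A i - a))) l
        (𝓝 0) := by
      simpa using ((h.mul_const E).const_mul 2).add ((h.const_mul E).const_mul 2)
    refine squeeze_zero' (Eventually.of_forall fun i => massSq_nonneg _) ?_ h0
    filter_upwards [hb] with i hi
    have hd := (hA i).sub ha
    have e : corr (A i) (A i) - corr a a = corr (A i - a) (A i) + corr a (A i - a) :=
      funext fun n => corr_sub_corr (hA i).summable ha.summable n
    have h1 := norm_sq_corr_le hd (hA i).summable
    have h2 := norm_sq_corr_le ha hd.summable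
    rw [e]
    refine (massSq_add_le h1.1 h2.1).2.trans ?_
    have h3 : energySq (A i - a) * massSq (A i) ≤ energySq (A i - a) * E :=
      mul_le_mul_of_nonneg_left ((hA i).massSq_le.trans hi.2) (energySq_nonneg _)
    have h4 : energySq a * massSq (A i - a) ≤ E * energySq (A i - a) :=
      mul_le_mul haE hd.massSq_le (massSq_nonneg _) (ha0.trans haE)
    linarith [h1.2, h2.2]
  have hconv : Tendsto (fun i => massSq (conv (A i) (A i) - conv a a)) l (𝓝 0) := by
    have h0 : Tendsto (fun i => 2 * (energySq (A i - a) * E) + 2 * (E * energySq (A i - a))) l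
        (𝓝 0) := by
      simpa using ((h.mul_const E).const_mul 2).add ((h.const_mul E).const_mul 2)
    refine squeeze_zero' (Eventually.of_forall fun i => massSq_nonneg _) ?_ h0
    filter_upwards [hb] with i hi
    have hd := (hA i).sub ha
    have e : conv (A i) (A i) - conv a a = conv (A i - a) (A i) + conv a (A i - a) :=
      funext fun n => conv_sub_conv (A i) a n
    have h1 := norm_sq_conv_le hd (hA i)
    have h2 := norm_sq_conv_le ha hd
    rw [e]
    refine (massSq_add_le h1.1 h2.1).2.trans ?_
    have h3 : energySq (A i - a) * energySq (A i) ≤ energySq (A i - a) * E :=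
      mul_le_mul_of_nonneg_left hi.2 (energySq_nonneg _)
    have h4 : energySq a * energySq (A i - a) ≤ E * energySq (A i - a) :=
      mul_le_mul_of_nonneg_right haE (energySq_nonneg _)
    linarith [h1.2, h2.2]
  have h0 : Tendsto (fun i =>
      2 * (2 * (4 * ‖cubic (A i) - cubic a‖ ^ 2 * (E * E)) +
        2 * (4 * ‖cubic a‖ ^ 2 * massSq (corr (A i) (A i) - corr a a))) +
      2 * (2 * (‖cubic (A i) - cubic a‖ ^ 2 * (E * E)) +
        2 * (‖cubic a‖ ^ 2 * massSq (conv (A i) (A i) - conv a a)))) l (𝓝 0) := by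
    have := ((((((hJ0.const_mul 4).mul_const (E * E)).const_mul 2).add
      ((hcorr.const_mul (4 * ‖cubic a‖ ^ 2)).const_mul 2)).const_mul 2).add
      ((((hJ0.mul_const (E * E)).const_mul 2).add
        ((hconv.const_mul (‖cubic a‖ ^ 2)).const_mul 2)).const_mul 2))
    simpa using this
  refine squeeze_zero' (Eventually.of_forall fun i => massSq_nonneg _) ?_ h0
  filter_upwards [hb] with i hi
  have sA := norm_sq_corr_le (hA i) (hA i).summable
  have sa := norm_sq_corr_le ha ha.summable
  have rA := norm_sq_conv_le (hA i) (hA i)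
  have ra := norm_sq_conv_le ha ha
  have sd := summable_sq_sub sA.1 sa.1
  have rd := summable_sq_sub rA.1 ra.1
  set dJ := cubic (A i) - cubic a with hdJ
  have e : field (A i) - field a =
      ((-Complex.I * 2 * dJ) • corr (A i) (A i) +
        (-Complex.I * 2 * cubic a) • (corr (A i) (A i) - corr a a)) +
      ((-Complex.I * conj dJ) • conv (A i) (A i) +
        (-Complex.I * conj (cubic a)) • (conv (A i) (A i) - conv a a)) := by
    funext n
    simp only [field, hdJ, Pi.add_apply, Pi.sub_apply, Pi.smul_apply, smul_eq_mul, map_sub]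
    ring
  have m1 := massSq_add_le (summable_smul sA.1 (-Complex.I * 2 * dJ))
    (summable_smul sd (-Complex.I * 2 * cubic a))
  have m2 := massSq_add_le (summable_smul rA.1 (-Complex.I * conj dJ))
    (summable_smul rd (-Complex.I * conj (cubic a)))
  have m3 := massSq_add_le m1.1 m2.1
  have n1 : ‖-Complex.I * 2 * dJ‖ ^ 2 = 4 * ‖dJ‖ ^ 2 := by
    rw [norm_mul, norm_mul, norm_neg, Complex.norm_I, Complex.norm_ofNat]; ring
  have n2 : ‖-Complex.I * 2 * cubic a‖ ^ 2 = 4 * ‖cubic a‖ ^ 2 := by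
    rw [norm_mul, norm_mul, norm_neg, Complex.norm_I, Complex.norm_ofNat]; ring
  have n3 : ‖-Complex.I * conj dJ‖ ^ 2 = ‖dJ‖ ^ 2 := by
    rw [norm_mul, norm_neg, Complex.norm_I, Complex.norm_conj]; ring
  have n4 : ‖-Complex.I * conj (cubic a)‖ ^ 2 = ‖cubic a‖ ^ 2 := by
    rw [norm_mul, norm_neg, Complex.norm_I, Complex.norm_conj]; ring
  simp only [massSq_smul, n1, n2, n3, n4] at m1 m2 m3
  have hEA := energySq_nonneg (A i)
  have b1 : 4 * ‖dJ‖ ^ 2 * massSq (corr (A i) (A i)) ≤ 4 * ‖dJ‖ ^ 2 * (E * E) := by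
    gcongr
    exact sA.2.trans (mul_le_mul hi.2 ((hA i).massSq_le.trans hi.2) (massSq_nonneg _)
      (ha0.trans haE))
  have b2 : ‖dJ‖ ^ 2 * massSq (conv (A i) (A i)) ≤ ‖dJ‖ ^ 2 * (E * E) := by
    gcongr
    exact rA.2.trans (mul_le_mul hi.2 hi.2 hEA (ha0.trans haE))
  rw [e]
  linarith [m1.2, m2.2, m3.2]

theorem tendsto_massSq {A : ι → ℕ → ℂ} {a : ℕ → ℂ} (hA : ∀ i, Summable fun n => ‖A i n‖ ^ 2)
    (ha : Summable fun n => ‖a n‖ ^ 2)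
    (h : Tendsto (fun i => massSq (A i - a)) l (𝓝 0)) :
    Tendsto (fun i => massSq (A i)) l (𝓝 (massSq a)) := by
  have h1 : Tendsto (fun i => √(massSq (A i)) - √(massSq a)) l (𝓝 0) := by
    refine squeeze_zero_norm (a := fun i => √(massSq (A i - a))) (fun i => ?_) (by simpa using h.sqrt)
    have hd := summable_sq_sub (hA i) ha
    have h2 := sqrt_tsum_norm_sq_add_le hd ha
    have h3 := sqrt_tsum_norm_sq_add_le (f := fun n => -(A i - a) n)
      (by simpa only [norm_neg] using hd) (hA i)
    simp only [norm_neg] at h3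
    simp only [Pi.sub_apply, neg_sub, sub_add_cancel] at h2 h3
    rw [Real.norm_eq_abs, abs_le]
    unfold massSq
    simp only [Pi.sub_apply]
    constructor <;> linarith
  have h2 := (h1.add_const (√(massSq a))).pow 2
  simpa [Real.sq_sqrt (massSq_nonneg _)] using h2

theorem tendsto_massSq_of_energySq (hA : ∀ i, FinEnergy (A i)) (ha : FinEnergy a)
    (h : Tendsto (fun i => energySq (A i - a)) l (𝓝 0)) :
    Tendsto (fun i => massSq (A i)) l (𝓝 (massSq a)) :=
  tendsto_massSq (fun i => (hA i).summable) ha.summable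
    (squeeze_zero (fun _ => massSq_nonneg _) (fun i => ((hA i).sub ha).massSq_le) h)

theorem energySq_eq_massSq (a : ℕ → ℂ) :
    energySq a = massSq fun n : ℕ => (√((n : ℝ) + 1) : ℂ) * a n := by
  unfold energySq massSq
  congr 1
  funext n
  rw [norm_mul, Complex.norm_real, Real.norm_of_nonneg (Real.sqrt_nonneg _), weighted_sq]

theorem FinEnergy.summable_weighted {a : ℕ → ℂ} (ha : FinEnergy a) :
    Summable fun n : ℕ => ‖(√((n : ℝ) + 1) : ℂ) * a n‖ ^ 2 := by
  simp only [norm_mul, Complex.norm_real, Real.norm_of_nonneg (Real.sqrt_nonneg _), weighted_sq]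
  exact ha

theorem tendsto_energySq_of_energySq (hA : ∀ i, FinEnergy (A i)) (ha : FinEnergy a)
    (h : Tendsto (fun i => energySq (A i - a)) l (𝓝 0)) :
    Tendsto (fun i => energySq (A i)) l (𝓝 (energySq a)) := by
  simp only [energySq_eq_massSq] at h ⊢
  refine tendsto_massSq (fun i => (hA i).summable_weighted) ha.summable_weighted
    (h.congr fun i => ?_)
  congr 1
  funext n
  simp only [Pi.sub_apply]
  ring

end StrongLimits

/-- Continuity of u' allows it to be integrated in L²; the integral has the right coefficients,
hence equals the increment of u, and the fundamental theorem of calculus differentiates it. -/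
theorem hasDerivAt_of_coeff {u u' : ℝ → L2} (hu' : Continuous u')
    (h : ∀ t k, HasDerivAt (fun s => coeff (u s) k) (coeff (u' t) k) t) (t : ℝ) :
    HasDerivAt u (u' t) t := by
  have hint : ∀ s, u s = u 0 + ∫ r in 0..s, u' r := by
    intro s
    refine ext_coeff fun k => ?_
    rw [coeff_add, ← coeffCLM_apply k (∫ r in 0..s, u' r),
      ← ContinuousLinearMap.intervalIntegral_comp_comm _ (hu'.intervalIntegrable 0 s)]
    simp only [coeffCLM_apply]
    rw [intervalIntegral.integral_eq_sub_of_hasDerivAt (fun r _ => h r k)]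
    · ring
    · refine Continuous.intervalIntegrable ?_ _ _
      simp only [← coeffCLM_apply]
      exact (coeffCLM k).continuous.comp hu'
  have h1 := ((hu'.integral_hasStrictDerivAt 0 t).hasDerivAt).const_add (u 0)
  exact h1.congr_of_eventuallyEq (Eventually.of_forall hint)

theorem exists_isSolution {u₀ : L2} (h₀ : u₀ ∈ HHalfPlus) : ∃ u, IsSolution u₀ u := by
  obtain ⟨hneg₀, hfin₀⟩ := mem_hHalfPlus_iff.1 h₀
  obtain ⟨a, ha, ha0⟩ := exists_coeffSolution hfin₀
  choose u hu huneg using fun t => exists_coeff_eq (ha.fin t).summable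
  choose u' hu' hu'neg using fun t => exists_coeff_eq (norm_sq_field_le (ha.fin t)).1
  have hmem : ∀ t, u t ∈ HHalfPlus := fun t =>
    mem_hHalfPlus_iff.2 ⟨huneg t, by rw [hu]; exact ha.fin t⟩
  have hcont : Continuous u' := by
    refine continuous_iff_continuousAt.2 fun t => ?_
    refine tendsto_iff_norm_sub_tendsto_zero.2 ?_
    have h1 := (tendsto_massSq_field_sub ha.fin (ha.fin t) (ha.tendsto_energySq_sub t)).sqrt
    rw [Real.sqrt_zero] at h1
    refine h1.congr fun s => ?_
    rw [← hu' s, ← hu' t, ← posCoeff_sub,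
      ← norm_sq_eq_massSq (sub_mem_neg (hu'neg s) (hu'neg t)), Real.sqrt_sq (norm_nonneg _)]
  refine ⟨u, ⟨?_, hmem, fun t => ?_, fun t => ?_⟩⟩
  · refine ext_coeff fun k => ?_
    rcases lt_or_ge k 0 with hk | hk
    · rw [huneg 0 k hk, hneg₀ k hk]
    · obtain ⟨n, rfl⟩ := Int.eq_ofNat_of_zero_le hk
      have := congrFun (hu 0) n
      rw [ha0] at this
      exact this
  · have h1 := (ha.tendsto_energySq_sub t).sqrt
    rw [Real.sqrt_zero] at h1
    refine h1.congr fun s => ?_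
    rw [hHalfNorm_sub_eq (huneg s) (huneg t), hu, hu]
  · have hG := memLp_sq (hmem t)
    have hF : MemLp (fun x => ((‖u t x‖ ^ 2 : ℝ) : ℂ)) 2 torusMeasure :=
      hG.of_le (Complex.continuous_ofReal.comp_aestronglyMeasurable
        ((Lp.aestronglyMeasurable (u t)).norm.pow 2)) (ae_of_all _ fun x => by simp)
    refine ⟨hF.toLp _, hG.toLp _, u' t, hF.coeFn_toLp, hG.coeFn_toLp,
      hasDerivAt_of_coeff hcont (fun s k => ?_) t, ?_⟩
    · rcases lt_or_ge k 0 with hk | hk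
      · simp only [huneg _ k hk, hu'neg _ k hk]
        exact hasDerivAt_const s (0 : ℂ)
      · obtain ⟨n, rfl⟩ := Int.eq_ofNat_of_zero_le hk
        have h1 := ha.deriv s n
        rw [← congrFun (hu' s) n] at h1
        refine h1.congr_of_eventuallyEq (Eventually.of_forall fun r => ?_)
        exact congrFun (hu r) n
    · refine ext_coeff fun k => ?_
      have hGc := fourierCoeff_sq (huneg t) hG.coeFn_toLp
      simp only [coeff_smul, coeff_add, coeff_szego, J_eq_cubic (hmem t) hG.coeFn_toLp]
      rcases lt_or_ge k 0 with hk | hk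
      · rw [hu'neg t k hk, if_neg (not_le.2 hk), show coeff (hG.toLp _) k = 0 from hGc.1 k hk]
        simp
      · obtain ⟨n, rfl⟩ := Int.eq_ofNat_of_zero_le hk
        have h1 : coeff (hF.toLp _) n = _ := fourierCoeff_norm_sq (huneg t) hF.coeFn_toLp n
        have h2 : coeff (hG.toLp _) n = _ := hGc.2 n
        have h3 : coeff (u' t) n = field (a t) n := congrFun (hu' t) n
        rw [if_pos hk, h1, h2, h3, hu, field, ← mul_assoc, mul_neg, Complex.I_mul_I, neg_neg,
          one_mul]

/-! ### The ground states -/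

theorem coeff_groundState (l p : ℂ) (hp : ‖p‖ < 1) (k : ℤ) :
    coeff (groundState l p hp) k = if 0 ≤ k then l * p ^ k.toNat else 0 := by
  set f : C(Torus, ℂ) := ⟨fun x : Torus => l / (1 - p * fourier 1 x),
      continuous_const.div (by fun_prop) (one_sub_mul_fourier_ne_zero hp)⟩ with hf
  have hfour : ∀ (n : ℕ) (x : Torus), fourier (n : ℤ) x = fourier 1 x ^ n := by
    intro n x
    induction n with
    | zero => simp
    | succ n ih => rw [Nat.cast_succ, fourier_add, ih, pow_succ]
  have hsum : Summable fun n : ℕ => (l * p ^ n) • (fourier (n : ℤ) : C(Torus, ℂ)) := by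
    refine Summable.of_norm ?_
    simp only [norm_smul, fourier_norm, mul_one, norm_mul, norm_pow]
    exact (summable_geometric_of_lt_one (norm_nonneg p) hp).mul_left _
  -- The geometric series converges uniformly on the circle, so coefficients may be read off term by
  -- term.
  have hval : HasSum (fun n : ℕ => (l * p ^ n) • (fourier (n : ℤ) : C(Torus, ℂ))) f := by
    convert hsum.hasSum
    ext x
    have h1 := (ContinuousMap.evalCLM ℂ x).hasSum hsum.hasSum
    have h2 : HasSum (fun n : ℕ => l * (p * fourier 1 x) ^ n) (l * (1 - p * fourier 1 x)⁻¹) := by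
      refine (hasSum_geometric_of_norm_lt_one ?_).mul_left l
      rw [norm_mul, fourier_apply, Circle.norm_coe, mul_one]
      exact hp
    refine (h2.unique ?_ : l * (1 - p * fourier 1 x)⁻¹ = _)
    convert h1 using 2 with n
    · change _ = (l * p ^ n) • fourier (n : ℤ) x
      rw [hfour, mul_pow, smul_eq_mul]
      ring
    · rfl
  have h1 := (ContinuousMap.toLp (E := ℂ) 2 torusMeasure ℂ).hasSum hval
  have h2 := (coeffCLM k).hasSum h1
  simp only [map_smul, coeffCLM_apply, smul_eq_mul] at h2
  have h3 : ∀ n : ℕ, coeff (ContinuousMap.toLp (E := ℂ) 2 torusMeasure ℂ (fourier (n : ℤ))) k =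
      if k = n then 1 else 0 := fun n => coeff_fourierLp k n
  simp only [h3, mul_ite, mul_one, mul_zero] at h2
  refine h2.unique ?_
  split_ifs with hk
  · obtain ⟨m, rfl⟩ := Int.eq_ofNat_of_zero_le hk
    have := hasSum_ite_eq m (l * p ^ m)
    rw [Int.toNat_natCast]
    convert this using 2 with n
    by_cases hn : n = m
    · simp [hn]
    · have : ¬ (m : ℤ) = n := fun h => hn (by exact_mod_cast h.symm)
      simp [hn, this]
  · convert hasSum_zero using 2 with n
    exact if_neg (by omega)

theorem coeff_phaseShift (θ α : ℝ) (v : L2) (k : ℤ) :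
    coeff (phaseShift θ α v) k =
      Complex.exp (-(Complex.I * θ)) * (Complex.exp (-(Complex.I * (k * α))) * coeff v k) := by
  rw [phaseShift, coeff_smul]
  congr 1
  unfold coeff fourierCoeff
  have h1 : ∫ x : Torus, fourier (-k) x • (Lp.compMeasurePreserving
      (fun x : Torus => x - (α : Torus)) (measurePreserving_sub_right torusMeasure (α : Torus)) v) x
      ∂torusMeasure = ∫ x : Torus, fourier (-k) ((x - (α : Torus)) + (α : Torus)) •
        v (x - (α : Torus)) ∂torusMeasure := by
    refine integral_congr_ae ?_
    filter_upwards [Lp.coeFn_compMeasurePreserving v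
      (measurePreserving_sub_right torusMeasure (α : Torus))] with x hx
    rw [hx, sub_add_cancel]
    rfl
  rw [h1, integral_sub_right_eq_self (μ := torusMeasure)
    (fun x : Torus => fourier (-k) (x + (α : Torus)) • v x), ← integral_const_mul]
  congr 1
  funext x
  have h2 : fourier (-k) (x + (α : Torus)) =
      Complex.exp (-(Complex.I * (k * α))) * fourier (-k) x := by
    rw [fourier_apply, zsmul_add, toCircle_add, Circle.coe_mul, ← fourier_apply, ← fourier_apply,
      fourier_coe_apply, mul_comm]
    congr 2
    have : (Real.pi : ℂ) ≠ 0 := by exact_mod_cast Real.pi_ne_zero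
    push_cast
    field_simp
  rw [h2, smul_eq_mul, smul_eq_mul, mul_assoc]

theorem exists_rotation {z z' : ℂ} (h : ‖z'‖ = ‖z‖) :
    ∃ θ : ℝ, z' = Complex.exp (-(Complex.I * θ)) * z := by
  refine ⟨z.arg - z'.arg, ?_⟩
  calc z' = ‖z‖ * Complex.exp (z'.arg * Complex.I) := by
        rw [← h, Complex.norm_mul_exp_arg_mul_I]
    _ = Complex.exp (-(Complex.I * (z.arg - z'.arg : ℝ))) *
        (‖z‖ * Complex.exp (z.arg * Complex.I)) := by
      rw [mul_left_comm, ← Complex.exp_add]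
      congr 2
      push_cast
      ring
    _ = _ := by rw [Complex.norm_mul_exp_arg_mul_I]

/-- The phase θ rotates l and the translation α rotates p independently, so the orbit contains every
pair with the given moduli. -/
theorem phaseShift_groundState {l p l' p' : ℂ} (hp : ‖p‖ < 1) (hl' : ‖l'‖ = ‖l‖)
    (hp' : ‖p'‖ = ‖p‖) : ∃ θ α : ℝ,
      posCoeff (phaseShift θ α (groundState l p hp)) = geom l' p' := by
  obtain ⟨θ, hθ⟩ := exists_rotation hl'
  obtain ⟨α, hα⟩ := exists_rotation hp'
  refine ⟨θ, α, funext fun n => ?_⟩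
  rw [posCoeff, coeff_phaseShift, coeff_groundState, if_pos (Int.natCast_nonneg n), geom, hθ, hα,
    mul_pow, ← Complex.exp_nat_mul, Int.toNat_natCast]
  have : (n : ℂ) * -(Complex.I * α) = -(Complex.I * (((n : ℤ) : ℂ) * α)) := by push_cast; ring
  rw [this]
  ring

theorem coeff_phaseShift_groundState_neg {l p : ℂ} (hp : ‖p‖ < 1) (θ α : ℝ) :
    ∀ k < 0, coeff (phaseShift θ α (groundState l p hp)) k = 0 := fun k hk => by
  rw [coeff_phaseShift, coeff_groundState, if_neg (not_le.2 hk), mul_zero, mul_zero]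

theorem posCoeff_groundState (l p : ℂ) (hp : ‖p‖ < 1) :
    posCoeff (groundState l p hp) = geom l p := funext fun n => by
  rw [posCoeff, coeff_groundState, if_pos (Int.natCast_nonneg n), Int.toNat_natCast, geom]

theorem coeff_groundState_neg (l p : ℂ) (hp : ‖p‖ < 1) :
    ∀ k < 0, coeff (groundState l p hp) k = 0 := fun k hk => by
  rw [coeff_groundState, if_neg (not_le.2 hk)]

theorem groundState_mem (l p : ℂ) (hp : ‖p‖ < 1) : groundState l p hp ∈ HHalfPlus :=
  mem_hHalfPlus_iff.2 ⟨coeff_groundState_neg l p hp, by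
    rw [posCoeff_groundState]; exact finEnergy_geom l hp⟩

/-! ### Orbital stability -/

/-- The distance to the orbit is at most the distance to any geometric sequence with parameters of
the same moduli. -/
theorem iInf_hHalfNorm_le {l p l' p' : ℂ} (hp : ‖p‖ < 1) (hl' : ‖l'‖ = ‖l‖) (hp' : ‖p'‖ = ‖p‖)
    {v : L2} (hv : v ∈ HHalfPlus) :
    ⨅ q : ℝ × ℝ, hHalfNorm (v - phaseShift q.1 q.2 (groundState l p hp)) ≤
      √(energySq (posCoeff v - geom l' p')) := by
  obtain ⟨θ, α, h⟩ := phaseShift_groundState hp hl' hp'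
  refine (ciInf_le ⟨0, ?_⟩ (θ, α)).trans_eq ?_
  · rintro _ ⟨q, rfl⟩
    exact Real.sqrt_nonneg _
  · rw [hHalfNorm_sub_eq (mem_hHalfPlus_iff.1 hv).1 (coeff_phaseShift_groundState_neg hp θ α), h]

/-- The rigidity argument divides by l, but here the profile is 0 and conservation of energy alone
gives stability with η = ε. -/
theorem orbitallyStable_zero (p : ℂ) (hp : ‖p‖ < 1) : OrbitallyStable (groundState 0 p hp) := by
  have hg : geom 0 p = 0 := funext fun n => by simp [geom]
  refine ⟨groundState_mem 0 p hp, fun ε hε => ⟨ε, hε, fun u₀ hu₀ hle =>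
    ⟨exists_isSolution hu₀, fun u hu t => ?_⟩⟩⟩
  refine (iInf_hHalfNorm_le hp (l' := 0) (p' := p) rfl rfl (hu.mem t)).trans ?_
  rw [hHalfNorm_sub_eq (mem_hHalfPlus_iff.1 hu₀).1 (coeff_groundState_neg 0 p hp),
    posCoeff_groundState, hg, sub_zero] at hle
  rw [hg, sub_zero, hu.coeffSolution.energySq_eq t]
  rwa [hu.init]

theorem orbitallyStable_groundState (l p : ℂ) (hp : ‖p‖ < 1) :
    OrbitallyStable (groundState l p hp) := by
  by_cases hl : l = 0
  · subst hl
    exact orbitallyStable_zero p hp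
  refine ⟨groundState_mem l p hp, fun ε hε => ?_⟩
  -- Failure yields data converging to the profile and times at which the solutions are ε-far from
  -- the orbit; the three conserved quantities at those times equal their initial values, so they
  -- converge and rigidity applies.
  by_contra hcon
  push Not at hcon
  have hcon' : ∀ j : ℕ, ∃ u₀ ∈ HHalfPlus, hHalfNorm (u₀ - groundState l p hp) ≤ 1 / ((j : ℝ) + 1) ∧
      ∃ u, IsSolution u₀ u ∧ ∃ t : ℝ,
        ε < ⨅ q : ℝ × ℝ, hHalfNorm (u t - phaseShift q.1 q.2 (groundState l p hp)) := by
    intro j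
    obtain ⟨u₀, h1, h2, h3⟩ := hcon (1 / ((j : ℝ) + 1)) (by positivity)
    exact ⟨u₀, h1, h2, h3 (exists_isSolution h1)⟩
  choose u₀ hu₀ hclose u hu t ht using hcon'
  have hm₀ := fun j => mem_hHalfPlus_iff.1 (hu₀ j)
  have hg := finEnergy_geom l hp
  have hlim : Tendsto (fun j => energySq (posCoeff (u₀ j) - geom l p)) atTop (𝓝 0) := by
    have h1 : Tendsto (fun j => √(energySq (posCoeff (u₀ j) - geom l p))) atTop (𝓝 0) := by
      refine squeeze_zero (fun _ => Real.sqrt_nonneg _) (fun j => ?_)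
        tendsto_one_div_add_atTop_nhds_zero_nat
      have := hclose j
      rwa [hHalfNorm_sub_eq (hm₀ j).1 (coeff_groundState_neg l p hp), posCoeff_groundState] at this
    simpa [Real.sq_sqrt (energySq_nonneg _)] using h1.pow 2
  have hsol := fun j => (hu j).coeffSolution
  have hinit : ∀ j, posCoeff (u j 0) = posCoeff (u₀ j) := fun j => by rw [(hu j).init]
  have hQ : Tendsto (fun j => massSq (posCoeff (u j (t j)))) atTop (𝓝 (massSq (geom l p))) := by
    refine (tendsto_massSq_of_energySq (fun j => (hm₀ j).2) hg hlim).congr fun j => ?_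
    rw [(hsol j).massSq_eq (t j), hinit]
  have hN : Tendsto (fun j => energySq (posCoeff (u j (t j)))) atTop
      (𝓝 (energySq (geom l p))) := by
    refine (tendsto_energySq_of_energySq (fun j => (hm₀ j).2) hg hlim).congr fun j => ?_
    rw [(hsol j).energySq_eq (t j), hinit]
  have hJ : Tendsto (fun j => ‖cubic (posCoeff (u j (t j)))‖) atTop (𝓝 ‖cubic (geom l p)‖) := by
    refine (tendsto_cubic (tendsto_apply_of_energySq (fun j => (hm₀ j).2) hg hlim)
      (eventually_energySq_le (fun j => (hm₀ j).2) hg hlim)).norm.congr fun j => ?_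
    rw [(hsol j).norm_cubic_eq (t j), hinit]
  obtain ⟨l', p', hl', hp', hconv⟩ := exists_tendsto_geom hl hp
    (fun j => (hsol j).fin (t j)) hQ hN hJ
  obtain ⟨j, hj⟩ := (hconv.eventually_lt_const (show (0 : ℝ) < ε ^ 2 by positivity)).exists
  have h1 := iInf_hHalfNorm_le hp (hl' j) (hp' j) ((hu j).mem (t j))
  have h2 := Real.sqrt_lt_sqrt (energySq_nonneg _) hj
  rw [Real.sqrt_sq hε.le] at h2
  exact absurd (ht j) (not_lt.2 (h1.trans h2.le))

end QuadSzego

end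

theorem corollary1 (l p : ℂ) (hp : ‖p‖ < 1) :
    QuadSzego.OrbitallyStable (QuadSzego.groundState l p hp) :=
  QuadSzego.orbitallyStable_groundState l p hp
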